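/- Let $d\ge 1$, $T>0$, $\xi\in(0,1)$, and let $(\Omega,\mathcal F,\mathbb P,\{\mathcal F_t\}_{t\ge0})$ be a filtered probability space satisfying the usual hypotheses. Let $N(dz,dt)$ be an $\{\mathcal F_t\}$-Poisson random measure on $\mathbf E\times[0,\infty)$ with intensity $m(dz)\,dt$, where $(\mathbf E,m)$ is $\sigma$-finite, and let $\tilde N(dz,dt)=N(dz,dt)-m(dz)\,dt$. Assume: (A1) $f:\mathbb R\to\mathbb R$ is $C^2$, nondecreasing and Lipschitz with constant $c_f$, and $f(0)=0$. (A2) $\vec v:[0,T]\times\mathbb R^d\to\mathbb R^d$ is $C^1$, and $\operatorname{div}_x\vec v=0$ and $|\vec v|\le V$ on $[0,T)\times\mathbb R^d$. (A3) There are $\lambda^*\in(0,1)$, $C^*>0$ and $h_1\in L^2(\mathbf E,m)$ with $0\le h_1\le 1$ such that $|\eta(u;z)-\eta(w;z)|\le\lambda^*|u-w|h_1(z)$ and $|\eta(u;z)|\le C^*h_1(z)$ for all $u,w\in\mathbb R$, $z\in\mathbf E$; moreover $\eta(0;z)=0$ for all $z$. Put $c_\eta=\int_{\mathbf E}h_1^2\,dm$.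 (A4) $u_0$ is an $\mathcal F_0$-measurable $L^2(\mathbb R^d)$-valued random variable with $\mathbb E\|u_0\|_2^2<\infty$. Let $\mathcal T$ be an admissible mesh of $\mathbb R^d$ with regularity constant $\alpha>0$ and size $h$: a family of disjoint, connected, bounded open polygonal sets $K$ (control volumes; polygonal means that $\partial K$ lies in a finite union of hyperplanes) whose closures cover $\mathbb R^d$, such that the common interface of two neighbouring control volumes lies in a hyperplane, $h=\sup_{K\in\mathcal T}\operatorname{diam}K<\infty$, and $\alpha h^d\le|K|$, $|\partial K|\le\frac1\alpha h^{d-1}$ for all $K\in\mathcal T$, where $|\cdot|$ denotes $d$- and $(d-1)$-dimensional Lebesgue measure, respectively. The set $\mathcal E_K$ of interfaces of $K$ consists of the sets $\sigma=K|L=\overline K\cap\overline L$ with $L\in\mathcal T$, $L\neq K$, $|\sigma|>0$; $n_{K,\sigma}$ is the unit normal to $\sigma$ outward to $K$. Let $\Delta t=T/N_t$ with $N_t\in\mathbb N$, $N_t\ge1$, and $t_n=n\Delta t$. In the $n$-th time step, $\vec v\cdot n_{K,\sigma}$ denotes the mean $\frac{1}{\Delta t|\sigma|}\int_{t_n}^{t_{n+1}}\int_\sigma\vec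 v(t,x)\cdot n_{K,\sigma}\,d\nu(x)\,dt$, with $\nu$ the $(d-1)$-dimensional Lebesgue measure. Let $u_K^n$ be the discrete unknowns of the upwind scheme: $u_K^0=\frac1{|K|}\int_Ku_0\,dx$ and, for $K\in\mathcal T$ and $0\le n\le N_t-1$, $$\frac{|K|}{\Delta t}(u_K^{n+1}-u_K^n)+\sum_{\sigma\in\mathcal E_K}|\sigma|\,\vec v\cdot n_{K,\sigma}\,f(u_\sigma^n)=\frac{|K|}{\Delta t}\int_{t_n}^{t_{n+1}}\int_{\mathbf E}\eta(u_K^n;z)\,\tilde N(dz,dt),$$ where, for $\sigma=K|L$, $u_\sigma^n=u_K^n$ if $\vec v\cdot n_{K,\sigma}\ge0$ and $u_\sigma^n=u_L^n$ if $\vec v\cdot n_{K,\sigma}<0$. Assume the CFL condition $$\Delta t\le\frac{(1-\xi)\alpha^2h}{c_fV}$$ (that is, $\Delta t\,c_fV\le(1-\xi)\alpha^2h$, so it is void if $c_fV=0$). Then: (a) There is a constant $C>0$, depending only on $T,u_0,\xi,c_f,c_\eta$, such that $$\sum_{K\in\mathcal T}\sum_{n=0}^{N_t-1}\Delta t\sum_{\sigma\in\mathcal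 E_K}|\sigma|\,|\vec v\cdot n_{K,\sigma}|\,\mathbb E\big[(f(u_\sigma^n)-f(u_K^n))^2\big]\le C.$$ (b) Let $R>h$, let $\mathcal T_R=\{K\in\mathcal T:K\subset B(0,R)\}$ and let $\mathcal E^R$ be the set of all interfaces of the elements of $\mathcal T_R$. There is a constant $C_1>0$, depending only on $R,d,T,u_0,\xi,c_f,c_\eta,V,\alpha$, such that $$\sum_{n=0}^{N_t-1}\Delta t\sum_{\sigma\in\mathcal E^R}|\sigma|\,|\vec v\cdot n_{K,\sigma}|\,\mathbb E\big[|f(u_\sigma^n)-f(u_K^n)|\big]\le C_1h^{-1/2},$$ where for each $\sigma\in\mathcal E^R$ and each $n$, $K$ may be either of the two control volumes adjacent to $\sigma$ (the summand vanishes for the upstream one, and the bound holds for the downstream one). -/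

import Mathlib

open MeasureTheory ProbabilityTheory Filter Set
open scoped NNReal ENNReal Topology InnerProductSpace

namespace FVScheme

/-- `ℝ^d` with its Euclidean norm. -/
abbrev Rd (d : ℕ) : Type := EuclideanSpace ℝ (Fin d)

/-! ### Meshes -/

/-- A polygonal set: a bounded open set whose boundary lies in a finite union of hyperplanes. -/
structure IsPolygonal {d : ℕ} (K : Set (Rd d)) : Prop where
  isOpen : IsOpen K
  isBounded : Bornology.IsBounded K
  frontier_subset : ∃ F : Finset (Rd d × ℝ), (∀ p ∈ F, p.1 ≠ 0) ∧
    frontier K ⊆ ⋃ p ∈ F, {x | ⟪p.1, x⟫_ℝ = p.2}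

/-- The common interface `K|L`. -/
def interface {d : ℕ} (K L : Set (Rd d)) : Set (Rd d) := closure K ∩ closure L

/-- The `(d-1)`-dimensional Lebesgue measure `dν` on subsets of `ℝ^d` (`d ≥ 1`), normalised so
that it is the usual surface measure; it is the counting measure for `d = 1`. -/
noncomputable abbrev surf (d : ℕ) : Measure (Rd d) := μHE[d - 1]

/-- `𝒩(K)`: the control volumes of `𝒯` that share with `K` an interface of positive
`(d-1)`-dimensional measure. The interfaces of `K` are the sets `K|L` with `L ∈ 𝒩(K)`. -/
def neighbors {d : ℕ} (𝒯 : Set (Set (Rd d))) (K : Set (Rd d)) : Set (Set (Rd d)) :=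
  {L | L ∈ 𝒯 ∧ L ≠ K ∧ 0 < surf d (interface K L)}

/-- Admissible mesh of `ℝ^d` with regularity constant `α > 0` and size `h`. -/
structure IsAdmissibleMesh {d : ℕ} (𝒯 : Set (Set (Rd d))) (α h : ℝ) : Prop where
  polygonal : ∀ K ∈ 𝒯, IsPolygonal K
  connected : ∀ K ∈ 𝒯, IsConnected K
  disjoint : ∀ K ∈ 𝒯, ∀ L ∈ 𝒯, K ≠ L → Disjoint K L
  cover : ⋃ K ∈ 𝒯, closure K = univ
  flat : ∀ K ∈ 𝒯, ∀ L ∈ neighbors 𝒯 K, ∃ (a : Rd d) (c : ℝ), a ≠ 0 ∧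
    interface K L ⊆ {x | ⟪a, x⟫_ℝ = c}
  size : IsLUB (Metric.diam '' 𝒯) h
  alpha_pos : 0 < α
  volume_ge : ∀ K ∈ 𝒯, ENNReal.ofReal (α * h ^ d) ≤ volume K
  boundary_le : ∀ K ∈ 𝒯, surf d (frontier K) ≤ ENNReal.ofReal (1 / α * h ^ (d - 1))

/-- `n` is the outward unit normal to `K` at the boundary point `x`: near `x`, the set `K`
coincides, off the hyperplane through `x` orthogonal to `n`, with the half-space `n` points out of. -/
def IsOutwardNormalAt {d : ℕ} (K : Set (Rd d)) (x n : Rd d) : Prop :=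
  ‖n‖ = 1 ∧ ∃ r > 0, ∀ y ∈ Metric.ball x r,
    (⟪y - x, n⟫_ℝ < 0 → y ∈ K) ∧ (0 < ⟪y - x, n⟫_ℝ → y ∉ K)

open Classical in
/-- The outward unit normal to `K` at `x` (unique where it exists; `0` elsewhere, which for a
polygonal `K` concerns no more than a null set of points of each interface). -/
noncomputable def outwardNormal {d : ℕ} (K : Set (Rd d)) (x : Rd d) : Rd d :=
  if h : ∃ n, IsOutwardNormalAt K x n then h.choose else 0

/-- The number `v · n_{K,σ}`, `σ = K|L`, of a time step `[a, b]`: the mean of `v(t,x) · n_{K,σ}`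
over `[a, b] × σ`. -/
noncomputable def normalVelocity {d : ℕ} (v : ℝ → Rd d → Rd d) (K L : Set (Rd d)) (a b : ℝ) : ℝ :=
  1 / ((b - a) * (surf d (interface K L)).toReal) *
    ∫ t in a..b, ∫ x in interface K L, ⟪v t x, outwardNormal K x⟫_ℝ ∂(surf d)

/-! ### Assumptions on the data -/

/-- Flux: `C²`, nondecreasing, Lipschitz with constant `cf`, vanishing at `0`. -/
structure FluxAssumption (f : ℝ → ℝ) (cf : ℝ≥0) : Prop where
  contDiff : ContDiff ℝ 2 f
  monotone : Monotone f
  lipschitz : LipschitzWith cf f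
  map_zero : f 0 = 0

/-- Velocity: `C¹` on `[0,T] × ℝ^d`, divergence free and bounded by `V` on `[0,T) × ℝ^d`. -/
structure VelocityAssumption {d : ℕ} (v : ℝ → Rd d → Rd d) (T V : ℝ) : Prop where
  contDiffOn : ContDiffOn ℝ 1 (fun p : ℝ × Rd d => v p.1 p.2) (Icc 0 T ×ˢ univ)
  div_free : ∀ t ∈ Ico 0 T, ∀ x : Rd d,
    ∑ i : Fin d, fderiv ℝ (v t) x (EuclideanSpace.single i 1) i = 0
  bounded : ∀ t ∈ Ico 0 T, ∀ x : Rd d, ‖v t x‖ ≤ V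

/-- Noise coefficient; `cη` is the integral of the square of the dominating function `h₁`. -/
structure NoiseAssumption {E : Type*} [MeasurableSpace E] (m : Measure E) (η : ℝ → E → ℝ)
    (cη : ℝ) : Prop where
  measurable : ∀ u, Measurable (η u)
  bounds : ∃ (lam Cstar : ℝ) (h₁ : E → ℝ), 0 < lam ∧ lam < 1 ∧ 0 < Cstar ∧ MemLp h₁ 2 m ∧
    (∀ z, 0 ≤ h₁ z ∧ h₁ z ≤ 1) ∧ ∫ z, h₁ z ^ 2 ∂m = cη ∧
    (∀ u w z, |η u z - η w z| ≤ lam * |u - w| * h₁ z) ∧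
    (∀ u z, |η u z| ≤ Cstar * h₁ z)
  map_zero : ∀ z, η 0 z = 0

/-! ### Poisson random measures and the stochastic integral -/

/-- The usual hypotheses on a filtration. -/
structure UsualConditions {Ω : Type*} [mΩ : MeasurableSpace Ω] (P : Measure Ω)
    (ℱ : Filtration ℝ≥0 mΩ) : Prop where
  rightContinuous : ℱ.IsRightContinuous
  null : ∀ s : Set Ω, P s = 0 → MeasurableSet[ℱ 0] s

/-- `N` is a Poisson random measure on `Θ` with intensity measure `ρ`. -/
structure IsPoissonRandomMeasure {Ω Θ : Type*} [MeasurableSpace Ω] [MeasurableSpace Θ]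
    (P : Measure Ω) (ρ : Measure Θ) (N : Ω → Measure Θ) : Prop where
  measurable : ∀ B, MeasurableSet B → Measurable fun ω => N ω B
  integer_valued : ∀ ω B, MeasurableSet B → ∃ k : ℕ∞, N ω B = (k : ℝ≥0∞)
  law : ∀ B, MeasurableSet B → ρ B ≠ ∞ →
    P.map (fun ω => N ω B) = (poissonMeasure (ρ B).toNNReal).map (fun k : ℕ => (k : ℝ≥0∞))
  law_top : ∀ B, MeasurableSet B → ρ B = ∞ → ∀ᵐ ω ∂P, N ω B = ∞
  indep : ∀ (k : ℕ) (B : Fin k → Set Θ), (∀ i, MeasurableSet (B i)) →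
    Pairwise (fun i j => Disjoint (B i) (B j)) → iIndepFun (fun i ω => N ω (B i)) P

/-- `N(dz, dt)` is a Poisson random measure on `[0,∞) × E` with intensity `dt m(dz)`, relative
to the filtration `ℱ`: its restriction to `[0,t] × E` is `ℱ t`-measurable and its restriction to
`(t,∞) × E` is independent of `ℱ t`. -/
structure IsPoissonNoise {Ω E : Type*} [mΩ : MeasurableSpace Ω] [MeasurableSpace E]
    (P : Measure Ω) (ℱ : Filtration ℝ≥0 mΩ) (m : Measure E) (N : Ω → Measure (ℝ × E)) : Prop where
  poisson : IsPoissonRandomMeasure P (((volume : Measure ℝ).restrict (Ici 0)).prod m) N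
  adapted : ∀ (t : ℝ≥0) (B : Set (ℝ × E)), MeasurableSet B → B ⊆ Icc 0 (t : ℝ) ×ˢ univ →
    Measurable[ℱ t] fun ω => N ω B
  indep : ∀ t : ℝ≥0, Indep
    (⨆ B ∈ {B : Set (ℝ × E) | MeasurableSet B ∧ B ⊆ Ioi (t : ℝ) ×ˢ univ},
      MeasurableSpace.comap (fun ω => N ω B) inferInstance) (ℱ t) P

/-- A simple predictable function
`∑ i, ∑ j, ξ i j (ω) 1_{(τ i, τ (i+1)]}(t) 1_{A j}(z)`. -/
structure SimplePredictable {Ω E : Type*} [mΩ : MeasurableSpace Ω] [MeasurableSpace E]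
    (ℱ : Filtration ℝ≥0 mΩ) (m : Measure E) where
  p : ℕ
  q : ℕ
  τ : Fin (p + 1) → ℝ≥0
  τ_strictMono : StrictMono τ
  A : Fin q → Set E
  A_measurable : ∀ j, MeasurableSet (A j)
  A_finite : ∀ j, m (A j) < ∞
  A_disjoint : Pairwise fun i j => Disjoint (A i) (A j)
  ξ : Fin p → Fin q → Ω → ℝ
  ξ_measurable : ∀ i j, Measurable[ℱ (τ i.castSucc)] (ξ i j)
  ξ_bounded : ∀ i j, ∃ M : ℝ, ∀ ω, |ξ i j ω| ≤ M

namespace SimplePredictable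

variable {Ω E : Type*} [mΩ : MeasurableSpace Ω] [MeasurableSpace E]
  {ℱ : Filtration ℝ≥0 mΩ} {m : Measure E}

/-- The values of a simple predictable function. -/
noncomputable def val (S : SimplePredictable ℱ m) (ω : Ω) (t : ℝ) (z : E) : ℝ :=
  ∑ i : Fin S.p, ∑ j : Fin S.q, S.ξ i j ω *
    (Ioc (S.τ i.castSucc : ℝ) (S.τ i.succ)).indicator 1 t * (S.A j).indicator 1 z

/-- The integral of a simple predictable function over `(a, b] × E` (`0 ≤ a`) against the
compensated measure `N(dz,dt) - m(dz) dt`. -/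
noncomputable def integral (S : SimplePredictable ℱ m) (N : Ω → Measure (ℝ × E)) (a b : ℝ)
    (ω : Ω) : ℝ :=
  ∑ i : Fin S.p, ∑ j : Fin S.q, S.ξ i j ω *
    ((N ω ((Ioc (S.τ i.castSucc : ℝ) (S.τ i.succ) ∩ Ioc a b) ×ˢ S.A j)).toReal -
      (volume (Ioc (S.τ i.castSucc : ℝ) (S.τ i.succ) ∩ Ioc a b) * m (S.A j)).toReal)

end SimplePredictable

/-- `I = ∫_a^b ∫_E φ(t,z) Ñ(dz,dt)`: `φ` is the limit in `L²(Ω × (a,b] × E)` of simple predictable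
functions whose integrals converge to `I` in `L²(Ω)`. This determines `I` almost surely. -/
def IsStochasticIntegral {Ω E : Type*} [mΩ : MeasurableSpace Ω] [MeasurableSpace E]
    (P : Measure Ω) (ℱ : Filtration ℝ≥0 mΩ) (m : Measure E) (N : Ω → Measure (ℝ × E)) (a b : ℝ)
    (φ : Ω → ℝ → E → ℝ) (I : Ω → ℝ) : Prop :=
  AEStronglyMeasurable I P ∧ ∃ S : ℕ → SimplePredictable ℱ m,
    Tendsto (fun k => ∫⁻ ω, ∫⁻ t in Ioc a b, ∫⁻ z, ‖(S k).val ω t z - φ ω t z‖ₑ ^ 2 ∂m ∂volume ∂P)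
      atTop (𝓝 0) ∧
    Tendsto (fun k => ∫⁻ ω, ‖(S k).integral N a b ω - I ω‖ₑ ^ 2 ∂P) atTop (𝓝 0)

/-! ### The upwind finite volume scheme -/

/-- The upstream value `u_σ` on `σ = K|L`, where `w = v · n_{K,σ}`. -/
noncomputable def upstream (w uK uL : ℝ) : ℝ := if 0 ≤ w then uK else uL

/-- `u_σ^n` on `σ = K|L` for the time step `Δt`. -/
noncomputable def uInterface {d : ℕ} {Ω : Type*} (v : ℝ → Rd d → Rd d) (Δt : ℝ)
    (u : ℕ → Set (Rd d) → Ω → ℝ) (n : ℕ) (K L : Set (Rd d)) (ω : Ω) : ℝ :=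
  upstream (normalVelocity v K L (n * Δt) ((n + 1) * Δt)) (u n K ω) (u n L ω)

/-- `u n K`, for `K ∈ 𝒯` and `n ≤ Nt`, are the discrete unknowns `u_K^n` of the upwind finite
volume scheme with time step `Δt`. -/
structure IsUpwindSolution {d : ℕ} {Ω E : Type*} [mΩ : MeasurableSpace Ω] [MeasurableSpace E]
    (P : Measure Ω) (ℱ : Filtration ℝ≥0 mΩ) (m : Measure E) (N : Ω → Measure (ℝ × E))
    (f : ℝ → ℝ) (v : ℝ → Rd d → Rd d) (η : ℝ → E → ℝ)
    (u₀ : Ω → Lp ℝ 2 (volume : Measure (Rd d))) (𝒯 : Set (Set (Rd d))) (Δt : ℝ) (Nt : ℕ)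
    (u : ℕ → Set (Rd d) → Ω → ℝ) : Prop where
  init : ∀ K ∈ 𝒯, ∀ᵐ ω ∂P, u 0 K ω = 1 / (volume K).toReal * ∫ x in K, u₀ ω x
  step : ∀ K ∈ 𝒯, ∀ n < Nt, ∃ I : Ω → ℝ,
    IsStochasticIntegral P ℱ m N (n * Δt) ((n + 1) * Δt) (fun ω _ z => η (u n K ω) z) I ∧
    ∀ᵐ ω ∂P, (volume K).toReal / Δt * (u (n + 1) K ω - u n K ω) +
      ∑ᶠ L ∈ neighbors 𝒯 K, (surf d (interface K L)).toReal *
        normalVelocity v K L (n * Δt) ((n + 1) * Δt) * f (uInterface v Δt u n K L ω) =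
      (volume K).toReal / Δt * I ω

/-- `𝒯_R`: the control volumes contained in the ball `B(0,R)`. -/
def meshInBall {d : ℕ} (𝒯 : Set (Set (Rd d))) (R : ℝ) : Set (Set (Rd d)) :=
  {K | K ∈ 𝒯 ∧ K ⊆ Metric.ball 0 R}

end FVScheme

open FVScheme

/-! The estimate is an `L²` energy balance for the upwind scheme. A divergence-free velocity has
zero net flux through the boundary of a cell, so the flux term equals minus the sum over neighbours
of the inflow times `f(u_L) - f(u_K)`. One step then reads `u_K^{n+1} = transported + I`, with `I`
the stochastic integral (`finsum_flux_eq`, `exists_step`).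

Noise: the transported value is known at time `t_n`, hence orthogonal to `I`, and the isometry
together with `|η(u;z)| ≤ |u| h₁(z)` bounds `E I²` by `Δt cη E (u_K^n)²` (`integral_sq_succ_le`).
The integral is only given as an `L²` limit, so adaptedness, orthogonality and the isometry bound
are proved for simple integrands, from the independence of the Poisson measure, and passed to the
limit.

Transport: let `Φ` be the primitive of `s f'(s)`. Since `f` is nondecreasing with `f' ≤ cf`, the
product `2 cf x (f x - f y)` dominates `(f y - f x)² + 2 cf (Φ x - Φ y)` (`entropy_inequality`).
After expanding the square of the transported value, Cauchy–Schwarz and the CFL condition absorb the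
quadratic term into a share `1 - ξ` of this dissipation, and the share `ξ` survives
(`upwind_energy`). Keeping the factor `cf` throughout avoids dividing by it.

Summation: total inflow and total outflow of each cell agree, so the differences of `Φ` cancel over
the mesh (`hasSum_exchange`). The mesh is infinite, so summability of the energies is propagated in
time along with the inequality (`sum_energy_succ_le`). A discrete Gronwall argument gives (a) with
the bound `cf / ξ * exp (cη T) * E ‖u₀‖²`.

For (b), Young's inequality with parameter `h^(-1/2)` combines (a) with a bound of order `1 / h` for
the total flux through the interfaces of the cells in the ball, which comes from the volume and
perimeter bounds of the mesh (`sum_abs_jump_le`).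

The zero net flux rests on a Gauss–Green formula for polygonal cells
(`IsPolygonal.integral_fderiv`), where the normal is defined pointwise by the local shape of the
cell. The difference quotient of the indicator of `K` is distributed over the hyperplanes that carry
the boundary, and each share is blown up near its hyperplane. Almost every boundary point with a
normal lies on exactly one interface, and the normals seen from its two sides are opposite. -/

namespace FVScheme

/-! ### Hyperplanes -/

/-- The hyperplane with normal `n` and offset `c`. -/
def hyperplane {d : ℕ} (n : Rd d) (c : ℝ) : Set (Rd d) := {x | ⟪n, x⟫_ℝ = c}

lemma isClosed_hyperplane {d : ℕ} (n : Rd d) (c : ℝ) : IsClosed (hyperplane n c) :=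
  isClosed_eq (by fun_prop) continuous_const

lemma hyperplane_neg {d : ℕ} (n : Rd d) (c : ℝ) : hyperplane (-n) (-c) = hyperplane n c := by
  ext x; simp [hyperplane]

/-- `𝓗` is a finite set of (pairwise distinct) hyperplanes covering the boundary of `K`. -/
structure IsHyperplaneCover {d : ℕ} (K : Set (Rd d)) (𝓗 : Finset (Set (Rd d))) : Prop where
  isHyperplane : ∀ H ∈ 𝓗, ∃ (n : Rd d) (c : ℝ), ‖n‖ = 1 ∧ H = hyperplane n c
  frontier_subset : frontier K ⊆ ⋃ H ∈ 𝓗, H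

/-- Taking the image in sets identifies different equations of the same hyperplane, so that two
distinct members of the cover meet in a null set. -/
lemma IsPolygonal.exists_cover {d : ℕ} {K : Set (Rd d)} (hK : IsPolygonal K) :
    ∃ 𝓗, IsHyperplaneCover K 𝓗 := by
  classical
  obtain ⟨F, hF, hsub⟩ := hK.frontier_subset
  refine ⟨F.image fun p => hyperplane p.1 p.2, ⟨?_, ?_⟩⟩
  · intro H hH
    obtain ⟨p, hp, rfl⟩ := Finset.mem_image.1 hH
    have hp0 : ‖p.1‖ ≠ 0 := norm_ne_zero_iff.2 (hF p hp)
    refine ⟨‖p.1‖⁻¹ • p.1, ‖p.1‖⁻¹ * p.2, ?_, ?_⟩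
    · rw [norm_smul, norm_inv, norm_norm, inv_mul_cancel₀ hp0]
    · ext x
      simp [hyperplane, real_inner_smul_left, hp0]
  · rw [Finset.set_biUnion_finset_image]
    exact hsub

/-- Orthogonal coordinates `(r, w) ↦ r n + w + p` adapted to a unit vector `n`. -/
noncomputable def slabEquiv {d : ℕ} (n : Rd d) (hn : ‖n‖ = 1) (p : Rd d) :
    ℝ × (ℝ ∙ n)ᗮ ≃ᵐ Rd d :=
  ((LinearIsometryEquiv.toSpanUnitSingleton (𝕜 := ℝ) n hn).toHomeomorph.toMeasurableEquiv.prodCongr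
    (MeasurableEquiv.refl _)).trans ((ℝ ∙ n).measurableEquivProd p).symm

lemma slabEquiv_apply {d : ℕ} (n : Rd d) (hn : ‖n‖ = 1) (p : Rd d) (q : ℝ × (ℝ ∙ n)ᗮ) :
    slabEquiv n hn p q = q.1 • n + q.2 + p := by
  change ((ℝ ∙ n).measurableEquivProd p).symm
    (LinearIsometryEquiv.toSpanUnitSingleton (𝕜 := ℝ) n hn q.1, q.2) = _
  simp

lemma measurePreserving_slabEquiv {d : ℕ} (n : Rd d) (hn : ‖n‖ = 1) (p : Rd d) :
    MeasurePreserving (slabEquiv n hn p) (volume.prod volume) volume := by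
  have h1 := (LinearIsometryEquiv.toSpanUnitSingleton (𝕜 := ℝ) n hn).measurePreserving.prod
    (MeasurePreserving.id (volume : Measure (ℝ ∙ n)ᗮ))
  have h2 := ((ℝ ∙ n).measurePreserving_measurableEquivProd p).symm
  rw [InnerProductSpace.euclideanHausdorffMeasure_eq_volume] at h2
  exact h2.comp h1

lemma finrank_orthogonal {d : ℕ} {n : Rd d} (hn : ‖n‖ = 1) :
    Module.finrank ℝ (ℝ ∙ n)ᗮ = d - 1 := by
  have h := Submodule.finrank_add_finrank_orthogonal (ℝ ∙ n)
  rw [finrank_span_singleton (by rintro rfl; simp at hn), finrank_euclideanSpace_fin] at h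
  omega

lemma isometry_orthogonal_add {d : ℕ} (n p : Rd d) :
    Isometry fun w : (ℝ ∙ n)ᗮ => (w : Rd d) + p :=
  (IsometryEquiv.addRight p).isometry.comp isometry_subtype_coe

lemma range_orthogonal_add {d : ℕ} (n p : Rd d) :
    range (fun w : (ℝ ∙ n)ᗮ => (w : Rd d) + p) = hyperplane n ⟪n, p⟫_ℝ := by
  ext x
  constructor
  · rintro ⟨w, rfl⟩
    have := Submodule.mem_orthogonal_singleton_iff_inner_right.1 w.2
    simp [hyperplane, inner_add_right, this]
  · intro hx
    refine ⟨⟨x - p, Submodule.mem_orthogonal_singleton_iff_inner_right.2 ?_⟩, by simp⟩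
    rw [inner_sub_right, sub_eq_zero]; exact hx

/-- An isometry transports the normalised Hausdorff measure, which is Lebesgue measure on the
`(d-1)`-dimensional space `nᗮ`. Surface integrals over a hyperplane thus become Lebesgue integrals.
-/
lemma map_orthogonal_add {d : ℕ} {n : Rd d} (hn : ‖n‖ = 1) (p : Rd d) :
    (volume : Measure (ℝ ∙ n)ᗮ).map (fun w : (ℝ ∙ n)ᗮ => (w : Rd d) + p) =
      (surf d).restrict (hyperplane n ⟪n, p⟫_ℝ) := by
  rw [← range_orthogonal_add, ← (isometry_orthogonal_add n p).map_euclideanHausdorffMeasure,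
    ← InnerProductSpace.euclideanHausdorffMeasure_eq_volume, finrank_orthogonal hn]

lemma measurableEmbedding_orthogonal_add {d : ℕ} (n p : Rd d) :
    MeasurableEmbedding fun w : (ℝ ∙ n)ᗮ => (w : Rd d) + p :=
  (isometry_orthogonal_add n p).isClosedEmbedding.measurableEmbedding

lemma exists_mem_hyperplane {d : ℕ} {n : Rd d} (hn : ‖n‖ = 1) (c : ℝ) :
    ∃ p : Rd d, ⟪n, p⟫_ℝ = c :=
  ⟨c • n, by rw [real_inner_smul_right, real_inner_self_eq_norm_sq, hn]; ring⟩

/-- With the base point in the intersection, the second hyperplane cuts out a linear subspace of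
`nᗮ`. It is proper, since otherwise `n'` would lie in `nᗮᗮ = ℝ n` and the hyperplanes would
coincide. -/
lemma surf_hyperplane_inter_null {d : ℕ} {H H' : Set (Rd d)}
    (hH : ∃ (n : Rd d) (c : ℝ), ‖n‖ = 1 ∧ H = hyperplane n c)
    (hH' : ∃ (n : Rd d) (c : ℝ), ‖n‖ = 1 ∧ H' = hyperplane n c) (hne : H ≠ H') :
    surf d (H ∩ H') = 0 := by
  obtain ⟨n, c, hn, rfl⟩ := hH
  obtain ⟨n', c', hn', rfl⟩ := hH'
  rcases (hyperplane n c ∩ hyperplane n' c').eq_empty_or_nonempty with h0 | ⟨p, hp, hp'⟩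
  · simp [h0]
  have hpc : ⟪n, p⟫_ℝ = c := hp
  have hpc' : ⟪n', p⟫_ℝ = c' := hp'
  have key := map_orthogonal_add hn p
  rw [hpc] at key
  have : surf d (hyperplane n c ∩ hyperplane n' c') =
      volume ((fun w : (ℝ ∙ n)ᗮ => (w : Rd d) + p) ⁻¹' hyperplane n' c') := by
    rw [← (measurableEmbedding_orthogonal_add n p).map_apply, key,
      Measure.restrict_apply (isClosed_hyperplane _ _).measurableSet, inter_comm]
  rw [this]
  let ℓ : (ℝ ∙ n)ᗮ →ₗ[ℝ] ℝ := (innerₛₗ ℝ n').comp (Submodule.subtype _)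
  have hset : ((fun w : (ℝ ∙ n)ᗮ => (w : Rd d) + p) ⁻¹' hyperplane n' c') = LinearMap.ker ℓ := by
    ext w
    simp [ℓ, hyperplane, inner_add_right, hpc']
  rw [hset]
  apply Measure.addHaar_submodule
  intro htop
  apply hne
  have hperp : n' ∈ (ℝ ∙ n)ᗮᗮ := by
    rw [Submodule.mem_orthogonal']
    intro w hw
    have : (⟨w, hw⟩ : (ℝ ∙ n)ᗮ) ∈ LinearMap.ker ℓ := by rw [htop]; trivial
    simpa [ℓ] using this
  rw [Submodule.orthogonal_orthogonal] at hperp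
  obtain ⟨a, rfl⟩ := Submodule.mem_span_singleton.1 hperp
  have ha : a ≠ 0 := by rintro rfl; simp at hn'
  ext x
  simp only [hyperplane, mem_ofPred_eq, real_inner_smul_left] at *
  rw [← hpc, ← hpc']
  constructor
  · intro h; rw [h]
  · intro h; exact mul_left_cancel₀ ha h

/-! ### Local structure of a polygonal set at a regular boundary point -/

/-- If the normals differed, a small step from `x` along `n₁ - n₂` would leave `K` according to `n₁`
and enter it according to `n₂`. -/
lemma IsOutwardNormalAt.unique {d : ℕ} {K : Set (Rd d)} {x n₁ n₂ : Rd d}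
    (h₁ : IsOutwardNormalAt K x n₁) (h₂ : IsOutwardNormalAt K x n₂) : n₁ = n₂ := by
  obtain ⟨hn₁, r₁, hr₁, H₁⟩ := h₁
  obtain ⟨hn₂, r₂, hr₂, H₂⟩ := h₂
  by_contra hne
  have hlt : ⟪n₁, n₂⟫_ℝ < 1 := by
    refine lt_of_le_of_ne ?_ fun h => hne ?_
    · simpa [hn₁, hn₂] using real_inner_le_norm n₁ n₂
    · exact (inner_eq_one_iff_of_norm_eq_one hn₁ hn₂).1 h
  have hpos : 0 < ‖n₁ - n₂‖ := norm_pos_iff.2 (sub_ne_zero.2 hne)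
  set ε := min r₁ r₂ / (2 * ‖n₁ - n₂‖) with hε
  have hε0 : 0 < ε := by positivity
  have hz : ‖ε • (n₁ - n₂)‖ < min r₁ r₂ := by
    rw [norm_smul, Real.norm_of_nonneg hε0.le, hε]
    have : 0 < min r₁ r₂ := lt_min hr₁ hr₂
    field_simp
    linarith
  have hz₁ : x + ε • (n₁ - n₂) ∈ Metric.ball x r₁ := by
    simpa using hz.trans_le (min_le_left _ _)
  have hz₂ : x + ε • (n₁ - n₂) ∈ Metric.ball x r₂ := by
    simpa using hz.trans_le (min_le_right _ _)
  refine (H₁ _ hz₁).2 ?_ ((H₂ _ hz₂).1 ?_)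
  · rw [add_sub_cancel_left, real_inner_smul_left, inner_sub_left, real_inner_self_eq_norm_sq, hn₁,
      real_inner_comm]
    exact mul_pos hε0 (by linarith)
  · rw [add_sub_cancel_left, real_inner_smul_left, inner_sub_left, real_inner_self_eq_norm_sq, hn₂]
    exact mul_neg_of_pos_of_neg hε0 (by linarith)

lemma IsOutwardNormalAt.outwardNormal_eq {d : ℕ} {K : Set (Rd d)} {x n : Rd d}
    (h : IsOutwardNormalAt K x n) : outwardNormal K x = n := by
  have hex : ∃ n, IsOutwardNormalAt K x n := ⟨n, h⟩
  rw [outwardNormal, dif_pos hex]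
  exact hex.choose_spec.unique h

lemma outwardNormal_eq_zero {d : ℕ} {K : Set (Rd d)} {x : Rd d}
    (h : ¬ ∃ n, IsOutwardNormalAt K x n) : outwardNormal K x = 0 := by
  rw [outwardNormal, dif_neg h]

lemma norm_outwardNormal_le {d : ℕ} (K : Set (Rd d)) (x : Rd d) : ‖outwardNormal K x‖ ≤ 1 := by
  by_cases h : ∃ n, IsOutwardNormalAt K x n
  · obtain ⟨n, hn⟩ := h
    rw [hn.outwardNormal_eq, hn.1]
  · simp [outwardNormal_eq_zero h]

/-- Near `x`, the set `K` contains the half-space which `n` points out of. -/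
def HalfBallIn {d : ℕ} (K : Set (Rd d)) (x n : Rd d) : Prop :=
  ‖n‖ = 1 ∧ ∃ r > 0, ∀ y ∈ Metric.ball x r, ⟪y - x, n⟫_ℝ < 0 → y ∈ K

lemma exists_small_smul_mem_ball {d : ℕ} (x z : Rd d) {r : ℝ} (hr : 0 < r) :
    ∃ ε : ℝ, 0 < ε ∧ x + ε • z ∈ Metric.ball x r ∧ x - ε • z ∈ Metric.ball x r := by
  refine ⟨r / (2 * (‖z‖ + 1)), by positivity, ?_⟩
  have : ‖(r / (2 * (‖z‖ + 1))) • z‖ < r := by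
    rw [norm_smul, Real.norm_of_nonneg (by positivity), div_mul_eq_mul_div,
      div_lt_iff₀ (by positivity)]
    nlinarith [norm_nonneg z]
  constructor <;> simpa [dist_eq_norm] using this

/-- Unless `n' = -n`, the direction `-(n + n')` points into both open half-spaces, and the disjoint
sets would share a point. -/
lemma HalfBallIn.eq_neg {d : ℕ} {K L : Set (Rd d)} {x n n' : Rd d} (hK : HalfBallIn K x n)
    (hL : HalfBallIn L x n') (hKL : Disjoint K L) : n' = -n := by
  obtain ⟨hn, r, hr, H⟩ := hK
  obtain ⟨hn', r', hr', H'⟩ := hL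
  by_contra hne
  have hlt : -1 < ⟪n, n'⟫_ℝ := by
    refine lt_of_le_of_ne ?_ fun h => hne ?_
    · have := neg_le_of_abs_le (abs_real_inner_le_norm n n')
      simpa [hn, hn'] using this
    · have : ⟪-n, n'⟫_ℝ = 1 := by rw [inner_neg_left, ← h]; norm_num
      exact ((inner_eq_one_iff_of_norm_eq_one (by simpa using hn) hn').1 this).symm
  obtain ⟨ε, hε, -, hz⟩ := exists_small_smul_mem_ball x (n + n') (lt_min hr hr')
  refine disjoint_left.1 hKL
    (H _ (Metric.ball_subset_ball (min_le_left _ _) hz) ?_)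
    (H' _ (Metric.ball_subset_ball (min_le_right _ _) hz) ?_)
  · rw [sub_sub_cancel_left, inner_neg_left, real_inner_smul_left, inner_add_left,
      real_inner_self_eq_norm_sq, hn, real_inner_comm]
    exact neg_neg_of_pos (mul_pos hε (by linarith))
  · rw [sub_sub_cancel_left, inner_neg_left, real_inner_smul_left, inner_add_left,
      real_inner_self_eq_norm_sq, hn']
    exact neg_neg_of_pos (mul_pos hε (by linarith))

/-- The opposite half ball is filled by `L`, so `K` cannot enter it. -/
lemma HalfBallIn.isOutwardNormalAt {d : ℕ} {K L : Set (Rd d)} {x n n' : Rd d}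
    (hK : HalfBallIn K x n) (hL : HalfBallIn L x n') (hKL : Disjoint K L) :
    IsOutwardNormalAt K x n := by
  have hn' := hK.eq_neg hL hKL
  subst hn'
  obtain ⟨hn, r, hr, H⟩ := hK
  obtain ⟨-, r', hr', H'⟩ := hL
  refine ⟨hn, min r r', lt_min hr hr', fun y hy => ⟨H y ?_, fun h => ?_⟩⟩
  · exact Metric.ball_subset_ball (min_le_left _ _) hy
  · refine disjoint_right.1 hKL (H' y (Metric.ball_subset_ball (min_le_right _ _) hy) ?_)
    rw [inner_neg_right]; linarith

/-- A preconnected set that avoids the boundary of `K` lies in `K` or off `K`. -/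
lemma subset_or_disjoint_of_disjoint_frontier {X : Type*} [TopologicalSpace X] {s K : Set X}
    (hs : IsPreconnected s) (h : Disjoint s (frontier K)) : s ⊆ K ∨ Disjoint s K := by
  by_contra! hcon
  obtain ⟨hcon₁, hcon₂⟩ := hcon
  obtain ⟨x, hx, hxK⟩ := not_subset.1 hcon₁
  obtain ⟨y, hy, hyK⟩ := not_disjoint_iff.1 hcon₂
  have hf : ∀ z ∈ s, z ∈ closure K → z ∈ interior K := fun z hz hzK => by
    by_contra hzi
    exact disjoint_left.1 h hz ⟨hzK, hzi⟩
  obtain ⟨z, -, hz₁, hz₂⟩ := hs (interior K) (closure K)ᶜ isOpen_interior isClosed_closure.isOpen_compl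
    (fun z hz => by by_cases hzK : z ∈ closure K <;> simp [hzK, hf z hz])
    ⟨y, hy, hf y hy (subset_closure hyK)⟩
    ⟨x, hx, fun hxc => hxK (interior_subset (hf x hx hxc))⟩
  exact hz₂ (interior_subset_closure hz₁)

lemma convex_halfBall {d : ℕ} (y n : Rd d) (r : ℝ) :
    Convex ℝ (Metric.ball y r ∩ {z | ⟪z - y, n⟫_ℝ < 0}) := by
  refine (convex_ball y r).inter ?_
  have : {z : Rd d | ⟪z - y, n⟫_ℝ < 0} = {z | innerₛₗ ℝ n z < ⟪n, y⟫_ℝ} := by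
    ext z
    simp [inner_sub_left, real_inner_comm]
  rw [this]
  exact convex_halfSpace_lt (LinearMap.isLinear _) _

lemma IsHyperplaneCover.exists_ball_disjoint {d : ℕ} {K : Set (Rd d)} {𝓗 : Finset (Set (Rd d))}
    (h𝓗 : IsHyperplaneCover K 𝓗) {y : Rd d} {H₀ : Set (Rd d)}
    (hgood : ∀ H ∈ 𝓗, H ≠ H₀ → y ∉ H) :
    ∃ r > 0, ∀ H ∈ 𝓗, H ≠ H₀ → Disjoint (Metric.ball y r) H := by
  classical
  have hclosed : IsClosed (⋃ H ∈ 𝓗.filter (· ≠ H₀), H) := by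
    refine isClosed_biUnion_finset fun H hH => ?_
    obtain ⟨n', c', -, rfl⟩ := h𝓗.isHyperplane H (Finset.mem_filter.1 hH).1
    exact isClosed_hyperplane _ _
  have hy' : y ∈ (⋃ H ∈ 𝓗.filter (· ≠ H₀), H)ᶜ := by
    simp only [mem_compl_iff, mem_iUnion, not_exists, Finset.mem_filter]
    exact fun H hH => hgood H hH.1 hH.2
  obtain ⟨r, hr, hball⟩ := Metric.isOpen_iff.1 hclosed.isOpen_compl y hy'
  exact ⟨r, hr, fun H hH hne => disjoint_left.2 fun z hz hzH =>
    hball hz (mem_iUnion₂.2 ⟨H, Finset.mem_filter.2 ⟨hH, hne⟩, hzH⟩)⟩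

/-- The local structure of a set `K` near a point which lies on just one of the hyperplanes that
cover its boundary. -/
lemma IsHyperplaneCover.local_structure {d : ℕ} {K : Set (Rd d)} {𝓗 : Finset (Set (Rd d))}
    (h𝓗 : IsHyperplaneCover K 𝓗) {n y : Rd d} {c : ℝ}
    (hy : y ∈ hyperplane n c) (hgood : ∀ H ∈ 𝓗, H ≠ hyperplane n c → y ∉ H) :
    ∃ r > 0, ((∀ z ∈ Metric.ball y r, ⟪z - y, n⟫_ℝ < 0 → z ∈ K) ∨
        (∀ z ∈ Metric.ball y r, ⟪z - y, n⟫_ℝ < 0 → z ∉ K)) ∧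
      ((∀ z ∈ Metric.ball y r, 0 < ⟪z - y, n⟫_ℝ → z ∈ K) ∨
        (∀ z ∈ Metric.ball y r, 0 < ⟪z - y, n⟫_ℝ → z ∉ K)) := by
  obtain ⟨r, hr, hball⟩ := h𝓗.exists_ball_disjoint hgood
  have hfr : ∀ z ∈ Metric.ball y r, ⟪z - y, n⟫_ℝ ≠ 0 → z ∉ frontier K := by
    intro z hz hzn hzK
    obtain ⟨H, hH, hzH⟩ := mem_iUnion₂.1 (h𝓗.frontier_subset hzK)
    by_cases hHn : H = hyperplane n c
    · subst hHn
      apply hzn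
      have h1 : ⟪n, z⟫_ℝ = c := hzH
      have h2 : ⟪n, y⟫_ℝ = c := hy
      rw [real_inner_comm, inner_sub_right, h1, h2, sub_self]
    · exact disjoint_left.1 (hball H hH hHn) hz hzH
  -- Each open half ball is convex and misses the boundary of `K`, so it lies entirely in `K` or
  -- entirely off it.
  have side : ∀ n' : Rd d, (n' = n ∨ n' = -n) →
      ((∀ z ∈ Metric.ball y r, ⟪z - y, n'⟫_ℝ < 0 → z ∈ K) ∨
        (∀ z ∈ Metric.ball y r, ⟪z - y, n'⟫_ℝ < 0 → z ∉ K)) := by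
    intro n' hn'
    have hd : Disjoint (Metric.ball y r ∩ {z | ⟪z - y, n'⟫_ℝ < 0}) (frontier K) := by
      refine disjoint_left.2 fun z hz => hfr z hz.1 ?_
      have hz2 : ⟪z - y, n'⟫_ℝ < 0 := hz.2
      rcases hn' with rfl | rfl
      · exact hz2.ne
      · rw [inner_neg_right] at hz2
        intro h
        linarith
    rcases subset_or_disjoint_of_disjoint_frontier (convex_halfBall y n' r).isPreconnected hd
      with h | h
    · exact Or.inl fun z hz hzn => h ⟨hz, hzn⟩
    · exact Or.inr fun z hz hzn => disjoint_left.1 h ⟨hz, hzn⟩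
  refine ⟨r, hr, side n (Or.inl rfl), ?_⟩
  simpa only [inner_neg_right, neg_lt_zero] using side (-n) (Or.inr rfl)

/-- When `K` looks the same on both sides of the hyperplane, no direction `n'` can separate it from
its complement: the points `y ± ε (n' + τ n)` lie on opposite sides for `n'`, but both off the
hyperplane, where `K` contains both or neither. -/
lemma not_exists_isOutwardNormalAt {d : ℕ} {K : Set (Rd d)} {n y : Rd d} {r : ℝ} (hr : 0 < r)
    (hn : ‖n‖ = 1)
    (h : (∀ z ∈ Metric.ball y r, ⟪z - y, n⟫_ℝ ≠ 0 → z ∈ K) ∨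
      (∀ z ∈ Metric.ball y r, ⟪z - y, n⟫_ℝ ≠ 0 → z ∉ K)) :
    ¬ ∃ n', IsOutwardNormalAt K y n' := by
  rintro ⟨n', hn', r', hr', H⟩
  have hle : |⟪n, n'⟫_ℝ| ≤ 1 := by simpa [hn, hn'] using abs_real_inner_le_norm n n'
  -- Both values `τ = ±1/2` keep the first quantity positive, and at most one of them makes the
  -- second vanish.
  obtain ⟨τ, hτ₁, hτ₂⟩ : ∃ τ : ℝ, 0 < 1 + τ * ⟪n, n'⟫_ℝ ∧ ⟪n, n'⟫_ℝ + τ ≠ 0 := by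
    obtain ⟨h1, h2⟩ := abs_le.1 hle
    by_cases h0 : ⟪n, n'⟫_ℝ + 1 / 2 = 0
    · exact ⟨-1 / 2, by linarith, fun h => by linarith⟩
    · exact ⟨1 / 2, by linarith, h0⟩
  have e1 : ⟪n' + τ • n, n'⟫_ℝ = 1 + τ * ⟪n, n'⟫_ℝ := by
    rw [inner_add_left, real_inner_smul_left, real_inner_self_eq_norm_sq, hn']; ring
  have e2 : ⟪n' + τ • n, n⟫_ℝ = ⟪n, n'⟫_ℝ + τ := by
    rw [inner_add_left, real_inner_smul_left, real_inner_self_eq_norm_sq, hn, real_inner_comm]; ring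
  obtain ⟨ε, hε, hz, hz'⟩ := exists_small_smul_mem_ball y (n' + τ • n) (lt_min hr hr')
  have hzr := Metric.ball_subset_ball (min_le_left _ _) hz
  have hzr' := Metric.ball_subset_ball (min_le_right _ _) hz
  have hwr := Metric.ball_subset_ball (min_le_left _ _) hz'
  have hwr' := Metric.ball_subset_ball (min_le_right _ _) hz'
  have hz1 : y + ε • (n' + τ • n) ∉ K := by
    refine (H _ hzr').2 ?_
    rw [add_sub_cancel_left, real_inner_smul_left, e1]; positivity
  have hw1 : y - ε • (n' + τ • n) ∈ K := by
    refine (H _ hwr').1 ?_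
    rw [sub_sub_cancel_left, inner_neg_left, real_inner_smul_left, e1, neg_lt_zero]; positivity
  rcases h with h | h
  · refine hz1 (h _ hzr ?_)
    rw [add_sub_cancel_left, real_inner_smul_left, e2]
    exact mul_ne_zero hε.ne' hτ₂
  · refine h _ hwr ?_ hw1
    rw [sub_sub_cancel_left, inner_neg_left, real_inner_smul_left, e2]
    exact neg_ne_zero.2 (mul_ne_zero hε.ne' hτ₂)

/-- At a regular point, the outward normal is the jump of the indicator function times `n`. -/
lemma IsHyperplaneCover.exists_jump {d : ℕ} {K : Set (Rd d)} {𝓗 : Finset (Set (Rd d))}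
    (h𝓗 : IsHyperplaneCover K 𝓗) {n y : Rd d} {c : ℝ} (hn : ‖n‖ = 1)
    (hy : y ∈ hyperplane n c) (hgood : ∀ H ∈ 𝓗, H ≠ hyperplane n c → y ∉ H) :
    ∃ j : ℝ, outwardNormal K y = j • n ∧ ∃ r > 0, ∀ z₁ ∈ Metric.ball y r, ∀ z₂ ∈ Metric.ball y r,
      ⟪z₁ - y, n⟫_ℝ < 0 → 0 < ⟪z₂ - y, n⟫_ℝ →
        K.indicator (1 : Rd d → ℝ) z₁ - K.indicator (1 : Rd d → ℝ) z₂ = j := by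
  obtain ⟨r, hr, h₁, h₂⟩ := h𝓗.local_structure hy hgood
  rcases h₁ with h₁ | h₁ <;> rcases h₂ with h₂ | h₂
  · refine ⟨0, ?_, r, hr, fun z₁ hz₁ z₂ hz₂ hn₁ hn₂ => ?_⟩
    · rw [zero_smul]
      refine outwardNormal_eq_zero (not_exists_isOutwardNormalAt hr hn (Or.inl fun z hz hzn => ?_))
      exact (lt_or_gt_of_ne hzn).elim (h₁ z hz) (h₂ z hz)
    · simp [h₁ z₁ hz₁ hn₁, h₂ z₂ hz₂ hn₂]
  · refine ⟨1, ?_, r, hr, fun z₁ hz₁ z₂ hz₂ hn₁ hn₂ => ?_⟩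
    · rw [one_smul]
      exact IsOutwardNormalAt.outwardNormal_eq ⟨hn, r, hr, fun z hz => ⟨h₁ z hz, h₂ z hz⟩⟩
    · simp [h₁ z₁ hz₁ hn₁, h₂ z₂ hz₂ hn₂]
  · refine ⟨-1, ?_, r, hr, fun z₁ hz₁ z₂ hz₂ hn₁ hn₂ => ?_⟩
    · rw [neg_one_smul]
      refine IsOutwardNormalAt.outwardNormal_eq ⟨by rwa [norm_neg], r, hr, fun z hz => ?_⟩
      rw [inner_neg_right, neg_lt_zero, neg_pos]
      exact ⟨h₂ z hz, h₁ z hz⟩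
    · simp [h₁ z₁ hz₁ hn₁, h₂ z₂ hz₂ hn₂]
  · refine ⟨0, ?_, r, hr, fun z₁ hz₁ z₂ hz₂ hn₁ hn₂ => ?_⟩
    · rw [zero_smul]
      refine outwardNormal_eq_zero (not_exists_isOutwardNormalAt hr hn (Or.inr fun z hz hzn => ?_))
      exact (lt_or_gt_of_ne hzn).elim (h₁ z hz) (h₂ z hz)
    · simp [h₁ z₁ hz₁ hn₁, h₂ z₂ hz₂ hn₂]

/-- At a regular boundary point, an open set contains a half ball. -/
lemma IsHyperplaneCover.exists_halfBallIn {d : ℕ} {K : Set (Rd d)} {𝓗 : Finset (Set (Rd d))}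
    (h𝓗 : IsHyperplaneCover K 𝓗) (hK : IsOpen K) {n y : Rd d} {c : ℝ} (hn : ‖n‖ = 1)
    (hy : y ∈ hyperplane n c) (hgood : ∀ H ∈ 𝓗, H ≠ hyperplane n c → y ∉ H)
    (hyK : y ∈ closure K) : ∃ n', HalfBallIn K y n' := by
  obtain ⟨r, hr, h₁, h₂⟩ := h𝓗.local_structure hy hgood
  rcases h₁ with h₁ | h₁
  · exact ⟨n, hn, r, hr, h₁⟩
  rcases h₂ with h₂ | h₂
  · refine ⟨-n, by rwa [norm_neg], r, hr, ?_⟩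
    simpa only [inner_neg_right, neg_lt_zero] using h₂
  -- If both half balls missed `K`, points of `K` near `y` would lie on the hyperplane; since `K` is
  -- open, such a point can be moved off it along `n` inside `K`.
  exfalso
  obtain ⟨z, hz, hzK⟩ := mem_closure_iff.1 hyK _ Metric.isOpen_ball (Metric.mem_ball_self hr)
  have hzn : ⟪z - y, n⟫_ℝ = 0 := by
    by_contra h0
    exact (lt_or_gt_of_ne h0).elim (fun h => h₁ z hz h hzK) (fun h => h₂ z hz h hzK)
  obtain ⟨ρ, hρ, hsub⟩ := Metric.isOpen_iff.1 (Metric.isOpen_ball.inter hK) z ⟨hz, hzK⟩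
  obtain ⟨ε, hε, hw, -⟩ := exists_small_smul_mem_ball z n hρ
  obtain ⟨hwb, hwK⟩ := hsub hw
  refine h₂ _ hwb ?_ hwK
  rw [add_sub_right_comm, inner_add_left, hzn, real_inner_smul_left, real_inner_self_eq_norm_sq, hn]
  linarith

/-! ### The Gauss–Green formula for polygonal sets -/

/-- The excluded points lie in finitely many intersections of two distinct hyperplanes. -/
lemma IsHyperplaneCover.ae_good {d : ℕ} {K : Set (Rd d)} {𝓗 : Finset (Set (Rd d))}
    (h𝓗 : IsHyperplaneCover K 𝓗) {H : Set (Rd d)} (hH : H ∈ 𝓗) :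
    ∀ᵐ y ∂(surf d).restrict H, y ∈ H ∧ ∀ H' ∈ 𝓗, H' ≠ H → y ∉ H' := by
  obtain ⟨n, c, hn, rfl⟩ := h𝓗.isHyperplane H hH
  have hm := (isClosed_hyperplane n c).measurableSet
  refine (ae_restrict_mem hm).and ?_
  rw [ae_restrict_iff' hm]
  have : ∀ H' ∈ 𝓗, ∀ᵐ y ∂surf d, H' ≠ hyperplane n c → y ∈ hyperplane n c → y ∉ H' := by
    intro H' hH'
    by_cases hne : H' = hyperplane n c
    · simp [hne]
    have h0 := surf_hyperplane_inter_null ⟨n, c, hn, rfl⟩ (h𝓗.isHyperplane H' hH') (Ne.symm hne)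
    filter_upwards [measure_eq_zero_iff_ae_notMem.1 h0] with y hy _ hy1 hy2
    exact hy ⟨hy1, hy2⟩
  filter_upwards [(ae_ball_iff (Finset.countable_toSet 𝓗)).2 this] with y hy hyH H' hH' hne
  exact hy H' hH' hne hyH

/-- The normal is chosen point by point, so its measurability is not visible from the definition. On
a covering hyperplane it is almost everywhere the limit, as `s` decreases to `0`, of the Borel
functions giving the jump of the indicator between `y - s n` and `y + s n`. -/
lemma IsHyperplaneCover.aestronglyMeasurable_outwardNormal_restrict {d : ℕ} {K : Set (Rd d)}
    {𝓗 : Finset (Set (Rd d))} (h𝓗 : IsHyperplaneCover K 𝓗) (hK : MeasurableSet K)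
    {H : Set (Rd d)} (hH : H ∈ 𝓗) :
    AEStronglyMeasurable (outwardNormal K) ((surf d).restrict H) := by
  have hgood := h𝓗.ae_good hH
  obtain ⟨n, c, hn, rfl⟩ := h𝓗.isHyperplane H hH
  refine aestronglyMeasurable_of_tendsto_ae (𝓝[>] (0 : ℝ))
    (f := fun s y => (K.indicator (1 : Rd d → ℝ) (y - s • n) -
      K.indicator (1 : Rd d → ℝ) (y + s • n)) • n) (fun s => ?_) ?_
  · have h1 : Measurable fun y : Rd d => K.indicator (1 : Rd d → ℝ) (y - s • n) :=
      (measurable_one.indicator hK).comp (by fun_prop)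
    have h2 : Measurable fun y : Rd d => K.indicator (1 : Rd d → ℝ) (y + s • n) :=
      (measurable_one.indicator hK).comp (by fun_prop)
    exact ((h1.sub h2).smul_const n).aestronglyMeasurable
  · filter_upwards [hgood] with y hy
    obtain ⟨j, hj, r, hr, H⟩ := h𝓗.exists_jump hn hy.1 hy.2
    rw [hj]
    refine tendsto_const_nhds.congr' ?_
    filter_upwards [Ioo_mem_nhdsGT hr] with s hs
    have hsn : ‖s • n‖ < r := by
      rw [norm_smul, hn, mul_one, Real.norm_of_nonneg hs.1.le]; exact hs.2
    rw [H (y - s • n) (by simpa [dist_eq_norm] using hsn) (y + s • n)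
      (by simpa [dist_eq_norm] using hsn)]
    · rw [sub_sub_cancel_left, inner_neg_left, real_inner_smul_left, real_inner_self_eq_norm_sq, hn]
      linarith [hs.1]
    · rw [add_sub_cancel_left, real_inner_smul_left, real_inner_self_eq_norm_sq, hn]
      linarith [hs.1]

lemma IsPolygonal.aestronglyMeasurable_outwardNormal {d : ℕ} {K : Set (Rd d)}
    (hK : IsPolygonal K) :
    AEStronglyMeasurable (outwardNormal K) ((surf d).restrict (frontier K)) := by
  obtain ⟨𝓗, h𝓗⟩ := hK.exists_cover
  refine AEStronglyMeasurable.mono_measure ?_ (Measure.restrict_mono h𝓗.frontier_subset le_rfl)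
  rw [show (⋃ H ∈ 𝓗, H) = ⋃ H : {H // H ∈ 𝓗}, H.1 by ext; simp]
  exact aestronglyMeasurable_iUnion_iff.2 fun H =>
    h𝓗.aestronglyMeasurable_outwardNormal_restrict hK.isOpen.measurableSet H.2

lemma IsPolygonal.ae_exists_halfBallIn {d : ℕ} {K : Set (Rd d)} (hK : IsPolygonal K) :
    ∀ᵐ y ∂surf d, y ∈ frontier K → ∃ n, HalfBallIn K y n := by
  obtain ⟨𝓗, h𝓗⟩ := hK.exists_cover
  have : ∀ H ∈ 𝓗, ∀ᵐ y ∂surf d, y ∈ H → y ∈ frontier K → ∃ n, HalfBallIn K y n := by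
    intro H hH
    have hgood := h𝓗.ae_good hH
    obtain ⟨n, c, hn, rfl⟩ := h𝓗.isHyperplane H hH
    rw [ae_restrict_iff' (isClosed_hyperplane n c).measurableSet] at hgood
    filter_upwards [hgood] with y hy hyH hyK
    exact h𝓗.exists_halfBallIn hK.isOpen hn hyH (hy hyH).2 (frontier_subset_closure hyK)
  filter_upwards [(ae_ball_iff (Finset.countable_toSet 𝓗)).2 this] with y hy hyK
  obtain ⟨H, hH, hyH⟩ := mem_iUnion₂.1 (h𝓗.frontier_subset hyK)
  exact hy H hH hyH hyK

/-- The points `x` such that the segment from `x - s e` to `x` meets `H`. -/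
def crossing {d : ℕ} (e : Rd d) (s : ℝ) (H : Set (Rd d)) : Set (Rd d) :=
  {x | ∃ t ∈ Icc 0 s, x - t • e ∈ H}

/-- The number of sets in `𝓗` crossed by the segment from `x - s e` to `x`. -/
noncomputable def crossings {d : ℕ} (𝓗 : Finset (Set (Rd d))) (e : Rd d) (s : ℝ) (x : Rd d) : ℝ :=
  ∑ H ∈ 𝓗, (crossing e s H).indicator 1 x

/-- The share of the set `H` in the variation of the indicator function of `K`. -/
noncomputable def slabTerm {d : ℕ} (𝓗 : Finset (Set (Rd d))) (K : Set (Rd d)) (φ : Rd d → ℝ)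
    (e : Rd d) (H : Set (Rd d)) (s : ℝ) (x : Rd d) : ℝ :=
  (crossing e s H).indicator 1 x *
    (φ x * (K.indicator (1 : Rd d → ℝ) (x - s • e) - K.indicator (1 : Rd d → ℝ) x)) *
    (crossings 𝓗 e s x)⁻¹

lemma mem_crossing_hyperplane {d : ℕ} {e n x : Rd d} {c s : ℝ} (hs : 0 ≤ s) (hβ : 0 ≤ ⟪n, e⟫_ℝ) :
    x ∈ crossing e s (hyperplane n c) ↔ ⟪n, x⟫_ℝ - c ∈ Icc 0 (s * ⟪n, e⟫_ℝ) := by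
  constructor
  · rintro ⟨t, ht, h⟩
    simp only [hyperplane, mem_ofPred_eq, inner_sub_right, real_inner_smul_right] at h
    constructor
    · have := mul_nonneg ht.1 hβ; linarith
    · have := mul_le_mul_of_nonneg_right ht.2 hβ; linarith
  · rintro ⟨h1, h2⟩
    rcases hβ.eq_or_lt with h0 | h0
    · refine ⟨0, ⟨le_rfl, hs⟩, ?_⟩
      rw [← h0, mul_zero] at h2
      simp only [hyperplane, mem_ofPred_eq, zero_smul, sub_zero]
      linarith
    · refine ⟨(⟪n, x⟫_ℝ - c) / ⟪n, e⟫_ℝ, ⟨by positivity, (div_le_iff₀ h0).2 h2⟩, ?_⟩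
      simp only [hyperplane, mem_ofPred_eq, inner_sub_right, real_inner_smul_right]
      rw [div_mul_cancel₀ _ h0.ne']; ring

lemma exists_normal_inner_nonneg {d : ℕ} {H : Set (Rd d)}
    (hH : ∃ (n : Rd d) (c : ℝ), ‖n‖ = 1 ∧ H = hyperplane n c) (e : Rd d) :
    ∃ (n : Rd d) (c : ℝ), ‖n‖ = 1 ∧ H = hyperplane n c ∧ 0 ≤ ⟪n, e⟫_ℝ := by
  obtain ⟨n, c, hn, rfl⟩ := hH
  rcases le_total 0 ⟪n, e⟫_ℝ with h | h
  · exact ⟨n, c, hn, rfl, h⟩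
  · exact ⟨-n, -c, by rwa [norm_neg], (hyperplane_neg n c).symm, by rw [inner_neg_left]; linarith⟩

lemma measurableSet_crossing {d : ℕ} {H : Set (Rd d)}
    (hH : ∃ (n : Rd d) (c : ℝ), ‖n‖ = 1 ∧ H = hyperplane n c) (e : Rd d) {s : ℝ} (hs : 0 ≤ s) :
    MeasurableSet (crossing e s H) := by
  obtain ⟨n, c, hn, rfl, hβ⟩ := exists_normal_inner_nonneg hH e
  have : crossing e s (hyperplane n c) = (fun x => ⟪n, x⟫_ℝ - c) ⁻¹' Icc 0 (s * ⟪n, e⟫_ℝ) := by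
    ext x; exact mem_crossing_hyperplane hs hβ
  rw [this]
  exact measurableSet_Icc.preimage (by fun_prop)

lemma IsHyperplaneCover.measurable_slabTerm {d : ℕ} {K : Set (Rd d)} {𝓗 : Finset (Set (Rd d))}
    (h𝓗 : IsHyperplaneCover K 𝓗) (hK : MeasurableSet K) {φ : Rd d → ℝ} (hφ : Continuous φ)
    (e : Rd d) {H : Set (Rd d)} (hH : H ∈ 𝓗) {s : ℝ} (hs : 0 ≤ s) :
    Measurable (slabTerm 𝓗 K φ e H s) := by
  have h1 : ∀ H ∈ 𝓗, Measurable ((crossing e s H).indicator (1 : Rd d → ℝ)) := fun H hH =>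
    measurable_one.indicator (measurableSet_crossing (h𝓗.isHyperplane H hH) e hs)
  have h2 : Measurable fun y : Rd d => K.indicator (1 : Rd d → ℝ) (y - s • e) :=
    (measurable_one.indicator hK).comp (by fun_prop)
  refine ((h1 H hH).mul (hφ.measurable.mul (h2.sub (measurable_one.indicator hK)))).mul ?_
  exact (Finset.measurable_fun_sum 𝓗 h1).inv

/-- If some hyperplane is crossed, the weights `1 / crossings` add up to one. If none is crossed,
the segment avoids the boundary of `K`, its endpoints are both in or both off `K`, and both sides
vanish. -/
lemma IsHyperplaneCover.sum_slabTerm {d : ℕ} {K : Set (Rd d)} {𝓗 : Finset (Set (Rd d))}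
    (h𝓗 : IsHyperplaneCover K 𝓗) (φ : Rd d → ℝ) (e : Rd d) {s : ℝ} (hs : 0 ≤ s) (x : Rd d) :
    ∑ H ∈ 𝓗, slabTerm 𝓗 K φ e H s x =
      φ x * (K.indicator (1 : Rd d → ℝ) (x - s • e) - K.indicator (1 : Rd d → ℝ) x) := by
  simp only [slabTerm]
  rw [← Finset.sum_mul, ← Finset.sum_mul]
  change crossings 𝓗 e s x * _ * _ = _
  by_cases hm : crossings 𝓗 e s x = 0
  · have hcr : ∀ H ∈ 𝓗, x ∉ crossing e s H := by
      intro H hH hx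
      have := (Finset.sum_eq_zero_iff_of_nonneg (fun H _ =>
        indicator_nonneg (fun _ _ => zero_le_one) x)).1 hm H hH
      simp [hx] at this
    have hseg : Disjoint (segment ℝ (x - s • e) x) (frontier K) := by
      refine disjoint_left.2 fun z hz hzK => ?_
      obtain ⟨H, hH, hzH⟩ := mem_iUnion₂.1 (h𝓗.frontier_subset hzK)
      refine hcr H hH ?_
      obtain ⟨a, b, ha, hb, hab, rfl⟩ := hz
      refine ⟨a * s, ⟨by positivity, mul_le_of_le_one_left hs (by linarith)⟩, ?_⟩
      convert hzH using 1
      have : b = 1 - a := by linarith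
      subst this
      module
    rw [hm]
    rcases subset_or_disjoint_of_disjoint_frontier (convex_segment (𝕜 := ℝ) _ _).isPreconnected hseg
      with h | h
    · simp [h (left_mem_segment ℝ _ _), h (right_mem_segment ℝ _ _)]
    · simp [disjoint_left.1 h (left_mem_segment ℝ _ _), disjoint_left.1 h (right_mem_segment ℝ _ _)]
  · field_simp

lemma abs_slabTerm_le {d : ℕ} {K : Set (Rd d)} {𝓗 : Finset (Set (Rd d))} (φ : Rd d → ℝ)
    (e : Rd d) {H : Set (Rd d)} (hH : H ∈ 𝓗) (s : ℝ) (x : Rd d) :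
    |slabTerm 𝓗 K φ e H s x| ≤ |φ x| := by
  have hnn : ∀ H' ∈ 𝓗, 0 ≤ (crossing e s H').indicator (1 : Rd d → ℝ) x := fun H' _ =>
    indicator_nonneg (fun _ _ => zero_le_one) x
  have h1 : (crossing e s H).indicator 1 x ≤ crossings 𝓗 e s x :=
    Finset.single_le_sum hnn hH
  have h0 : 0 ≤ crossings 𝓗 e s x := Finset.sum_nonneg hnn
  have h2 : |K.indicator (1 : Rd d → ℝ) (x - s • e) - K.indicator (1 : Rd d → ℝ) x| ≤ 1 := by
    by_cases ha : x - s • e ∈ K <;> by_cases hb : x ∈ K <;> simp [ha, hb]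
  have h3 : (crossing e s H).indicator 1 x * (crossings 𝓗 e s x)⁻¹ ≤ 1 := by
    rcases h0.eq_or_lt with h | h
    · rw [← h]; simp
    · rw [← div_eq_mul_inv]; exact (div_le_one h).2 h1
  have h4 : 0 ≤ (crossing e s H).indicator 1 x * (crossings 𝓗 e s x)⁻¹ :=
    mul_nonneg (hnn H hH) (inv_nonneg.2 h0)
  rw [slabTerm, mul_right_comm, abs_mul, abs_of_nonneg h4, abs_mul]
  calc _ ≤ 1 * (|φ x| * 1) := by gcongr
    _ = _ := by ring

lemma integral_prod_mul_left_comp {W : Type*} [MeasureSpace W] [SFinite (volume : Measure W)]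
    {s : ℝ} (hs : 0 < s) (G : ℝ × W → ℝ) :
    ∫ q : ℝ × W, G (s * q.1, q.2) ∂(volume.prod volume) =
      s⁻¹ * ∫ q, G q ∂(volume.prod volume) := by
  let E : ℝ × W ≃ᵐ ℝ × W :=
    (Homeomorph.mulLeft₀ s hs.ne').toMeasurableEquiv.prodCongr (MeasurableEquiv.refl W)
  have hE : ((volume : Measure ℝ).prod (volume : Measure W)).map E =
      ENNReal.ofReal |s⁻¹| • (volume.prod volume) := by
    have h := Measure.map_prod_map (volume : Measure ℝ) (volume : Measure W)
      (f := fun x => s * x) (g := id) (by fun_prop) measurable_id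
    rw [Real.map_volume_mul_left hs.ne', Measure.map_id, Measure.prod_smul_left] at h
    exact h.symm
  have h := integral_map_equiv (μ := (volume : Measure ℝ).prod (volume : Measure W)) E G
  rw [hE, integral_smul_measure, ENNReal.toReal_ofReal (abs_nonneg _), abs_of_pos (by positivity)]
    at h
  exact h.symm

/-- In the blown-up coordinate `ρ` the slab of crossing points is `0 ≤ ρ ≤ ⟪n, e⟫`, whatever `s` is.
For small `s` only this hyperplane is crossed, so the count is one, and the ends of the segment lie
strictly on its two sides, where the jump of the indicator is constant. The two excluded values of
`ρ` would put an end on the hyperplane. -/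
lemma tendsto_slabTerm {d : ℕ} {K : Set (Rd d)} {𝓗 : Finset (Set (Rd d))}
    (h𝓗 : IsHyperplaneCover K 𝓗) {φ : Rd d → ℝ} (hφ : Continuous φ) (e : Rd d) {n : Rd d} {c : ℝ}
    (hn : ‖n‖ = 1) (hH : hyperplane n c ∈ 𝓗) (hβ : 0 ≤ ⟪n, e⟫_ℝ) {y : Rd d}
    (hy : y ∈ hyperplane n c) (hgood : ∀ H ∈ 𝓗, H ≠ hyperplane n c → y ∉ H) {ρ : ℝ}
    (hρ0 : ρ ≠ 0) (hρ1 : ρ ≠ ⟪n, e⟫_ℝ) :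
    Tendsto (fun s => slabTerm 𝓗 K φ e (hyperplane n c) s ((s * ρ) • n + y)) (𝓝[>] 0)
      (𝓝 ((Icc 0 ⟪n, e⟫_ℝ).indicator 1 ρ * (φ y * ⟪outwardNormal K y, n⟫_ℝ))) := by
  have hyc : ⟪n, y⟫_ℝ = c := hy
  have hcr : ∀ s > 0, (s * ρ) • n + y ∈ crossing e s (hyperplane n c) ↔ ρ ∈ Icc 0 ⟪n, e⟫_ℝ := by
    intro s hs
    rw [mem_crossing_hyperplane hs.le hβ, inner_add_right, real_inner_smul_right,
      real_inner_self_eq_norm_sq, hn, hyc, one_pow, mul_one, add_sub_cancel_right, mem_Icc, mem_Icc,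
      mul_le_mul_iff_right₀ hs, mul_nonneg_iff_of_pos_left hs]
  by_cases hρ : ρ ∈ Icc 0 ⟪n, e⟫_ℝ
  swap
  · rw [indicator_of_notMem hρ, zero_mul]
    refine tendsto_const_nhds.congr' ?_
    filter_upwards [self_mem_nhdsWithin] with s hs
    rw [slabTerm, indicator_of_notMem (fun h => hρ ((hcr s hs).1 h)), zero_mul, zero_mul]
  have hρpos : 0 < ρ := lt_of_le_of_ne hρ.1 (Ne.symm hρ0)
  have hρlt : ρ < ⟪n, e⟫_ℝ := lt_of_le_of_ne hρ.2 hρ1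
  obtain ⟨j, hj, r, hr, Hj⟩ := h𝓗.exists_jump hn hy hgood
  obtain ⟨r', hr', hball⟩ := h𝓗.exists_ball_disjoint hgood
  have hφt : Tendsto (fun s : ℝ => φ ((s * ρ) • n + y)) (𝓝[>] 0) (𝓝 (φ y)) := by
    have : Continuous fun s : ℝ => φ ((s * ρ) • n + y) := by fun_prop
    simpa using (this.tendsto 0).mono_left nhdsWithin_le_nhds
  have hjn : ⟪outwardNormal K y, n⟫_ℝ = j := by
    rw [hj, real_inner_smul_left, real_inner_self_eq_norm_sq, hn]; ring
  rw [hjn, indicator_of_mem hρ, Pi.one_apply, one_mul]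
  refine (hφt.mul_const j).congr' ?_
  -- Every point of the segment is within `s (ρ + ‖e‖)` of `y`; the extra `1` makes the estimate
  -- strict and the denominator positive.
  have hδ : 0 < min r r' / (ρ + ‖e‖ + 1) := by
    have := lt_min hr hr'
    positivity
  filter_upwards [Ioo_mem_nhdsGT hδ] with s hs
  have hs0 : 0 < s := hs.1
  have hsr : s * (ρ + ‖e‖ + 1) < min r r' := (lt_div_iff₀ (by positivity)).1 hs.2
  have hmem : ∀ t ∈ Icc 0 s, (s * ρ) • n + y - t • e ∈ Metric.ball y (min r r') := by
    intro t ht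
    rw [Metric.mem_ball, dist_eq_norm]
    calc ‖(s * ρ) • n + y - t • e - y‖ = ‖(s * ρ) • n - t • e‖ := by congr 1; abel
      _ ≤ ‖(s * ρ) • n‖ + ‖t • e‖ := norm_sub_le _ _
      _ = s * ρ + t * ‖e‖ := by
        rw [norm_smul, norm_smul, hn, Real.norm_of_nonneg ht.1, Real.norm_of_nonneg (by positivity),
          mul_one]
      _ ≤ s * ρ + s * ‖e‖ := by gcongr; exact ht.2
      _ < s * (ρ + ‖e‖ + 1) := by linarith
      _ < min r r' := hsr
  have hone : crossings 𝓗 e s ((s * ρ) • n + y) = 1 := by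
    rw [crossings, Finset.sum_eq_single_of_mem _ hH]
    · rw [indicator_of_mem ((hcr s hs0).2 hρ), Pi.one_apply]
    · intro H hH' hne
      refine indicator_of_notMem ?_ _
      rintro ⟨t, ht, htH⟩
      exact disjoint_left.1 (hball H hH' hne)
        (Metric.ball_subset_ball (min_le_right _ _) (hmem t ht)) htH
  rw [slabTerm, hone, indicator_of_mem ((hcr s hs0).2 hρ), Pi.one_apply, one_mul, inv_one, mul_one,
    Hj _ (Metric.ball_subset_ball (min_le_left _ _) (hmem s ⟨hs0.le, le_rfl⟩)) _
      (Metric.ball_subset_ball (min_le_left _ _) (by simpa using hmem 0 ⟨le_rfl, hs0.le⟩))]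
  · have : (s * ρ) • n + y - s • e - y = (s * ρ) • n - s • e := by abel
    rw [this, inner_sub_left, real_inner_smul_left, real_inner_smul_left,
      real_inner_self_eq_norm_sq, hn, real_inner_comm n e]
    nlinarith
  · rw [add_sub_cancel_right, real_inner_smul_left, real_inner_self_eq_norm_sq, hn]
    nlinarith

lemma exists_bound_of_continuous {d : ℕ} {φ : Rd d → ℝ} (hφ : Continuous φ) (R : ℝ) :
    ∃ M, 0 ≤ M ∧ ∀ x ∈ Metric.closedBall (0 : Rd d) R, |φ x| ≤ M := by
  obtain ⟨M, hM⟩ := (isCompact_closedBall (0 : Rd d) R).exists_bound_of_continuousOn hφ.continuousOn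
  exact ⟨|M|, abs_nonneg _, fun x hx => (hM x hx).trans (le_abs_self _)⟩

/-- The substitution `x = s ρ n + w + p` absorbs the factor `s⁻¹`, and dominated convergence
applies. Integrating the limit over `ρ` gives the factor `⟪n, e⟫`, which combines with the jump into
`⟪outwardNormal K y, e⟫`. -/
lemma IsHyperplaneCover.tendsto_integral_slabTerm {d : ℕ} {K : Set (Rd d)}
    {𝓗 : Finset (Set (Rd d))} (h𝓗 : IsHyperplaneCover K 𝓗) (hK : MeasurableSet K)
    (hKb : Bornology.IsBounded K) {φ : Rd d → ℝ} (hφ : Continuous φ) (e : Rd d) {H : Set (Rd d)}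
    (hH : H ∈ 𝓗) :
    Tendsto (fun s => s⁻¹ * ∫ x, slabTerm 𝓗 K φ e H s x) (𝓝[>] 0)
      (𝓝 (∫ y in H, φ y * ⟪outwardNormal K y, e⟫_ℝ ∂surf d)) := by
  have hgood := h𝓗.ae_good hH
  obtain ⟨n, c, hn, rfl, hβ⟩ := exists_normal_inner_nonneg (h𝓗.isHyperplane H hH) e
  obtain ⟨p, hp⟩ := exists_mem_hyperplane hn c
  have hmap := map_orthogonal_add hn p
  rw [hp] at hmap
  have hgoodW : ∀ᵐ w : (ℝ ∙ n)ᗮ, (w : Rd d) + p ∈ hyperplane n c ∧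
      ∀ H' ∈ 𝓗, H' ≠ hyperplane n c → (w : Rd d) + p ∉ H' := by
    rw [← hmap] at hgood
    exact (measurableEmbedding_orthogonal_add n p).ae_map_iff.1 hgood
  have hlim : ∫ y in hyperplane n c, φ y * ⟪outwardNormal K y, e⟫_ℝ ∂surf d =
      ∫ q : ℝ × (ℝ ∙ n)ᗮ, (Icc 0 ⟪n, e⟫_ℝ).indicator 1 q.1 *
        (φ (q.2 + p) * ⟪outwardNormal K (q.2 + p), n⟫_ℝ) ∂(volume.prod volume) := by
    rw [integral_prod_mul (fun r : ℝ => (Icc 0 ⟪n, e⟫_ℝ).indicator 1 r)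
      (fun w : (ℝ ∙ n)ᗮ => φ (w + p) * ⟪outwardNormal K (w + p), n⟫_ℝ),
      integral_indicator_one measurableSet_Icc, Real.volume_real_Icc_of_le hβ, sub_zero,
      ← integral_const_mul, ← hmap, (measurableEmbedding_orthogonal_add n p).integral_map]
    refine integral_congr_ae ?_
    filter_upwards [hgoodW] with w hw
    obtain ⟨j, hj, -⟩ := h𝓗.exists_jump hn hw.1 hw.2
    rw [hj, real_inner_smul_left, real_inner_smul_left, real_inner_self_eq_norm_sq, hn]
    ring
  rw [hlim]
  obtain ⟨R, hR⟩ := hKb.subset_closedBall (0 : Rd d)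
  obtain ⟨M, hM0, hM⟩ := exists_bound_of_continuous hφ (R + ‖e‖)
  -- A fixed box for all `s < 1`: a nonzero integrand forces `ρ` into the slab and puts `x` or `x -
  -- s e` in `K`, so `x` is within `‖e‖` of `K` and `w` is bounded.
  let B : Set (ℝ × (ℝ ∙ n)ᗮ) :=
    Icc 0 ⟪n, e⟫_ℝ ×ˢ Metric.closedBall 0 (R + ‖e‖ + ⟪n, e⟫_ℝ + ‖p‖)
  have hBm : MeasurableSet B := measurableSet_Icc.prod Metric.isClosed_closedBall.measurableSet
  have hchange : ∀ s > 0, s⁻¹ * ∫ x, slabTerm 𝓗 K φ e (hyperplane n c) s x =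
      ∫ q : ℝ × (ℝ ∙ n)ᗮ, slabTerm 𝓗 K φ e (hyperplane n c) s ((s * q.1) • n + (q.2 + p))
        ∂(volume.prod volume) := by
    intro s hs
    rw [← (measurePreserving_slabEquiv n hn p).integral_comp',
      ← integral_prod_mul_left_comp hs]
    simp only [slabEquiv_apply, add_assoc]
  refine Tendsto.congr' (f₁ := fun s => ∫ q : ℝ × (ℝ ∙ n)ᗮ,
    slabTerm 𝓗 K φ e (hyperplane n c) s ((s * q.1) • n + (q.2 + p)) ∂(volume.prod volume)) ?_ ?_
  · filter_upwards [self_mem_nhdsWithin] with s hs using (hchange s hs).symm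
  refine tendsto_integral_filter_of_dominated_convergence (B.indicator fun _ => M) ?_ ?_ ?_ ?_
  · filter_upwards [self_mem_nhdsWithin] with s hs
    refine Measurable.aestronglyMeasurable ?_
    exact (h𝓗.measurable_slabTerm hK hφ e hH (le_of_lt hs)).comp (by fun_prop)
  · filter_upwards [Ioo_mem_nhdsGT (zero_lt_one' ℝ)] with s hs
    refine Eventually.of_forall fun q => ?_
    by_cases h0 : slabTerm 𝓗 K φ e (hyperplane n c) s ((s * q.1) • n + (q.2 + p)) = 0
    · rw [h0, norm_zero]
      exact indicator_nonneg (fun _ _ => hM0) q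
    set x := (s * q.1) • n + ((q.2 : Rd d) + p) with hx
    have hxc : x ∈ crossing e s (hyperplane n c) := by
      by_contra hxc
      exact h0 (by rw [slabTerm, indicator_of_notMem hxc, zero_mul, zero_mul])
    have hn2 : ⟪n, (q.2 : Rd d)⟫_ℝ = 0 := Submodule.mem_orthogonal_singleton_iff_inner_right.1 q.2.2
    have hq1 : q.1 ∈ Icc 0 ⟪n, e⟫_ℝ := by
      rw [mem_crossing_hyperplane hs.1.le hβ, hx, inner_add_right, inner_add_right, hn2, hp,
        real_inner_smul_right, real_inner_self_eq_norm_sq, hn, one_pow, mul_one, zero_add,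
        add_sub_cancel_right, mem_Icc, mul_le_mul_iff_right₀ hs.1,
        mul_nonneg_iff_of_pos_left hs.1] at hxc
      exact hxc
    have hxR : ‖x‖ ≤ R + ‖e‖ := by
      by_cases hxK : x ∈ K
      · have := hR hxK
        rw [mem_closedBall_zero_iff] at this
        linarith [norm_nonneg e]
      by_cases hxK' : x - s • e ∈ K
      · have h1 := hR hxK'
        rw [mem_closedBall_zero_iff] at h1
        have h2 : ‖s • e‖ ≤ ‖e‖ := by
          rw [norm_smul, Real.norm_of_nonneg hs.1.le]
          exact mul_le_of_le_one_left (norm_nonneg e) hs.2.le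
        calc ‖x‖ = ‖(x - s • e) + s • e‖ := by rw [sub_add_cancel]
          _ ≤ _ := norm_add_le _ _
          _ ≤ _ := add_le_add h1 h2
      · exact absurd (by simp [slabTerm, hxK, hxK']) h0
    have hqB : q ∈ B := by
      refine ⟨hq1, ?_⟩
      rw [mem_closedBall_zero_iff, Submodule.coe_norm]
      have h3 : ‖(s * q.1) • n‖ ≤ ⟪n, e⟫_ℝ := by
        rw [norm_smul, hn, mul_one, Real.norm_of_nonneg (mul_nonneg hs.1.le hq1.1)]
        exact (mul_le_of_le_one_left hq1.1 hs.2.le).trans hq1.2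
      calc ‖(q.2 : Rd d)‖ = ‖x - (s * q.1) • n - p‖ := by rw [hx]; congr 1; abel
        _ ≤ ‖x‖ + ‖(s * q.1) • n‖ + ‖p‖ :=
          (norm_sub_le _ _).trans (add_le_add_left (norm_sub_le _ _) _)
        _ ≤ _ := by gcongr
    rw [indicator_of_mem hqB, Real.norm_eq_abs]
    exact (abs_slabTerm_le φ e hH s x).trans (hM x (mem_closedBall_zero_iff.2 hxR))
  · rw [integrable_indicator_iff hBm]
    refine integrableOn_const ?_
    exact (isCompact_Icc.prod (isCompact_closedBall _ _)).measure_lt_top.ne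
  · have h1 : ∀ᵐ q : ℝ × (ℝ ∙ n)ᗮ ∂(volume.prod volume), q.1 ≠ 0 ∧ q.1 ≠ ⟪n, e⟫_ℝ :=
      Measure.quasiMeasurePreserving_fst.ae
        ((Measure.ae_ne volume (0 : ℝ)).and (Measure.ae_ne volume (⟪n, e⟫_ℝ)))
    have h2 := (Measure.quasiMeasurePreserving_snd
      (μ := (volume : Measure ℝ)) (ν := (volume : Measure (ℝ ∙ n)ᗮ))).ae hgoodW
    filter_upwards [h1, h2] with q hq1 hq2
    exact tendsto_slabTerm h𝓗 hφ e hn hH hβ hq2.1 hq2.2 hq1.1 hq1.2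

/-- Translation invariance moves the shift from the indicator to `φ`, which turns the expression
into a difference quotient at `0` of `s ↦ ∫ x in K, φ (x + s • e)`. This function is differentiated
under the integral sign. -/
lemma tendsto_integral_translate {d : ℕ} {K : Set (Rd d)} (hK : MeasurableSet K)
    (hKb : Bornology.IsBounded K) {φ : Rd d → ℝ} (hφ : ContDiff ℝ 1 φ) (e : Rd d) :
    Tendsto (fun s : ℝ => s⁻¹ * ∫ x, φ x * (K.indicator (1 : Rd d → ℝ) (x - s • e) -
      K.indicator (1 : Rd d → ℝ) x)) (𝓝[>] 0) (𝓝 (∫ x in K, fderiv ℝ φ x e)) := by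
  obtain ⟨R, hR⟩ := hKb.subset_closedBall (0 : Rd d)
  have hcont : Continuous fun x => fderiv ℝ φ x e :=
    (hφ.continuous_fderiv one_ne_zero).clm_apply continuous_const
  obtain ⟨M, hM0, hM⟩ := exists_bound_of_continuous hcont (R + ‖e‖)
  have hKfin : volume K ≠ ∞ := hKb.measure_lt_top.ne
  have hgint : ∀ s : ℝ, IntegrableOn (fun x => φ (x + s • e)) K := fun s => by
    have hc : Continuous fun x => φ (x + s • e) := by have := hφ.continuous; fun_prop
    exact (hc.continuousOn.integrableOn_compact (isCompact_closedBall (0 : Rd d) R)).mono_set hR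
  have hder : HasDerivAt (fun s : ℝ => ∫ x in K, φ (x + s • e))
      (∫ x in K, fderiv ℝ φ (x + (0 : ℝ) • e) e) 0 := by
    refine (hasDerivAt_integral_of_dominated_loc_of_deriv_le (μ := volume.restrict K)
      (F := fun s x => φ (x + s • e)) (F' := fun s x => fderiv ℝ φ (x + s • e) e)
      (bound := fun _ => M) (Metric.ball_mem_nhds (0 : ℝ) one_pos)
      (Eventually.of_forall fun s => (hgint s).aestronglyMeasurable) (hgint 0) ?_ ?_ ?_ ?_).2
    · exact (hcont.comp (by fun_prop)).aestronglyMeasurable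
    · filter_upwards [ae_restrict_mem hK] with x hx s hs
      refine hM _ (mem_closedBall_zero_iff.2 ?_)
      have h1 := mem_closedBall_zero_iff.1 (hR hx)
      have h2 : ‖s • e‖ ≤ ‖e‖ := by
        rw [norm_smul]
        exact mul_le_of_le_one_left (norm_nonneg e) (mem_ball_zero_iff.1 hs).le
      exact (norm_add_le _ _).trans (add_le_add h1 h2)
    · exact integrableOn_const hKfin
    · refine Eventually.of_forall fun x s _ => ?_
      have h1 : HasFDerivAt φ (fderiv ℝ φ (x + s • e)) (x + s • e) :=
        (hφ.differentiable one_ne_zero _).hasFDerivAt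
      have h2 : HasDerivAt (fun s : ℝ => x + s • e) e s := by
        simpa using ((hasDerivAt_id s).smul_const e).const_add x
      exact h1.comp_hasDerivAt s h2
  have := hder.tendsto_slope_zero_right
  simp only [zero_smul, add_zero, zero_add] at this
  refine this.congr fun s => ?_
  rw [smul_eq_mul]
  congr 1
  have e1 : ∫ x in K, φ (x + s • e) = ∫ x, φ x * K.indicator (1 : Rd d → ℝ) (x - s • e) := by
    rw [← integral_indicator hK, ← integral_add_right_eq_self
      (fun x => φ x * K.indicator (1 : Rd d → ℝ) (x - s • e)) (s • e)]
    refine integral_congr_ae (Eventually.of_forall fun x => ?_)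
    by_cases hx : x ∈ K <;> simp [hx]
  have e2 : ∫ x in K, φ x = ∫ x, φ x * K.indicator (1 : Rd d → ℝ) x := by
    rw [← integral_indicator hK]
    refine integral_congr_ae (Eventually.of_forall fun x => ?_)
    by_cases hx : x ∈ K <;> simp [hx]
  have i1 : Integrable fun x => φ x * K.indicator (1 : Rd d → ℝ) (x - s • e) := by
    have := ((integrable_indicator_iff hK).2 (hgint s)).comp_sub_right (s • e)
    refine this.congr (Eventually.of_forall fun x => ?_)
    by_cases hx : x - s • e ∈ K <;> simp [hx]
  have i2 : Integrable fun x => φ x * K.indicator (1 : Rd d → ℝ) x := by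
    have := (integrable_indicator_iff hK).2 (hgint 0)
    refine this.congr (Eventually.of_forall fun x => ?_)
    by_cases hx : x ∈ K <;> simp [hx]
  rw [e1, e2, ← integral_sub i1 i2]
  simp only [mul_sub]

lemma IsHyperplaneCover.integrable_slabTerm {d : ℕ} {K : Set (Rd d)} {𝓗 : Finset (Set (Rd d))}
    (h𝓗 : IsHyperplaneCover K 𝓗) (hK : MeasurableSet K) (hKb : Bornology.IsBounded K)
    {φ : Rd d → ℝ} (hφ : Continuous φ) (e : Rd d) {H : Set (Rd d)} (hH : H ∈ 𝓗) {s : ℝ}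
    (hs : 0 ≤ s) : Integrable (slabTerm 𝓗 K φ e H s) := by
  obtain ⟨R, hR⟩ := hKb.subset_closedBall (0 : Rd d)
  have hφi : IntegrableOn φ (Metric.closedBall 0 (R + ‖s • e‖)) :=
    hφ.continuousOn.integrableOn_compact (isCompact_closedBall _ _)
  rw [← integrable_indicator_iff Metric.isClosed_closedBall.measurableSet] at hφi
  refine hφi.norm.mono' (h𝓗.measurable_slabTerm hK hφ e hH hs).aestronglyMeasurable
    (Eventually.of_forall fun x => ?_)
  by_cases hx : x ∈ Metric.closedBall 0 (R + ‖s • e‖)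
  · rw [indicator_of_mem hx]
    exact abs_slabTerm_le φ e hH s x
  · have hx1 : x ∉ K := fun h => hx (Metric.closedBall_subset_closedBall
      (le_add_of_nonneg_right (norm_nonneg _)) (hR h))
    have hx2 : x - s • e ∉ K := fun h => hx <| by
      have h1 := mem_closedBall_zero_iff.1 (hR h)
      rw [mem_closedBall_zero_iff]
      calc ‖x‖ = ‖(x - s • e) + s • e‖ := by rw [sub_add_cancel]
        _ ≤ _ := norm_add_le _ _
        _ ≤ _ := add_le_add_left h1 _
    simp [slabTerm, hx1, hx2]

lemma mem_frontier_of_isOutwardNormalAt {d : ℕ} {K : Set (Rd d)} {x n : Rd d}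
    (h : IsOutwardNormalAt K x n) : x ∈ frontier K := by
  obtain ⟨hn, r, hr, H⟩ := h
  have key : ∀ t > 0, ∃ y ∈ Metric.ball x t, ∃ z ∈ Metric.ball x t, y ∈ K ∧ z ∉ K := by
    intro t ht
    obtain ⟨ε, hε, h1, h2⟩ := exists_small_smul_mem_ball x n (lt_min hr ht)
    refine ⟨_, Metric.ball_subset_ball (min_le_right _ _) h2,
      _, Metric.ball_subset_ball (min_le_right _ _) h1,
      (H _ (Metric.ball_subset_ball (min_le_left _ _) h2)).1 ?_,
      (H _ (Metric.ball_subset_ball (min_le_left _ _) h1)).2 ?_⟩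
    · rw [sub_sub_cancel_left, inner_neg_left, real_inner_smul_left, real_inner_self_eq_norm_sq, hn]
      linarith
    · rw [add_sub_cancel_left, real_inner_smul_left, real_inner_self_eq_norm_sq, hn]
      linarith
  rw [frontier_eq_closure_inter_closure]
  constructor <;> rw [Metric.mem_closure_iff] <;> intro t ht <;>
    obtain ⟨y, hy, z, hz, hyK, hzK⟩ := key t ht
  · exact ⟨y, hyK, by rwa [dist_comm]⟩
  · exact ⟨z, hzK, by rwa [dist_comm]⟩

lemma outwardNormal_of_notMem_frontier {d : ℕ} {K : Set (Rd d)} {x : Rd d}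
    (h : x ∉ frontier K) : outwardNormal K x = 0 :=
  outwardNormal_eq_zero fun ⟨_, hn⟩ => h (mem_frontier_of_isOutwardNormalAt hn)

lemma IsPolygonal.integrableOn_inner_outwardNormal {d : ℕ} {K : Set (Rd d)} (hK : IsPolygonal K)
    (hfin : surf d (frontier K) ≠ ∞) {g : Rd d → Rd d} (hg : Continuous g) :
    IntegrableOn (fun x => ⟪g x, outwardNormal K x⟫_ℝ) (frontier K) (surf d) := by
  have hcomp : IsCompact (frontier K) :=
    hK.isBounded.isCompact_closure.of_isClosed_subset isClosed_frontier frontier_subset_closure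
  obtain ⟨M, hM⟩ := hcomp.exists_bound_of_continuousOn hg.continuousOn
  have : IsFiniteMeasure ((surf d).restrict (frontier K)) := isFiniteMeasure_restrict.2 hfin
  refine Integrable.mono' (integrable_const M)
    (hg.aestronglyMeasurable.inner hK.aestronglyMeasurable_outwardNormal) ?_
  filter_upwards [ae_restrict_mem isClosed_frontier.measurableSet] with x hx
  calc ‖⟪g x, outwardNormal K x⟫_ℝ‖ ≤ ‖g x‖ * ‖outwardNormal K x‖ := norm_inner_le_norm _ _
    _ ≤ ‖g x‖ * 1 := by gcongr; exact norm_outwardNormal_le K x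
    _ ≤ M := by rw [mul_one]; exact hM x hx

/-- The Gauss–Green formula for the derivative in the direction `e`. -/
lemma IsPolygonal.integral_fderiv {d : ℕ} {K : Set (Rd d)} (hK : IsPolygonal K)
    (hfin : surf d (frontier K) ≠ ∞) {φ : Rd d → ℝ} (hφ : ContDiff ℝ 1 φ) (e : Rd d) :
    ∫ x in K, fderiv ℝ φ x e = ∫ x in frontier K, φ x * ⟪outwardNormal K x, e⟫_ℝ ∂surf d := by
  obtain ⟨𝓗, h𝓗⟩ := hK.exists_cover
  have hKm := hK.isOpen.measurableSet
  have hlim := tendsto_finsetSum 𝓗 fun H hH =>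
    h𝓗.tendsto_integral_slabTerm hKm hK.isBounded hφ.continuous e hH
  -- The same difference quotient has two limits, the volume integral of the derivative and the sum
  -- of the hyperplane integrals.
  have heq := tendsto_nhds_unique (tendsto_integral_translate hKm hK.isBounded hφ e)
    (hlim.congr' ?_)
  · rw [heq]
    have hgint : IntegrableOn (fun x => φ x * ⟪outwardNormal K x, e⟫_ℝ) (frontier K) (surf d) := by
      have := hK.integrableOn_inner_outwardNormal hfin (g := fun x => φ x • e)
        (hφ.continuous.smul continuous_const)
      refine this.congr (Eventually.of_forall fun x => ?_)
      exact (real_inner_smul_left _ _ _).trans (congrArg _ (real_inner_comm _ _))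
    have hU : frontier K = ⋃ H : {H // H ∈ 𝓗}, H.1 ∩ frontier K := by
      ext x
      simp only [mem_iUnion, mem_inter_iff, exists_and_right, Subtype.exists, exists_prop,
        iff_and_self]
      exact fun hx => by simpa using h𝓗.frontier_subset hx
    have hm : ∀ H ∈ 𝓗, MeasurableSet H := fun H hH => by
      obtain ⟨n, c, -, rfl⟩ := h𝓗.isHyperplane H hH
      exact (isClosed_hyperplane n c).measurableSet
    conv_rhs => rw [hU]
    rw [integral_iUnion_ae, tsum_fintype, ← Finset.sum_coe_sort]
    · refine Finset.sum_congr rfl fun H _ => ?_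
      -- Off the boundary of `K` the normal takes its default value `0`, so the integral over all of
      -- `H` sees only the boundary.
      refine setIntegral_eq_of_subset_of_forall_sdiff_eq_zero (hm H.1 H.2) inter_subset_left ?_
      intro x hx
      rw [outwardNormal_of_notMem_frontier fun h => hx.2 ⟨hx.1, h⟩, inner_zero_left, mul_zero]
    · exact fun H => ((hm H.1 H.2).inter isClosed_frontier.measurableSet).nullMeasurableSet
    · intro H H' hne
      refine measure_mono_null (inter_subset_inter inter_subset_left inter_subset_left) ?_
      exact surf_hyperplane_inter_null (h𝓗.isHyperplane _ H.2) (h𝓗.isHyperplane _ H'.2)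
        fun h => hne (Subtype.ext h)
    · rwa [← hU]
  · filter_upwards [self_mem_nhdsWithin] with s hs
    have hs0 : (0 : ℝ) ≤ s := le_of_lt hs
    rw [← Finset.mul_sum, ← integral_finsetSum _ fun H hH =>
      h𝓗.integrable_slabTerm hKm hK.isBounded hφ.continuous e hH hs0]
    simp only [h𝓗.sum_slabTerm φ e hs0]

/-- The flux of a divergence free field through the boundary of a polygonal set vanishes. -/
lemma IsPolygonal.integral_inner_outwardNormal_eq_zero {d : ℕ} {K : Set (Rd d)}
    (hK : IsPolygonal K) (hfin : surf d (frontier K) ≠ ∞) {g : Rd d → Rd d} (hg : ContDiff ℝ 1 g)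
    (hdiv : ∀ x, ∑ i : Fin d, fderiv ℝ g x (EuclideanSpace.single i 1) i = 0) :
    ∫ x in frontier K, ⟪g x, outwardNormal K x⟫_ℝ ∂surf d = 0 := by
  have hgi : ∀ i, ContDiff ℝ 1 fun x => g x i := fun i =>
    (EuclideanSpace.proj (𝕜 := ℝ) i).contDiff.comp hg
  have hfd : ∀ i x, fderiv ℝ (fun x => g x i) x (EuclideanSpace.single i 1) =
      fderiv ℝ g x (EuclideanSpace.single i 1) i := fun i x => by
    have h1 := (EuclideanSpace.proj (𝕜 := ℝ) i : Rd d →L[ℝ] ℝ).hasFDerivAt.comp x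
      (hg.differentiable one_ne_zero x).hasFDerivAt
    exact congrArg (fun L => L (EuclideanSpace.single i (1 : ℝ))) h1.fderiv
  have hexp : ∀ x, ⟪g x, outwardNormal K x⟫_ℝ =
      ∑ i : Fin d, g x i * ⟪outwardNormal K x, EuclideanSpace.single i 1⟫_ℝ := fun x => by
    rw [PiLp.inner_apply]
    refine Finset.sum_congr rfl fun i _ => ?_
    simp [EuclideanSpace.inner_single_right, mul_comm]
  have hgint : ∀ i, IntegrableOn (fun x => g x i *
      ⟪outwardNormal K x, EuclideanSpace.single i 1⟫_ℝ) (frontier K) (surf d) := fun i => by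
    refine (hK.integrableOn_inner_outwardNormal hfin
      (g := fun x => g x i • EuclideanSpace.single i 1)
      ((hgi i).continuous.smul continuous_const)).congr (Eventually.of_forall fun x => ?_)
    exact (real_inner_smul_left _ _ _).trans (congrArg _ (real_inner_comm _ _))
  simp_rw [hexp]
  rw [integral_finsetSum _ fun i _ => hgint i]
  simp_rw [← hK.integral_fderiv hfin (hgi _)]
  rw [← integral_finsetSum]
  · simp_rw [hfd, hdiv]; simp
  · intro i _
    have hc : Continuous fun x => fderiv ℝ (fun x => g x i) x (EuclideanSpace.single i 1) :=
      ((hgi i).continuous_fderiv one_ne_zero).clm_apply continuous_const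
    exact (hc.continuousOn.integrableOn_compact hK.isBounded.isCompact_closure).mono_set
      subset_closure

/-! ### Geometry of admissible meshes -/

lemma interface_comm {d : ℕ} (K L : Set (Rd d)) : interface K L = interface L K :=
  inter_comm _ _

lemma isClosed_interface {d : ℕ} (K L : Set (Rd d)) : IsClosed (interface K L) :=
  isClosed_closure.inter isClosed_closure

namespace IsAdmissibleMesh

variable {d : ℕ} {𝒯 : Set (Set (Rd d))} {α h : ℝ}

lemma isOpen (hM : IsAdmissibleMesh 𝒯 α h) {K : Set (Rd d)} (hK : K ∈ 𝒯) : IsOpen K :=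
  (hM.polygonal K hK).isOpen

lemma nonempty (hM : IsAdmissibleMesh 𝒯 α h) : 𝒯.Nonempty := by
  obtain ⟨K, hK, -⟩ := mem_iUnion₂.1 (hM.cover.symm ▸ mem_univ (0 : Rd d))
  exact ⟨K, hK⟩

lemma diam_le (hM : IsAdmissibleMesh 𝒯 α h) {K : Set (Rd d)} (hK : K ∈ 𝒯) : Metric.diam K ≤ h :=
  hM.size.1 (mem_image_of_mem _ hK)

lemma size_pos (hM : IsAdmissibleMesh 𝒯 α h) (hd : 0 < d) : 0 < h := by
  obtain ⟨K, hK⟩ := hM.nonempty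
  obtain ⟨x, hx⟩ := (hM.connected K hK).nonempty
  have : Nonempty (Fin d) := ⟨⟨0, hd⟩⟩
  have : Nontrivial (Rd d) := inferInstance
  have : (𝓝[≠] x).NeBot := Module.punctured_nhds_neBot ℝ (Rd d) x
  have hinf := infinite_of_mem_nhds x ((hM.isOpen hK).mem_nhds hx)
  exact (Metric.diam_pos hinf.nontrivial (hM.polygonal K hK).isBounded).trans_le (hM.diam_le hK)

lemma volume_pos (hM : IsAdmissibleMesh 𝒯 α h) {K : Set (Rd d)} (hK : K ∈ 𝒯) :
    0 < (volume K).toReal :=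
  ENNReal.toReal_pos ((hM.isOpen hK).measure_pos _ (hM.connected K hK).nonempty).ne'
    (hM.polygonal K hK).isBounded.measure_lt_top.ne

lemma mul_pow_le_volume (hM : IsAdmissibleMesh 𝒯 α h) {K : Set (Rd d)} (hK : K ∈ 𝒯) :
    α * h ^ d ≤ (volume K).toReal :=
  (ENNReal.ofReal_le_iff_le_toReal (hM.polygonal K hK).isBounded.measure_lt_top.ne).1
    (hM.volume_ge K hK)

lemma surf_frontier_ne_top (hM : IsAdmissibleMesh 𝒯 α h) {K : Set (Rd d)} (hK : K ∈ 𝒯) :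
    surf d (frontier K) ≠ ∞ :=
  ne_top_of_le_ne_top ENNReal.ofReal_ne_top (hM.boundary_le K hK)

lemma interface_subset_frontier (hM : IsAdmissibleMesh 𝒯 α h) {K L : Set (Rd d)} (hK : K ∈ 𝒯)
    (hL : L ∈ 𝒯) (hne : L ≠ K) : interface K L ⊆ frontier K := by
  rintro x ⟨hxK, hxL⟩
  rw [(hM.isOpen hK).frontier_eq]
  exact ⟨hxK, disjoint_left.1 ((hM.disjoint L hL K hK hne).closure_left (hM.isOpen hK)) hxL⟩

lemma surf_interface_ne_top (hM : IsAdmissibleMesh 𝒯 α h) {K L : Set (Rd d)} (hK : K ∈ 𝒯)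
    (hL : L ∈ 𝒯) (hne : L ≠ K) : surf d (interface K L) ≠ ∞ :=
  ne_top_of_le_ne_top (hM.surf_frontier_ne_top hK)
    (measure_mono (hM.interface_subset_frontier hK hL hne))

/-- Such cells lie in a ball of radius enlarged by `h`; they are disjoint, and each has volume at
least `α h ^ d > 0`. -/
lemma finite_meeting (hM : IsAdmissibleMesh 𝒯 α h) (hd : 0 < d) {B : Set (Rd d)}
    (hB : Bornology.IsBounded B) : {L | L ∈ 𝒯 ∧ (closure L ∩ B).Nonempty}.Finite := by
  have hh := hM.size_pos hd
  obtain ⟨R, hR⟩ := hB.subset_closedBall (0 : Rd d)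
  have hsub : ∀ L ∈ {L | L ∈ 𝒯 ∧ (closure L ∩ B).Nonempty}, L ⊆ Metric.closedBall 0 (R + h) := by
    rintro L ⟨hL, x, hxL, hxB⟩ y hy
    have hbd := (hM.polygonal L hL).isBounded.closure
    have h1 : dist y x ≤ h := by
      refine (Metric.dist_le_diam_of_mem hbd (subset_closure hy) hxL).trans ?_
      rw [Metric.diam_closure]; exact hM.diam_le hL
    have h2 := Metric.mem_closedBall.1 (hR hxB)
    rw [Metric.mem_closedBall]
    linarith [dist_triangle y x 0]
  have hε : 0 < ENNReal.ofReal (α * h ^ d) :=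
    ENNReal.ofReal_pos.2 (mul_pos hM.alpha_pos (pow_pos hh d))
  have hfin := Measure.finite_const_le_meas_of_disjoint_iUnion (volume : Measure (Rd d)) hε
    (As := fun L : {L | L ∈ 𝒯 ∧ (closure L ∩ B).Nonempty} => L.1)
    (fun L => (hM.isOpen L.2.1).measurableSet)
    (fun L L' hne => hM.disjoint _ L.2.1 _ L'.2.1 fun h => hne (Subtype.ext h))
    (ne_top_of_le_ne_top (isCompact_closedBall (0 : Rd d) (R + h)).measure_lt_top.ne
      (measure_mono (iUnion_subset fun L => hsub L.1 L.2)))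
  have huniv : {L : {L | L ∈ 𝒯 ∧ (closure L ∩ B).Nonempty} |
      ENNReal.ofReal (α * h ^ d) ≤ volume L.1} = univ :=
    eq_univ_of_forall fun L => hM.volume_ge _ L.2.1
  rw [huniv] at hfin
  exact finite_univ_iff.1 hfin

lemma finite_neighbors (hM : IsAdmissibleMesh 𝒯 α h) (hd : 0 < d) {K : Set (Rd d)} (hK : K ∈ 𝒯) :
    (neighbors 𝒯 K).Finite := by
  refine (hM.finite_meeting hd (hM.polygonal K hK).isBounded.closure).subset ?_
  rintro L ⟨hL, -, hpos⟩
  refine ⟨hL, ?_⟩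
  rw [inter_comm]
  by_contra hne
  rw [not_nonempty_iff_eq_empty] at hne
  rw [interface, hne, measure_empty] at hpos
  exact lt_irrefl _ hpos

lemma mem_neighbors_comm {K L : Set (Rd d)} (hK : K ∈ 𝒯)
    (h : L ∈ neighbors 𝒯 K) : K ∈ neighbors 𝒯 L :=
  ⟨hK, h.2.1.symm, by rw [interface_comm]; exact h.2.2⟩

lemma countable (hM : IsAdmissibleMesh 𝒯 α h) : 𝒯.Countable :=
  PairwiseDisjoint.countable_of_isOpen (s := id) (fun K hK L hL hne => hM.disjoint K hK L hL hne)
    (fun _ hK => hM.isOpen hK) fun K hK => (hM.connected K hK).nonempty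

lemma ae_outwardNormal_neg (hM : IsAdmissibleMesh 𝒯 α h) {K L : Set (Rd d)} (hK : K ∈ 𝒯)
    (hL : L ∈ 𝒯) (hne : L ≠ K) :
    ∀ᵐ x ∂surf d, x ∈ interface K L → outwardNormal L x = -outwardNormal K x := by
  filter_upwards [(hM.polygonal K hK).ae_exists_halfBallIn, (hM.polygonal L hL).ae_exists_halfBallIn]
    with x hxK hxL hx
  obtain ⟨n, hn⟩ := hxK (hM.interface_subset_frontier hK hL hne hx)
  obtain ⟨n', hn'⟩ := hxL (hM.interface_subset_frontier hL hK hne.symm (interface_comm K L ▸ hx))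
  have hdis := hM.disjoint K hK L hL hne.symm
  rw [(hn.isOutwardNormalAt hn' hdis).outwardNormal_eq,
    (hn'.isOutwardNormalAt hn hdis.symm).outwardNormal_eq, hn.eq_neg hn' hdis]

/-- At almost every common point three disjoint cells would each contain a half ball. Their unit
vectors would be pairwise opposite, which is impossible for three. -/
lemma aedisjoint_interface (hM : IsAdmissibleMesh 𝒯 α h) {K L L' : Set (Rd d)} (hK : K ∈ 𝒯)
    (hL : L ∈ 𝒯) (hL' : L' ∈ 𝒯) (hne : L ≠ K) (hne' : L' ≠ K) (hLL' : L ≠ L') :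
    AEDisjoint (surf d) (interface K L) (interface K L') := by
  refine measure_eq_zero_iff_ae_notMem.2 ?_
  filter_upwards [(hM.polygonal K hK).ae_exists_halfBallIn, (hM.polygonal L hL).ae_exists_halfBallIn,
    (hM.polygonal L' hL').ae_exists_halfBallIn] with x hxK hxL hxL' hx
  obtain ⟨n, hn⟩ := hxK (hM.interface_subset_frontier hK hL hne hx.1)
  obtain ⟨n₁, hn₁⟩ := hxL (hM.interface_subset_frontier hL hK hne.symm (interface_comm K L ▸ hx.1))
  obtain ⟨n₂, hn₂⟩ :=
    hxL' (hM.interface_subset_frontier hL' hK hne'.symm (interface_comm K L' ▸ hx.2))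
  have e1 := hn.eq_neg hn₁ (hM.disjoint K hK L hL hne.symm)
  have e2 := hn.eq_neg hn₂ (hM.disjoint K hK L' hL' hne'.symm)
  have e3 := hn₁.eq_neg hn₂ (hM.disjoint L hL L' hL' hLL')
  rw [e1, e2, neg_neg] at e3
  have h0 : n = 0 := by
    have : (2 : ℝ) • n = 0 := by rw [two_smul]; nth_rewrite 1 [← e3]; simp
    simpa using this
  have := hn.1
  simp [h0] at this

/-- The half ball outside `K` is covered by the closures of other cells. Only finitely many come
near, so their union is closed and contains `x`. -/
lemma exists_mem_interface (hM : IsAdmissibleMesh 𝒯 α h) (hd : 0 < d) {K : Set (Rd d)}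
    {x n : Rd d} (hK : K ∈ 𝒯) (hn : IsOutwardNormalAt K x n) :
    ∃ L ∈ 𝒯, L ≠ K ∧ x ∈ interface K L := by
  have hxK := frontier_subset_closure (mem_frontier_of_isOutwardNormalAt hn)
  obtain ⟨hn1, r, hr, H⟩ := hn
  let U : Set (Rd d) := Metric.ball x r ∩ {y | 0 < ⟪y - x, n⟫_ℝ}
  have hUo : IsOpen U := Metric.isOpen_ball.inter
    (isOpen_lt continuous_const (by fun_prop))
  have hUK : Disjoint (closure K) U :=
    (disjoint_right.2 fun y hy => (H y hy.1).2 hy.2).closure_left hUo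
  have hfin := (hM.finite_meeting hd (Metric.isBounded_ball (x := x) (r := r))).subset
    (t := {L | (L ∈ 𝒯 ∧ (closure L ∩ Metric.ball x r).Nonempty) ∧ L ≠ K}) fun L hL => hL.1
  have hcl : IsClosed (⋃ L ∈ {L | (L ∈ 𝒯 ∧ (closure L ∩ Metric.ball x r).Nonempty) ∧ L ≠ K},
      closure L) := hfin.isClosed_biUnion fun L _ => isClosed_closure
  have hUsub : U ⊆ ⋃ L ∈ {L | (L ∈ 𝒯 ∧ (closure L ∩ Metric.ball x r).Nonempty) ∧ L ≠ K},
      closure L := by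
    intro y hy
    obtain ⟨L, hL, hyL⟩ := mem_iUnion₂.1 (hM.cover.symm ▸ mem_univ y)
    refine mem_iUnion₂.2 ⟨L, ⟨⟨hL, y, hyL, hy.1⟩, ?_⟩, hyL⟩
    rintro rfl
    exact disjoint_left.1 hUK hyL hy
  have hxU : x ∈ closure U := by
    rw [Metric.mem_closure_iff]
    intro t ht
    obtain ⟨ε, hε, h1, -⟩ := exists_small_smul_mem_ball x n (lt_min hr ht)
    refine ⟨_, ⟨Metric.ball_subset_ball (min_le_left _ _) h1, ?_⟩, ?_⟩
    · change 0 < ⟪x + ε • n - x, n⟫_ℝ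
      rw [add_sub_cancel_left, real_inner_smul_left, real_inner_self_eq_norm_sq, hn1]
      linarith
    · rw [dist_comm]
      exact Metric.ball_subset_ball (min_le_right _ _) h1
  obtain ⟨L, hL, hxL⟩ := mem_iUnion₂.1 (closure_minimal hUsub hcl hxU)
  exact ⟨L, hL.1.1, hL.2, hxK, hxL⟩

/-- Up to a null set, the boundary points of a control volume with a normal lie on interfaces. -/
lemma ae_mem_interface (hM : IsAdmissibleMesh 𝒯 α h) (hd : 0 < d) {K : Set (Rd d)} (hK : K ∈ 𝒯) :
    ∀ᵐ x ∂surf d, outwardNormal K x ≠ 0 → x ∈ ⋃ L ∈ neighbors 𝒯 K, interface K L := by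
  have hnull : ∀ L ∈ 𝒯, ∀ᵐ x ∂surf d, L ≠ K → x ∈ interface K L → L ∈ neighbors 𝒯 K := by
    intro L hL
    by_cases hpos : surf d (interface K L) = 0
    · filter_upwards [measure_eq_zero_iff_ae_notMem.1 hpos] with x hx _ hx'
      exact absurd hx' hx
    · exact Eventually.of_forall fun x hne _ => ⟨hL, hne, pos_iff_ne_zero.2 hpos⟩
  filter_upwards [(ae_ball_iff hM.countable).2 hnull] with x hx hnx
  have : ∃ n, IsOutwardNormalAt K x n := by
    by_contra hcon
    exact hnx (outwardNormal_eq_zero hcon)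
  obtain ⟨n, hn⟩ := this
  obtain ⟨L, hL, hne, hxL⟩ := hM.exists_mem_interface hd hK hn
  exact mem_iUnion₂.2 ⟨L, hx L hL hne hxL, hxL⟩

lemma sum_surf_interface_le (hM : IsAdmissibleMesh 𝒯 α h) (hd : 0 < d) {K : Set (Rd d)}
    (hK : K ∈ 𝒯) : ∑ L ∈ (hM.finite_neighbors hd hK).toFinset, (surf d (interface K L)).toReal ≤
      1 / α * h ^ (d - 1) := by
  rw [← ENNReal.toReal_sum, ← measure_biUnion_finset₀]
  · refine ENNReal.toReal_le_of_le_ofReal ?_ ((measure_mono ?_).trans (hM.boundary_le K hK))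
    · have := hM.size_pos hd
      have := hM.alpha_pos
      positivity
    · refine iUnion₂_subset fun L hL => ?_
      have hL := (Finite.mem_toFinset _).1 hL
      exact hM.interface_subset_frontier hK hL.1 hL.2.1
  · intro L hL L' hL' hne
    simp only [Finite.coe_toFinset] at hL hL'
    exact hM.aedisjoint_interface hK hL.1 hL'.1 hL.2.1 hL'.2.1 hne
  · exact fun L _ => (isClosed_interface K L).measurableSet.nullMeasurableSet
  · intro L hL
    have hL := (Finite.mem_toFinset _).1 hL
    exact hM.surf_interface_ne_top hK hL.1 hL.2.1

/-- The interfaces need not exhaust the boundary: what they miss has zero normal almost everywhere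
and carries no flux. -/
lemma sum_setIntegral_interface (hM : IsAdmissibleMesh 𝒯 α h) (hd : 0 < d) {K : Set (Rd d)}
    (hK : K ∈ 𝒯) {g : Rd d → Rd d} (hg : Continuous g) :
    ∑ L ∈ (hM.finite_neighbors hd hK).toFinset,
      ∫ x in interface K L, ⟪g x, outwardNormal K x⟫_ℝ ∂surf d =
    ∫ x in frontier K, ⟪g x, outwardNormal K x⟫_ℝ ∂surf d := by
  have hfin := hM.finite_neighbors hd hK
  have hsub : (⋃ L : {L // L ∈ hfin.toFinset}, interface K L.1) ⊆ frontier K := by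
    refine iUnion_subset fun L => ?_
    have hL := (Finite.mem_toFinset _).1 L.2
    exact hM.interface_subset_frontier hK hL.1 hL.2.1
  have hgint := (hM.polygonal K hK).integrableOn_inner_outwardNormal (hM.surf_frontier_ne_top hK) hg
  rw [setIntegral_eq_of_subset_of_ae_sdiff_eq_zero isClosed_frontier.measurableSet.nullMeasurableSet
    hsub, integral_iUnion_ae, tsum_fintype, ← Finset.sum_coe_sort]
  · exact fun L => (isClosed_interface K L.1).measurableSet.nullMeasurableSet
  · intro L L' hne
    have hL := (Finite.mem_toFinset _).1 L.2
    have hL' := (Finite.mem_toFinset _).1 L'.2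
    exact hM.aedisjoint_interface hK hL.1 hL'.1 hL.2.1 hL'.2.1 fun h => hne (Subtype.ext h)
  · exact hgint.mono_set hsub
  · filter_upwards [hM.ae_mem_interface hd hK] with x hx hxd
    by_cases h0 : outwardNormal K x = 0
    · rw [h0, inner_zero_right]
    · exfalso
      obtain ⟨L, hL, hxL⟩ := mem_iUnion₂.1 (hx h0)
      exact hxd.2 (mem_iUnion.2 ⟨⟨L, hfin.mem_toFinset.2 hL⟩, hxL⟩)

end IsAdmissibleMesh

/-! ### The fluxes through the interfaces -/

namespace VelocityAssumption

variable {d : ℕ} {v : ℝ → Rd d → Rd d} {T V : ℝ}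

lemma contDiff (hv : VelocityAssumption v T V) {t : ℝ} (ht : t ∈ Icc 0 T) : ContDiff ℝ 1 (v t) := by
  have h1 : ContDiff ℝ 1 fun x : Rd d => (t, x) := by fun_prop
  exact contDiffOn_univ.1 (hv.contDiffOn.comp (h1.contDiffOn (s := univ)) fun x _ => ⟨ht, mem_univ _⟩)

lemma nonneg (hv : VelocityAssumption v T V) (hT : 0 < T) : 0 ≤ V :=
  (norm_nonneg _).trans (hv.bounded 0 ⟨le_rfl, hT⟩ 0)

end VelocityAssumption

open Classical in
/-- The flux through the interface `K|L` out of `K`, extended by `0` to all pairs `K`, `L`. -/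
noncomputable def meshFlux {d : ℕ} (𝒯 : Set (Set (Rd d))) (v : ℝ → Rd d → Rd d) (a b : ℝ)
    (K L : Set (Rd d)) : ℝ :=
  if L ∈ neighbors 𝒯 K then (surf d (interface K L)).toReal * normalVelocity v K L a b else 0

namespace IsAdmissibleMesh

variable {d : ℕ} {𝒯 : Set (Set (Rd d))} {α h : ℝ} {v : ℝ → Rd d → Rd d} {T V a b : ℝ}

lemma toReal_surf_pos (hM : IsAdmissibleMesh 𝒯 α h) {K L : Set (Rd d)} (hK : K ∈ 𝒯)
    (hL : L ∈ neighbors 𝒯 K) : 0 < (surf d (interface K L)).toReal :=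
  ENNReal.toReal_pos hL.2.2.ne' (hM.surf_interface_ne_top hK hL.1 hL.2.1)

lemma meshFlux_eq (hM : IsAdmissibleMesh 𝒯 α h) {K L : Set (Rd d)} (hK : K ∈ 𝒯)
    (hL : L ∈ neighbors 𝒯 K) : meshFlux 𝒯 v a b K L =
      1 / (b - a) * ∫ t in a..b, ∫ x in interface K L, ⟪v t x, outwardNormal K x⟫_ℝ ∂surf d := by
  have := (hM.toReal_surf_pos hK hL).ne'
  rw [meshFlux, if_pos hL, normalVelocity, ← mul_assoc]
  congr 1
  rw [one_div, one_div, mul_inv_rev, ← mul_assoc, mul_inv_cancel₀ this, one_mul]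

/-- Conservativity of the scheme: the normals from the two sides are opposite almost everywhere on
the interface. -/
lemma meshFlux_antisymm (hM : IsAdmissibleMesh 𝒯 α h) {K L : Set (Rd d)} (hK : K ∈ 𝒯)
    (hL : L ∈ 𝒯) : meshFlux 𝒯 v a b L K = -meshFlux 𝒯 v a b K L := by
  by_cases hKL : L ∈ neighbors 𝒯 K
  · rw [hM.meshFlux_eq hK hKL, hM.meshFlux_eq hL (mem_neighbors_comm hK hKL), ← mul_neg,
      ← intervalIntegral.integral_neg]
    congr 2
    ext t
    rw [← integral_neg, interface_comm]
    refine setIntegral_congr_ae (isClosed_interface K L).measurableSet ?_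
    filter_upwards [hM.ae_outwardNormal_neg hK hL hKL.2.1] with x hx hxi
    rw [hx hxi, inner_neg_right]
  · have hLK : K ∉ neighbors 𝒯 L := fun h => hKL (mem_neighbors_comm hL h)
    rw [meshFlux, meshFlux, if_neg hKL, if_neg hLK, neg_zero]

lemma continuousOn_setIntegral_interface (hM : IsAdmissibleMesh 𝒯 α h)
    (hv : VelocityAssumption v T V) {K L : Set (Rd d)} (hK : K ∈ 𝒯) (hL : L ∈ neighbors 𝒯 K) :
    ContinuousOn (fun t => ∫ x in interface K L, ⟪v t x, outwardNormal K x⟫_ℝ ∂surf d)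
      (Icc 0 T) := by
  have hsub := hM.interface_subset_frontier hK hL.1 hL.2.1
  have hcomp : IsCompact (interface K L) :=
    (hM.polygonal K hK).isBounded.isCompact_closure.of_isClosed_subset (isClosed_interface K L)
      inter_subset_left
  have hvc := hv.contDiffOn.continuousOn
  obtain ⟨M, hMb⟩ := (isCompact_Icc.prod hcomp).exists_bound_of_continuousOn
    (hvc.mono (prod_mono_right (subset_univ _)))
  have : IsFiniteMeasure ((surf d).restrict (interface K L)) :=
    isFiniteMeasure_restrict.2 (hM.surf_interface_ne_top hK hL.1 hL.2.1)
  refine continuousOn_of_dominated (bound := fun _ => M) (fun t ht => ?_) (fun t ht => ?_)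
    (integrable_const M) (Eventually.of_forall fun x => ?_)
  · exact (hv.contDiff ht).continuous.aestronglyMeasurable.inner
      ((hM.polygonal K hK).aestronglyMeasurable_outwardNormal.mono_measure
        (Measure.restrict_mono hsub le_rfl))
  · filter_upwards [ae_restrict_mem (isClosed_interface K L).measurableSet] with x hx
    calc ‖⟪v t x, outwardNormal K x⟫_ℝ‖ ≤ ‖v t x‖ * ‖outwardNormal K x‖ := norm_inner_le_norm _ _
      _ ≤ ‖v t x‖ * 1 := by gcongr; exact norm_outwardNormal_le K x
      _ ≤ M := by rw [mul_one]; exact hMb (t, x) ⟨ht, hx⟩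
  · have h1 : ContinuousOn (fun t => v t x) (Icc 0 T) :=
      hvc.comp (f := fun t : ℝ => (t, x)) (by fun_prop) fun t ht => ⟨ht, mem_univ _⟩
    exact h1.inner continuousOn_const

lemma sum_meshFlux (hM : IsAdmissibleMesh 𝒯 α h) (hd : 0 < d) (hv : VelocityAssumption v T V)
    (ha : 0 ≤ a) (hab : a ≤ b) (hb : b ≤ T) {K : Set (Rd d)} (hK : K ∈ 𝒯) :
    ∑ L ∈ (hM.finite_neighbors hd hK).toFinset, meshFlux 𝒯 v a b K L = 0 := by
  rw [Finset.sum_congr rfl fun L hL => hM.meshFlux_eq hK ((Finite.mem_toFinset _).1 hL),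
    ← Finset.mul_sum, ← intervalIntegral.integral_finsetSum, intervalIntegral.integral_zero_ae,
    mul_zero]
  -- The divergence condition holds on `[0, T)` only, and the last time step may end at `T`; that
  -- single instant is discarded.
  · filter_upwards [Measure.ae_ne volume T] with t htT ht
    rw [uIoc_of_le hab] at ht
    have ht' : t ∈ Ico 0 T := ⟨ha.trans ht.1.le, lt_of_le_of_ne (ht.2.trans hb) htT⟩
    have hc := hv.contDiff (Ico_subset_Icc_self ht')
    rw [hM.sum_setIntegral_interface hd hK hc.continuous]
    exact (hM.polygonal K hK).integral_inner_outwardNormal_eq_zero (hM.surf_frontier_ne_top hK) hc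
      (hv.div_free t ht')
  · intro L hL
    refine ContinuousOn.intervalIntegrable_of_Icc hab ?_
    exact (hM.continuousOn_setIntegral_interface hv hK ((Finite.mem_toFinset _).1 hL)).mono
      (Icc_subset_Icc ha hb)

lemma abs_meshFlux_le (hM : IsAdmissibleMesh 𝒯 α h) (hv : VelocityAssumption v T V)
    (ha : 0 ≤ a) (hab : a < b) (hb : b ≤ T) {K L : Set (Rd d)} (hK : K ∈ 𝒯)
    (hL : L ∈ neighbors 𝒯 K) :
    |meshFlux 𝒯 v a b K L| ≤ V * (surf d (interface K L)).toReal := by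
  have hba : 0 < b - a := sub_pos.2 hab
  rw [hM.meshFlux_eq hK hL, abs_mul, abs_of_pos (by positivity), one_div, inv_mul_le_iff₀ hba]
  have := intervalIntegral.norm_integral_le_of_norm_le_const_ae (a := a) (b := b)
    (f := fun t => ∫ x in interface K L, ⟪v t x, outwardNormal K x⟫_ℝ ∂surf d)
    (C := V * (surf d (interface K L)).toReal) ?_
  · rwa [abs_of_pos hba, mul_comm, Real.norm_eq_abs] at this
  filter_upwards [Measure.ae_ne volume T] with t htT ht
  rw [uIoc_of_le hab.le] at ht
  have ht' : t ∈ Ico 0 T := ⟨ha.trans ht.1.le, lt_of_le_of_ne (ht.2.trans hb) htT⟩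
  refine norm_setIntegral_le_of_norm_le_const
    (hM.surf_interface_ne_top hK hL.1 hL.2.1).lt_top fun x _ => ?_
  calc ‖⟪v t x, outwardNormal K x⟫_ℝ‖ ≤ ‖v t x‖ * ‖outwardNormal K x‖ := norm_inner_le_norm _ _
    _ ≤ ‖v t x‖ * 1 := by gcongr; exact norm_outwardNormal_le K x
    _ ≤ V := by rw [mul_one]; exact hv.bounded t ht' x

lemma sum_abs_meshFlux_le (hM : IsAdmissibleMesh 𝒯 α h) (hd : 0 < d)
    (hv : VelocityAssumption v T V) (ha : 0 ≤ a) (hab : a < b) (hb : b ≤ T) {K : Set (Rd d)}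
    (hK : K ∈ 𝒯) : ∑ L ∈ (hM.finite_neighbors hd hK).toFinset, |meshFlux 𝒯 v a b K L| ≤
      V * (1 / α * h ^ (d - 1)) := by
  calc _ ≤ ∑ L ∈ (hM.finite_neighbors hd hK).toFinset, V * (surf d (interface K L)).toReal :=
        Finset.sum_le_sum fun L hL =>
          hM.abs_meshFlux_le hv ha hab hb hK ((Finite.mem_toFinset _).1 hL)
    _ ≤ _ := by
      rw [← Finset.mul_sum]
      exact mul_le_mul_of_nonneg_left (hM.sum_surf_interface_le hd hK)
        (hv.nonneg (ha.trans_lt (hab.trans_le hb)))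

end IsAdmissibleMesh

/-! ### Moments of the compensated Poisson random measure -/

/-- The term at zero vanishes and `k / k! = 1 / (k-1)!`, so an index shift reduces this moment to
the total mass. -/
lemma hasSum_poisson_weight_mul (r : ℝ≥0) :
    HasSum (fun k : ℕ => Real.exp (-r) * (r : ℝ) ^ k / (k.factorial : ℝ) * k) r := by
  rw [← hasSum_nat_add_iff' 1]
  have h := (hasSum_one_poissonMeasure r).mul_left (r : ℝ)
  simp only [Finset.sum_range_one, Nat.cast_zero, mul_zero, sub_zero]
  rw [mul_one] at h
  refine h.congr_fun fun k => ?_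
  rw [Nat.factorial_succ]
  push_cast
  rw [pow_succ]
  field_simp

lemma hasSum_poisson_weight_mul_sq (r : ℝ≥0) :
    HasSum (fun k : ℕ => Real.exp (-r) * (r : ℝ) ^ k / (k.factorial : ℝ) * (k : ℝ) ^ 2)
      (r ^ 2 + r) := by
  rw [← hasSum_nat_add_iff' 1]
  have h := ((hasSum_poisson_weight_mul r).add (hasSum_one_poissonMeasure r)).mul_left (r : ℝ)
  simp only [Finset.sum_range_one, Nat.cast_zero, ne_eq, OfNat.ofNat_ne_zero, not_false_eq_true,
    zero_pow, mul_zero, sub_zero]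
  rw [show (r : ℝ) * (r + 1) = r ^ 2 + r by ring] at h
  refine h.congr_fun fun k => ?_
  rw [Nat.factorial_succ]
  push_cast
  rw [pow_succ]
  field_simp

lemma integrable_cast_poissonMeasure (r : ℝ≥0) :
    Integrable (fun k : ℕ => (k : ℝ)) (poissonMeasure r) :=
  integrable_poissonMeasure_iff.2 (by simpa using (hasSum_poisson_weight_mul r).summable)

lemma integrable_cast_sq_poissonMeasure (r : ℝ≥0) :
    Integrable (fun k : ℕ => (k : ℝ) ^ 2) (poissonMeasure r) :=
  integrable_poissonMeasure_iff.2 (by simpa using (hasSum_poisson_weight_mul_sq r).summable)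

lemma integral_cast_poissonMeasure (r : ℝ≥0) : ∫ k : ℕ, (k : ℝ) ∂poissonMeasure r = r := by
  rw [integral_poissonMeasure]
  exact (hasSum_poisson_weight_mul r).tsum_eq

lemma integral_cast_sq_poissonMeasure (r : ℝ≥0) :
    ∫ k : ℕ, (k : ℝ) ^ 2 ∂poissonMeasure r = r ^ 2 + r := by
  rw [integral_poissonMeasure]
  exact (hasSum_poisson_weight_mul_sq r).tsum_eq

/-- The compensated mass of `J × A`. -/
noncomputable def compensated {Ω E : Type*} [MeasurableSpace E] (m : Measure E)
    (N : Ω → Measure (ℝ × E)) (J : Set ℝ) (A : Set E) (ω : Ω) : ℝ :=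
  (N ω (J ×ˢ A)).toReal - (volume J * m A).toReal

/-- The σ-algebra generated by the noise after time `t`. -/
abbrev futureNoise {Ω E : Type*} [MeasurableSpace E] (N : Ω → Measure (ℝ × E)) (t : ℝ≥0) : MeasurableSpace Ω :=
  ⨆ B ∈ {B : Set (ℝ × E) | MeasurableSet B ∧ B ⊆ Ioi (t : ℝ) ×ˢ univ},
    MeasurableSpace.comap (fun ω => N ω B) inferInstance

lemma measurable_compensated_futureNoise {Ω E : Type*} [MeasurableSpace E] {m : Measure E}
    {N : Ω → Measure (ℝ × E)} {J : Set ℝ} {A : Set E} {t : ℝ≥0} (hJt : J ⊆ Ioi (t : ℝ)) (hJ : MeasurableSet J)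
    (hA : MeasurableSet A) : Measurable[futureNoise N t] (compensated m N J A) := by
  have h1 : Measurable[futureNoise N t] fun ω => N ω (J ×ˢ A) := by
    refine measurable_iff_comap_le.2 ?_
    exact le_iSup₂_of_le (f := fun B (_ : B ∈ {B : Set (ℝ × E) |
      MeasurableSet B ∧ B ⊆ Ioi (t : ℝ) ×ˢ univ}) =>
      MeasurableSpace.comap (fun ω => N ω B) inferInstance) (J ×ˢ A)
      ⟨hJ.prod hA, prod_mono hJt (subset_univ _)⟩ le_rfl
  exact h1.ennreal_toReal.sub_const _

section Noise

variable {Ω E : Type*} [mΩ : MeasurableSpace Ω] [MeasurableSpace E] {P : Measure Ω}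
  {ℱ : Filtration ℝ≥0 mΩ} {m : Measure E} {N : Ω → Measure (ℝ × E)} {J : Set ℝ} {A : Set E}

namespace IsPoissonNoise

lemma intensity_prod [SigmaFinite m] (hJ0 : J ⊆ Ici 0) (hJ : MeasurableSet J) :
    (((volume : Measure ℝ).restrict (Ici 0)).prod m) (J ×ˢ A) = volume J * m A := by
  rw [Measure.prod_prod, Measure.restrict_apply hJ, inter_eq_left.2 hJ0]

lemma measurable_compensated (hN : IsPoissonNoise P ℱ m N) (hJ : MeasurableSet J)
    (hA : MeasurableSet A) : Measurable (compensated m N J A) :=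
  (hN.poisson.measurable _ (hJ.prod hA)).ennreal_toReal.sub_const _

lemma adapted_compensated (hN : IsPoissonNoise P ℱ m N) {t : ℝ≥0} (hJt : J ⊆ Icc 0 (t : ℝ))
    (hJ : MeasurableSet J) (hA : MeasurableSet A) :
    Measurable[ℱ t] (compensated m N J A) :=
  (hN.adapted t _ (hJ.prod hA) (prod_mono hJt (subset_univ _))).ennreal_toReal.sub_const _

variable [SigmaFinite m]

lemma law_prod (hN : IsPoissonNoise P ℱ m N) (hJ0 : J ⊆ Ici 0) (hJ : MeasurableSet J)
    (hA : MeasurableSet A) (hfin : volume J * m A ≠ ∞) :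
    P.map (fun ω => N ω (J ×ˢ A)) =
      (poissonMeasure (volume J * m A).toNNReal).map (fun k : ℕ => (k : ℝ≥0∞)) := by
  have h := hN.poisson.law (J ×ˢ A) (hJ.prod hA)
  rw [intensity_prod hJ0 hJ] at h
  exact h hfin

lemma integral_comp_toReal (hN : IsPoissonNoise P ℱ m N) (hJ0 : J ⊆ Ici 0) (hJ : MeasurableSet J)
    (hA : MeasurableSet A) (hfin : volume J * m A ≠ ∞) {g : ℝ → ℝ} (hg : Measurable g) :
    ∫ ω, g (N ω (J ×ˢ A)).toReal ∂P =
      ∫ k : ℕ, g k ∂poissonMeasure (volume J * m A).toNNReal := by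
  have hgm : Measurable fun x : ℝ≥0∞ => g x.toReal := hg.comp ENNReal.measurable_toReal
  rw [← integral_map (hN.poisson.measurable _ (hJ.prod hA)).aemeasurable
    (f := fun x : ℝ≥0∞ => g x.toReal) hgm.aestronglyMeasurable, hN.law_prod hJ0 hJ hA hfin,
    integral_map (by fun_prop) hgm.aestronglyMeasurable]
  simp

lemma integrable_comp_toReal (hN : IsPoissonNoise P ℱ m N) (hJ0 : J ⊆ Ici 0)
    (hJ : MeasurableSet J) (hA : MeasurableSet A) (hfin : volume J * m A ≠ ∞) {g : ℝ → ℝ}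
    (hg : Measurable g)
    (hgint : Integrable (fun k : ℕ => g k) (poissonMeasure (volume J * m A).toNNReal)) :
    Integrable (fun ω => g (N ω (J ×ˢ A)).toReal) P := by
  have hgm : Measurable fun x : ℝ≥0∞ => g x.toReal := hg.comp ENNReal.measurable_toReal
  have h1 := integrable_map_measure (μ := P) (f := fun ω => N ω (J ×ˢ A))
    (g := fun x : ℝ≥0∞ => g x.toReal) hgm.aestronglyMeasurable
    (hN.poisson.measurable _ (hJ.prod hA)).aemeasurable
  refine h1.1 ?_
  rw [hN.law_prod hJ0 hJ hA hfin, integrable_map_measure hgm.aestronglyMeasurable (by fun_prop)]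
  simpa [Function.comp_def] using hgint

lemma integrable_sub_sq_poisson (r : ℝ≥0) :
    Integrable (fun k : ℕ => ((k : ℝ) - r) ^ 2) (poissonMeasure r) := by
  refine (((integrable_cast_sq_poissonMeasure r).sub
    ((integrable_cast_poissonMeasure r).const_mul (2 * r))).add
    (integrable_const ((r : ℝ) ^ 2))).congr (Eventually.of_forall fun k => ?_)
  simp only [Pi.add_apply, Pi.sub_apply]
  ring

lemma memLp_compensated [IsProbabilityMeasure P] (hN : IsPoissonNoise P ℱ m N) (hJ0 : J ⊆ Ici 0)
    (hJ : MeasurableSet J) (hA : MeasurableSet A) (hfin : volume J * m A ≠ ∞) :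
    MemLp (compensated m N J A) 2 P := by
  rw [memLp_two_iff_integrable_sq (hN.measurable_compensated hJ hA).aestronglyMeasurable]
  exact hN.integrable_comp_toReal hJ0 hJ hA hfin
    (g := fun x => (x - (volume J * m A).toReal) ^ 2) (by fun_prop) (integrable_sub_sq_poisson _)

lemma integral_compensated [IsProbabilityMeasure P] (hN : IsPoissonNoise P ℱ m N)
    (hJ0 : J ⊆ Ici 0) (hJ : MeasurableSet J) (hA : MeasurableSet A) (hfin : volume J * m A ≠ ∞) :
    ∫ ω, compensated m N J A ω ∂P = 0 := by
  have h := hN.integral_comp_toReal hJ0 hJ hA hfin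
    (g := fun x => x - (volume J * m A).toReal) (by fun_prop)
  refine h.trans ?_
  rw [integral_sub (integrable_cast_poissonMeasure _) (integrable_const _),
    integral_cast_poissonMeasure]
  simp [ENNReal.coe_toNNReal_eq_toReal]

lemma integral_compensated_sq [IsProbabilityMeasure P] (hN : IsPoissonNoise P ℱ m N)
    (hJ0 : J ⊆ Ici 0) (hJ : MeasurableSet J) (hA : MeasurableSet A) (hfin : volume J * m A ≠ ∞) :
    ∫ ω, compensated m N J A ω ^ 2 ∂P = (volume J * m A).toReal := by
  have h := hN.integral_comp_toReal hJ0 hJ hA hfin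
    (g := fun x => (x - (volume J * m A).toReal) ^ 2) (by fun_prop)
  refine h.trans ?_
  set r := (volume J * m A).toNNReal with hr
  have hrr : (volume J * m A).toReal = r := rfl
  rw [hrr]
  have : ∀ k : ℕ, ((k : ℝ) - r) ^ 2 = (k : ℝ) ^ 2 - 2 * r * k + (r : ℝ) ^ 2 := fun k => by ring
  simp_rw [this]
  have hi : Integrable (fun k : ℕ => (k : ℝ) ^ 2 - 2 * r * k) (poissonMeasure r) :=
    (integrable_cast_sq_poissonMeasure r).sub ((integrable_cast_poissonMeasure r).const_mul (2 * r))
  rw [integral_add hi (integrable_const _), integral_sub (integrable_cast_sq_poissonMeasure r)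
    ((integrable_cast_poissonMeasure r).const_mul (2 * r)), integral_const_mul,
    integral_cast_poissonMeasure, integral_cast_sq_poissonMeasure]
  simp
  ring

end IsPoissonNoise

namespace IsPoissonNoise

lemma futureNoise_le (hN : IsPoissonNoise P ℱ m N) (t : ℝ≥0) : futureNoise N t ≤ mΩ :=
  iSup₂_le fun B hB => (hN.poisson.measurable B hB.1).comap_le

/-- Independence of the noise after `t` from the past is what makes the increments behave like
martingale differences. -/
lemma integral_mul_future (hN : IsPoissonNoise P ℱ m N) {t : ℝ≥0} {X Y : Ω → ℝ}
    (hX : Measurable[ℱ t] X) (hY : Measurable[futureNoise N t] Y) :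
    ∫ ω, X ω * Y ω ∂P = (∫ ω, X ω ∂P) * ∫ ω, Y ω ∂P := by
  have hind : IndepFun X Y P := by
    rw [IndepFun_iff_Indep]
    exact (indep_of_indep_of_le_right (indep_of_indep_of_le_left (hN.indep t)
      (measurable_iff_comap_le.1 hY)) (measurable_iff_comap_le.1 hX)).symm
  exact hind.integral_mul_eq_mul_integral (hX.mono (ℱ.le t) le_rfl).aestronglyMeasurable
    (hY.mono (hN.futureNoise_le t) le_rfl).aestronglyMeasurable

lemma integral_compensated_mul [IsProbabilityMeasure P] [SigmaFinite m]
    (hN : IsPoissonNoise P ℱ m N) {A' : Set E} (hJ0 : J ⊆ Ici 0) (hJ : MeasurableSet J)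
    (hA : MeasurableSet A) (hA' : MeasurableSet A') (hfin : volume J * m A ≠ ∞)
    (hAA' : Disjoint A A') :
    ∫ ω, compensated m N J A ω * compensated m N J A' ω ∂P = 0 := by
  have hind := hN.poisson.indep 2 ![J ×ˢ A, J ×ˢ A']
    (by intro i; fin_cases i <;> simp [hJ.prod hA, hJ.prod hA']) (by
      have h1 : Disjoint (J ×ˢ A) (J ×ˢ A') := Disjoint.set_prod_right hAA' J J
      intro i j hij
      fin_cases i <;> fin_cases j <;> simp_all [disjoint_comm])
  have h2 : IndepFun (fun ω => N ω (J ×ˢ A)) (fun ω => N ω (J ×ˢ A')) P :=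
    hind.indepFun (i := 0) (j := 1) (by decide)
  have h3 : IndepFun (compensated m N J A) (compensated m N J A') P :=
    h2.comp (φ := fun x : ℝ≥0∞ => x.toReal - (volume J * m A).toReal)
      (ψ := fun x : ℝ≥0∞ => x.toReal - (volume J * m A').toReal)
      (ENNReal.measurable_toReal.sub_const _) (ENNReal.measurable_toReal.sub_const _)
  have := h3.integral_mul_eq_mul_integral (hN.measurable_compensated hJ hA).aestronglyMeasurable
    (hN.measurable_compensated hJ hA').aestronglyMeasurable
  rw [hN.integral_compensated hJ0 hJ hA hfin, zero_mul] at this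
  exact this

end IsPoissonNoise
end Noise

/-! ### The isometry for simple predictable functions -/

namespace SimplePredictable

variable {Ω E : Type*} [mΩ : MeasurableSpace Ω] [MeasurableSpace E] {P : Measure Ω}
  {ℱ : Filtration ℝ≥0 mΩ} {m : Measure E} {N : Ω → Measure (ℝ × E)}

/-- The part of the `i`-th time interval in `(a, b]`. -/
def slot (S : SimplePredictable ℱ m) (a b : ℝ) (i : Fin S.p) : Set ℝ :=
  Ioc (S.τ i.castSucc : ℝ) (S.τ i.succ) ∩ Ioc a b

lemma measurableSet_slot (S : SimplePredictable ℱ m) (a b : ℝ) (i : Fin S.p) :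
    MeasurableSet (S.slot a b i) := measurableSet_Ioc.inter measurableSet_Ioc

/-- The coefficient is known at the start of its interval and a test variable at time `a`. The noise
used must come after both, hence the maximum. -/
lemma slot_subset_Ioi (S : SimplePredictable ℱ m) (a : ℝ≥0) (b : ℝ) (i : Fin S.p) :
    S.slot a b i ⊆ Ioi ((max (S.τ i.castSucc) a : ℝ≥0) : ℝ) := by
  intro t ht
  rw [mem_Ioi, NNReal.coe_max]
  exact max_lt ht.1.1 ht.2.1

lemma slot_subset_Icc (S : SimplePredictable ℱ m) (a b : ℝ) (i : Fin S.p) :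
    S.slot a b i ⊆ Icc 0 ((S.τ i.succ : ℝ≥0) : ℝ) := fun _ ht =>
  ⟨(S.τ i.castSucc).2.trans ht.1.1.le, ht.1.2⟩

lemma slot_subset_Ici (S : SimplePredictable ℱ m) (a b : ℝ) (i : Fin S.p) :
    S.slot a b i ⊆ Ici 0 := fun _ ht => (S.slot_subset_Icc a b i ht).1

lemma volume_slot_mul_ne_top (S : SimplePredictable ℱ m) (a b : ℝ) (i : Fin S.p) (j : Fin S.q) :
    volume (S.slot a b i) * m (S.A j) ≠ ∞ :=
  ENNReal.mul_ne_top (ne_top_of_le_ne_top measure_Ioc_lt_top.ne (measure_mono inter_subset_right))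
    (S.A_finite j).ne

/-- The contribution of a rectangle to the stochastic integral. -/
noncomputable def term (S : SimplePredictable ℱ m) (N : Ω → Measure (ℝ × E)) (a b : ℝ)
    (k : Fin S.p × Fin S.q) (ω : Ω) : ℝ :=
  S.ξ k.1 k.2 ω * compensated m N (S.slot a b k.1) (S.A k.2) ω

lemma integral_eq_sum_term (S : SimplePredictable ℱ m) (a b : ℝ) (ω : Ω) :
    S.integral N a b ω = ∑ k, S.term N a b k ω := by
  rw [Fintype.sum_prod_type]
  rfl

lemma measurable_ξ (S : SimplePredictable ℱ m) (i : Fin S.p) (j : Fin S.q) :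
    Measurable (S.ξ i j) := (S.ξ_measurable i j).mono (ℱ.le _) le_rfl

lemma memLp_ξ (S : SimplePredictable ℱ m) (i : Fin S.p) (j : Fin S.q) : MemLp (S.ξ i j) ∞ P := by
  obtain ⟨M, hM⟩ := S.ξ_bounded i j
  exact memLp_top_of_bound (S.measurable_ξ i j).aestronglyMeasurable M
    (Eventually.of_forall fun ω => hM ω)

lemma measurable_term_of_lt (S : SimplePredictable ℱ m) (hN : IsPoissonNoise P ℱ m N)
    (a b : ℝ) (k : Fin S.p × Fin S.q) {t : ℝ≥0} (ht : S.τ k.1.succ ≤ t) :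
    Measurable[ℱ t] (S.term N a b k) := by
  have h1 : Measurable[ℱ t] (S.ξ k.1 k.2) := (S.ξ_measurable k.1 k.2).mono
    (ℱ.mono ((S.τ_strictMono k.1.castSucc_lt_succ).le.trans ht)) le_rfl
  exact h1.mul (hN.adapted_compensated ((S.slot_subset_Icc a b k.1).trans
    (Icc_subset_Icc_right (NNReal.coe_le_coe.2 ht))) (S.measurableSet_slot a b k.1)
    (S.A_measurable k.2))

lemma measurable_integral (S : SimplePredictable ℱ m) (hN : IsPoissonNoise P ℱ m N)
    (a : ℝ) (b : ℝ≥0) : Measurable[ℱ b] (S.integral N a b) := by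
  have : S.integral N a b = fun ω => ∑ k, S.term N a b k ω :=
    funext fun ω => S.integral_eq_sum_term a b ω
  rw [this]
  refine Finset.measurable_fun_sum (m := ℱ b) _ fun k _ => ?_
  -- The coefficient of an interval starting after `b` need not be known at `b`, but such an
  -- interval does not meet `(a, b]` and contributes zero.
  by_cases hk : S.τ k.1.castSucc ≤ b
  · have h1 : Measurable[ℱ b] (S.ξ k.1 k.2) := (S.ξ_measurable k.1 k.2).mono (ℱ.mono hk) le_rfl
    refine h1.mul (hN.adapted_compensated (fun t ht => ?_) (S.measurableSet_slot a b k.1)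
      (S.A_measurable k.2))
    exact ⟨S.slot_subset_Ici a b k.1 ht, ht.2.2⟩
  · have h0 : S.slot a b k.1 = ∅ := by
      refine eq_empty_of_forall_notMem fun t ht => hk ?_
      exact NNReal.coe_le_coe.1 (ht.1.1.le.trans ht.2.2)
    have : S.term N a b k = fun _ => 0 := by
      ext ω
      simp [term, compensated, h0]
    rw [this]
    exact measurable_const

lemma val_eq_sum (S : SimplePredictable ℱ m) (ω : Ω) (t : ℝ) (z : E) :
    S.val ω t z = ∑ k : Fin S.p × Fin S.q, S.ξ k.1 k.2 ω *
      (Ioc (S.τ k.1.castSucc : ℝ) (S.τ k.1.succ)).indicator 1 t * (S.A k.2).indicator 1 z := by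
  rw [Fintype.sum_prod_type]
  rfl

lemma measurable_val (S : SimplePredictable ℱ m) :
    Measurable fun q : Ω × ℝ × E => S.val q.1 q.2.1 q.2.2 := by
  simp_rw [S.val_eq_sum]
  refine Finset.measurable_fun_sum _ fun k _ => ?_
  refine (((S.measurable_ξ k.1 k.2).comp measurable_fst).mul ?_).mul ?_
  · exact (measurable_one.indicator measurableSet_Ioc).comp (measurable_fst.comp measurable_snd)
  · exact (measurable_one.indicator (S.A_measurable k.2)).comp (measurable_snd.comp measurable_snd)

/-- The rectangles are pairwise disjoint, so at most one summand is nonzero and no cross terms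
appear. -/
lemma enorm_val_sq (S : SimplePredictable ℱ m) (ω : Ω) (t : ℝ) (z : E) :
    ‖S.val ω t z‖ₑ ^ 2 = ∑ k : Fin S.p × Fin S.q, ENNReal.ofReal (S.ξ k.1 k.2 ω ^ 2) *
      ((Ioc (S.τ k.1.castSucc : ℝ) (S.τ k.1.succ)).indicator 1 t * (S.A k.2).indicator 1 z) := by
  rw [S.val_eq_sum]
  by_cases hex : ∃ k : Fin S.p × Fin S.q,
      t ∈ Ioc (S.τ k.1.castSucc : ℝ) (S.τ k.1.succ) ∧ z ∈ S.A k.2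
  · obtain ⟨k, hk1, hk2⟩ := hex
    have huniq : ∀ l : Fin S.p × Fin S.q, l ≠ k →
        t ∉ Ioc (S.τ l.1.castSucc : ℝ) (S.τ l.1.succ) ∨ z ∉ S.A l.2 := by
      intro l hl
      by_contra! hcon
      obtain ⟨hl1, hl2⟩ := hcon
      have e2 : l.2 = k.2 := by
        by_contra hne
        exact disjoint_left.1 (S.A_disjoint hne) hl2 hk2
      have e1 : l.1 = k.1 := by
        rcases lt_trichotomy l.1 k.1 with h | h | h
        · have := S.τ_strictMono.monotone (Fin.succ_le_castSucc_iff.2 h)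
          have := NNReal.coe_le_coe.2 this
          linarith [hl1.2, hk1.1]
        · exact h
        · have := S.τ_strictMono.monotone (Fin.succ_le_castSucc_iff.2 h)
          have := NNReal.coe_le_coe.2 this
          linarith [hl1.1, hk1.2]
      exact hl (Prod.ext e1 e2)
    rw [Finset.sum_eq_single k, Finset.sum_eq_single k]
    · simp only [indicator_of_mem hk1, indicator_of_mem hk2, Pi.one_apply, mul_one]
      rw [← enorm_pow, Real.enorm_of_nonneg (sq_nonneg _)]
    · intro l _ hl
      rcases huniq l hl with h | h <;> simp [indicator_of_notMem h]
    · exact fun h => absurd (Finset.mem_univ k) h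
    · intro l _ hl
      rcases huniq l hl with h | h <;> simp [indicator_of_notMem h]
    · exact fun h => absurd (Finset.mem_univ k) h
  · push Not at hex
    rw [Finset.sum_eq_zero, Finset.sum_eq_zero]
    · simp
    all_goals
      intro l _
      by_cases h : t ∈ Ioc (S.τ l.1.castSucc : ℝ) (S.τ l.1.succ)
      · simp [indicator_of_notMem (hex l h)]
      · simp [indicator_of_notMem h]

lemma lintegral_enorm_val_sq (S : SimplePredictable ℱ m) (a b : ℝ) :
    ∫⁻ ω, ∫⁻ t in Ioc a b, ∫⁻ z, ‖S.val ω t z‖ₑ ^ 2 ∂m ∂volume ∂P =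
      ∑ k : Fin S.p × Fin S.q, (∫⁻ ω, ENNReal.ofReal (S.ξ k.1 k.2 ω ^ 2) ∂P) *
        (volume (S.slot a b k.1) * m (S.A k.2)) := by
  have hA : ∀ k : Fin S.p × Fin S.q,
      Measurable ((S.A k.2).indicator (1 : E → ℝ≥0∞)) := fun k =>
    measurable_one.indicator (S.A_measurable k.2)
  have hI : ∀ k : Fin S.p × Fin S.q,
      Measurable ((Ioc (S.τ k.1.castSucc : ℝ) (S.τ k.1.succ)).indicator (1 : ℝ → ℝ≥0∞)) := fun k =>
    measurable_one.indicator measurableSet_Ioc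
  have hz : ∀ ω t, ∫⁻ z, ‖S.val ω t z‖ₑ ^ 2 ∂m = ∑ k : Fin S.p × Fin S.q,
      ENNReal.ofReal (S.ξ k.1 k.2 ω ^ 2) *
        ((Ioc (S.τ k.1.castSucc : ℝ) (S.τ k.1.succ)).indicator 1 t * m (S.A k.2)) := by
    intro ω t
    simp_rw [S.enorm_val_sq]
    rw [lintegral_finsetSum _ fun k _ => ((hA k).const_mul _).const_mul _]
    refine Finset.sum_congr rfl fun k _ => ?_
    rw [lintegral_const_mul _ ((hA k).const_mul _), lintegral_const_mul _ (hA k),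
      lintegral_indicator_one (S.A_measurable k.2)]
  have ht : ∀ ω, ∫⁻ t in Ioc a b, ∫⁻ z, ‖S.val ω t z‖ₑ ^ 2 ∂m ∂volume =
      ∑ k : Fin S.p × Fin S.q, ENNReal.ofReal (S.ξ k.1 k.2 ω ^ 2) *
        (volume (S.slot a b k.1) * m (S.A k.2)) := by
    intro ω
    simp_rw [hz]
    rw [lintegral_finsetSum _ fun k _ => ((hI k).mul_const _).const_mul _]
    refine Finset.sum_congr rfl fun k _ => ?_
    rw [lintegral_const_mul _ ((hI k).mul_const _), lintegral_mul_const _ (hI k),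
      lintegral_indicator_one measurableSet_Ioc, Measure.restrict_apply measurableSet_Ioc]
    rfl
  have hξ : ∀ k : Fin S.p × Fin S.q, Measurable fun ω => ENNReal.ofReal (S.ξ k.1 k.2 ω ^ 2) :=
    fun k => ((S.measurable_ξ k.1 k.2).pow_const 2).ennreal_ofReal
  simp_rw [ht]
  rw [lintegral_finsetSum _ fun k _ => (hξ k).mul_const _]
  exact Finset.sum_congr rfl fun k _ => lintegral_mul_const _ (hξ k)

variable [SigmaFinite m] [IsProbabilityMeasure P]

lemma memLp_term (S : SimplePredictable ℱ m) (hN : IsPoissonNoise P ℱ m N) (a b : ℝ)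
    (k : Fin S.p × Fin S.q) : MemLp (S.term N a b k) 2 P :=
  (hN.memLp_compensated (S.slot_subset_Ici a b k.1) (S.measurableSet_slot a b k.1)
    (S.A_measurable k.2) (S.volume_slot_mul_ne_top a b k.1 k.2)).mul (S.memLp_ξ k.1 k.2)

lemma memLp_integral (S : SimplePredictable ℱ m) (hN : IsPoissonNoise P ℱ m N) (a b : ℝ) :
    MemLp (S.integral N a b) 2 P := by
  have : S.integral N a b = fun ω => ∑ k, S.term N a b k ω :=
    funext fun ω => S.integral_eq_sum_term a b ω
  rw [this]
  exact memLp_finsetSum _ fun k _ => S.memLp_term hN a b k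

/-- `X` times the coefficient is known before the noise of this rectangle, whose compensated mass
has mean zero. -/
lemma integral_mul_term_eq_zero (S : SimplePredictable ℱ m) (hN : IsPoissonNoise P ℱ m N)
    (a : ℝ≥0) (b : ℝ) (k : Fin S.p × Fin S.q) {X : Ω → ℝ}
    (hX : Measurable[ℱ (max (S.τ k.1.castSucc) a)] X) :
    ∫ ω, X ω * S.term N a b k ω ∂P = 0 := by
  have hξ : Measurable[ℱ (max (S.τ k.1.castSucc) a)] (S.ξ k.1 k.2) :=
    (S.ξ_measurable k.1 k.2).mono (ℱ.mono (le_max_left _ _)) le_rfl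
  have h := hN.integral_mul_future (hX.mul hξ)
    (measurable_compensated_futureNoise (m := m) (S.slot_subset_Ioi a b k.1)
      (S.measurableSet_slot a b k.1) (S.A_measurable k.2))
  rw [hN.integral_compensated (S.slot_subset_Ici a b k.1) (S.measurableSet_slot a b k.1)
    (S.A_measurable k.2) (S.volume_slot_mul_ne_top a b k.1 k.2), mul_zero] at h
  rw [← h]
  congr 1
  ext ω
  simp only [term, Pi.mul_apply]
  ring

lemma integral_mul_integral_eq_zero (S : SimplePredictable ℱ m) (hN : IsPoissonNoise P ℱ m N)
    (a : ℝ≥0) (b : ℝ) {X : Ω → ℝ} (hX : Measurable[ℱ a] X) (hX2 : MemLp X 2 P) :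
    ∫ ω, X ω * S.integral N a b ω ∂P = 0 := by
  simp_rw [S.integral_eq_sum_term, Finset.mul_sum]
  rw [integral_finsetSum]
  · refine Finset.sum_eq_zero fun k _ => ?_
    exact S.integral_mul_term_eq_zero hN a b k (hX.mono (ℱ.mono (le_max_right _ _)) le_rfl)
  · exact fun k _ => hX2.integrable_mul (S.memLp_term hN a b k)

lemma integral_term_mul_of_lt (S : SimplePredictable ℱ m) (hN : IsPoissonNoise P ℱ m N)
    (a : ℝ≥0) (b : ℝ) (k l : Fin S.p × Fin S.q) (hkl : k.1 < l.1) :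
    ∫ ω, S.term N a b k ω * S.term N a b l ω ∂P = 0 := by
  refine S.integral_mul_term_eq_zero hN a b l (S.measurable_term_of_lt hN a b k ?_)
  exact (S.τ_strictMono.monotone (Fin.succ_le_castSucc_iff.2 hkl)).trans (le_max_left _ _)

/-- For different time intervals, the earlier term is known when the later one begins. For the same
interval, the mark sets are disjoint and the masses independent. -/
lemma integral_term_mul_of_ne (S : SimplePredictable ℱ m) (hN : IsPoissonNoise P ℱ m N)
    (a : ℝ≥0) (b : ℝ) (k l : Fin S.p × Fin S.q) (hkl : k ≠ l) :
    ∫ ω, S.term N a b k ω * S.term N a b l ω ∂P = 0 := by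
  rcases lt_trichotomy k.1 l.1 with h | h | h
  · exact S.integral_term_mul_of_lt hN a b k l h
  · obtain ⟨i, j⟩ := k
    obtain ⟨i', j'⟩ := l
    obtain rfl : i = i' := h
    have hjj' : j ≠ j' := fun h => hkl (by rw [h])
    have hξ : ∀ j, Measurable[ℱ (max (S.τ i.castSucc) a)] (S.ξ i j) := fun j =>
      (S.ξ_measurable i j).mono (ℱ.mono (le_max_left _ _)) le_rfl
    have hc : ∀ j, Measurable[futureNoise N (max (S.τ i.castSucc) a)]
        (compensated m N (S.slot a b i) (S.A j)) := fun j =>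
      measurable_compensated_futureNoise (m := m) (S.slot_subset_Ioi a b i)
        (S.measurableSet_slot a b i) (S.A_measurable j)
    have hgint := hN.integral_mul_future ((hξ j).mul (hξ j')) ((hc j).mul (hc j'))
    have h0 := hN.integral_compensated_mul (S.slot_subset_Ici a b i) (S.measurableSet_slot a b i)
      (S.A_measurable j) (S.A_measurable j') (S.volume_slot_mul_ne_top a b i j)
      (S.A_disjoint hjj')
    simp only [Pi.mul_apply] at hgint
    rw [h0, mul_zero] at hgint
    rw [← hgint]
    congr 1
    ext ω
    simp only [term]
    ring
  · rw [← S.integral_term_mul_of_lt hN a b l k h]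
    simp_rw [mul_comm]

lemma integral_term_sq (S : SimplePredictable ℱ m) (hN : IsPoissonNoise P ℱ m N)
    (a : ℝ≥0) (b : ℝ) (k : Fin S.p × Fin S.q) :
    ∫ ω, S.term N a b k ω * S.term N a b k ω ∂P =
      (∫ ω, S.ξ k.1 k.2 ω ^ 2 ∂P) * (volume (S.slot a b k.1) * m (S.A k.2)).toReal := by
  have hξ : Measurable[ℱ (max (S.τ k.1.castSucc) a)] (S.ξ k.1 k.2) :=
    (S.ξ_measurable k.1 k.2).mono (ℱ.mono (le_max_left _ _)) le_rfl
  have hc := measurable_compensated_futureNoise (m := m) (N := N) (S.slot_subset_Ioi a b k.1)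
        (S.measurableSet_slot a b k.1) (S.A_measurable k.2)
  have hgint := hN.integral_mul_future (hξ.pow_const 2) (hc.pow_const 2)
  rw [hN.integral_compensated_sq (S.slot_subset_Ici a b k.1) (S.measurableSet_slot a b k.1)
    (S.A_measurable k.2) (S.volume_slot_mul_ne_top a b k.1 k.2)] at hgint
  rw [← hgint]
  congr 1
  ext ω
  simp only [term]
  ring

lemma integral_integral_sq (S : SimplePredictable ℱ m) (hN : IsPoissonNoise P ℱ m N)
    (a : ℝ≥0) (b : ℝ) :
    ∫ ω, S.integral N a b ω ^ 2 ∂P = ∑ k : Fin S.p × Fin S.q,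
      (∫ ω, S.ξ k.1 k.2 ω ^ 2 ∂P) * (volume (S.slot a b k.1) * m (S.A k.2)).toReal := by
  have hgint : ∀ k l, Integrable (fun ω => S.term N a b k ω * S.term N a b l ω) P := fun k l =>
    (S.memLp_term hN a b k).integrable_mul (S.memLp_term hN a b l)
  simp_rw [S.integral_eq_sum_term, sq, Finset.sum_mul_sum]
  rw [integral_finsetSum _ fun k _ => integrable_finsetSum _ fun l _ => hgint k l]
  refine Finset.sum_congr rfl fun k _ => ?_
  rw [integral_finsetSum _ fun l _ => hgint k l, Finset.sum_eq_single k]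
  · simpa only [sq] using S.integral_term_sq hN a b k
  · exact fun l _ hl => S.integral_term_mul_of_ne hN a b k l hl.symm
  · exact fun h => absurd (Finset.mem_univ k) h

/-- The isometry for simple predictable functions. -/
lemma lintegral_enorm_integral_sq (S : SimplePredictable ℱ m) (hN : IsPoissonNoise P ℱ m N)
    (a : ℝ≥0) (b : ℝ) : ∫⁻ ω, ‖S.integral N a b ω‖ₑ ^ 2 ∂P =
      ∫⁻ ω, ∫⁻ t in Ioc (a : ℝ) b, ∫⁻ z, ‖S.val ω t z‖ₑ ^ 2 ∂m ∂volume ∂P := by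
  have h1 : ∀ ω, ‖S.integral N a b ω‖ₑ ^ 2 = ENNReal.ofReal (S.integral N a b ω ^ 2) := fun ω => by
    rw [← enorm_pow, Real.enorm_of_nonneg (sq_nonneg _)]
  have hξ2 : ∀ k : Fin S.p × Fin S.q, Integrable (fun ω => S.ξ k.1 k.2 ω ^ 2) P := fun k =>
    ((S.memLp_ξ (P := P) k.1 k.2).mono_exponent (p := 2) le_top).integrable_sq
  simp_rw [h1]
  rw [← ofReal_integral_eq_lintegral_ofReal (S.memLp_integral hN a b).integrable_sq
    (Eventually.of_forall fun ω => sq_nonneg _), S.integral_integral_sq hN,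
    S.lintegral_enorm_val_sq, ENNReal.ofReal_sum_of_nonneg]
  · refine Finset.sum_congr rfl fun k _ => ?_
    rw [ENNReal.ofReal_mul (integral_nonneg fun ω => sq_nonneg _),
      ofReal_integral_eq_lintegral_ofReal (hξ2 k) (Eventually.of_forall fun ω => sq_nonneg _),
      ENNReal.ofReal_toReal (S.volume_slot_mul_ne_top a b k.1 k.2)]
  · exact fun k _ => mul_nonneg (integral_nonneg fun ω => sq_nonneg _) ENNReal.toReal_nonneg

end SimplePredictable

/-! ### Properties of the stochastic integral -/

/-- The scheme holds almost surely and the integral is determined almost surely; completeness of the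
filtration makes adaptedness insensitive to this. -/
lemma UsualConditions.measurable_congr {Ω : Type*} [mΩ : MeasurableSpace Ω] {P : Measure Ω}
    {ℱ : Filtration ℝ≥0 mΩ} (hU : UsualConditions P ℱ) {t : ℝ≥0} {X Y : Ω → ℝ}
    (hX : Measurable[ℱ t] X) (hXY : Y =ᵐ[P] X) : Measurable[ℱ t] Y := by
  intro s hs
  have hnull : ∀ D : Set Ω, P D = 0 → MeasurableSet[ℱ t] D := fun D hD =>
    ℱ.mono (zero_le : (0 : ℝ≥0) ≤ t) D (hU.null D hD)
  have h0 : P {ω | Y ω ≠ X ω} = 0 := hXY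
  have : Y ⁻¹' s = (X ⁻¹' s \ {ω | Y ω ≠ X ω}) ∪ (Y ⁻¹' s ∩ {ω | Y ω ≠ X ω}) := by
    ext ω
    by_cases h : Y ω = X ω <;> simp [h]
  rw [this]
  exact ((hX hs).diff (hnull _ h0)).union (hnull _ (measure_mono_null inter_subset_right h0))

lemma lintegral_enorm_sq_eq_eLpNorm {Ω : Type*} [MeasurableSpace Ω] {μ : Measure Ω} (X : Ω → ℝ) :
    ∫⁻ ω, ‖X ω‖ₑ ^ 2 ∂μ = eLpNorm X 2 μ ^ 2 := by
  have := eLpNorm_nnreal_pow_eq_lintegral (μ := μ) (f := X) (p := 2) two_ne_zero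
  simpa using this.symm

lemma eLpNorm_two_eq {Ω : Type*} [MeasurableSpace Ω] {μ : Measure Ω} (X : Ω → ℝ) :
    eLpNorm X 2 μ = (∫⁻ ω, ‖X ω‖ₑ ^ 2 ∂μ) ^ (1 / 2 : ℝ) := by
  rw [lintegral_enorm_sq_eq_eLpNorm, ← ENNReal.rpow_natCast, ← ENNReal.rpow_mul]
  norm_num

lemma tendsto_rpow_half_zero {u : ℕ → ℝ≥0∞} (hu : Tendsto u atTop (𝓝 0)) :
    Tendsto (fun k => u k ^ (1 / 2 : ℝ)) atTop (𝓝 0) := by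
  have := (ENNReal.continuous_rpow_const (y := (1 / 2 : ℝ))).tendsto 0
  rw [ENNReal.zero_rpow_of_pos (by norm_num)] at this
  exact this.comp hu

lemma eLpNorm_two_uncurry {Ω E : Type*} [MeasurableSpace Ω] [MeasurableSpace E] {P : Measure Ω}
    [SFinite P] {m : Measure E} [SFinite m] {ψ : Ω → ℝ → E → ℝ} {J : Set ℝ}
    (hψ : Measurable fun q : Ω × ℝ × E => ψ q.1 q.2.1 q.2.2) :
    eLpNorm (fun q : Ω × ℝ × E => ψ q.1 q.2.1 q.2.2) 2 (P.prod ((volume.restrict J).prod m)) =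
      (∫⁻ ω, ∫⁻ t in J, ∫⁻ z, ‖ψ ω t z‖ₑ ^ 2 ∂m ∂volume ∂P) ^ (1 / 2 : ℝ) := by
  have hm : Measurable fun q : Ω × ℝ × E => ‖ψ q.1 q.2.1 q.2.2‖ₑ ^ 2 := hψ.enorm.pow_const 2
  rw [eLpNorm_two_eq, lintegral_prod _ hm.aemeasurable]
  congr 1
  refine lintegral_congr fun ω => ?_
  exact lintegral_prod (fun y : ℝ × E => ‖ψ ω y.1 y.2‖ₑ ^ 2)
    (hm.comp (measurable_prodMk_left (x := ω))).aemeasurable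

namespace IsStochasticIntegral

variable {Ω E : Type*} [mΩ : MeasurableSpace Ω] [MeasurableSpace E] {P : Measure Ω}
  {ℱ : Filtration ℝ≥0 mΩ} {m : Measure E} {N : Ω → Measure (ℝ × E)} {a : ℝ≥0} {b : ℝ}
  {φ : Ω → ℝ → E → ℝ} {I : Ω → ℝ}

lemma exists_eLpNorm_tendsto (hI : IsStochasticIntegral P ℱ m N a b φ I) :
    ∃ S : ℕ → SimplePredictable ℱ m,
      Tendsto (fun k => ∫⁻ ω, ∫⁻ t in Ioc (a : ℝ) b, ∫⁻ z,
        ‖(S k).val ω t z - φ ω t z‖ₑ ^ 2 ∂m ∂volume ∂P) atTop (𝓝 0) ∧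
      Tendsto (fun k => eLpNorm ((S k).integral N a b - I) 2 P) atTop (𝓝 0) := by
  obtain ⟨-, S, h1, h2⟩ := hI
  refine ⟨S, h1, ?_⟩
  simp_rw [eLpNorm_two_eq]
  exact tendsto_rpow_half_zero h2

variable [IsProbabilityMeasure P] [SigmaFinite m]

lemma memLp (hN : IsPoissonNoise P ℱ m N) (hI : IsStochasticIntegral P ℱ m N a b φ I) :
    MemLp I 2 P := by
  obtain ⟨S, -, h2⟩ := hI.exists_eLpNorm_tendsto
  obtain ⟨k, hk⟩ := (h2.eventually (gt_mem_nhds ENNReal.zero_lt_top)).exists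
  have h3 := (S k).memLp_integral hN a b
  have h4 : MemLp ((S k).integral N a b - I) 2 P :=
    ⟨h3.aestronglyMeasurable.sub hI.1, hk⟩
  simpa using h3.sub h4

/-- Orthogonality passes from simple integrands to the limit because, by Hölder, the products
converge in `L¹`. -/
lemma integral_mul_eq_zero (hN : IsPoissonNoise P ℱ m N)
    (hI : IsStochasticIntegral P ℱ m N a b φ I) {X : Ω → ℝ} (hX : Measurable[ℱ a] X)
    (hX2 : MemLp X 2 P) : ∫ ω, X ω * I ω ∂P = 0 := by
  obtain ⟨S, -, h2⟩ := hI.exists_eLpNorm_tendsto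
  have hgint : ∀ k, Integrable (fun ω => X ω * (S k).integral N a b ω) P := fun k =>
    hX2.integrable_mul ((S k).memLp_integral hN a b)
  have hlim : Tendsto (fun k => eLpNorm ((fun ω => X ω * (S k).integral N a b ω) -
      fun ω => X ω * I ω) 1 P) atTop (𝓝 0) := by
    refine tendsto_of_tendsto_of_tendsto_of_le_of_le (h := fun k =>
      eLpNorm X 2 P * eLpNorm ((S k).integral N a b - I) 2 P) tendsto_const_nhds ?_
      (fun _ => zero_le) fun k => ?_
    · have := ENNReal.Tendsto.const_mul h2 (Or.inr hX2.2.ne)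
      rwa [mul_zero] at this
    · have h3 := eLpNorm_smul_le_mul_eLpNorm (p := 2) (q := 2) (r := 1)
        (((S k).memLp_integral hN a b).aestronglyMeasurable.sub hI.1) hX2.aestronglyMeasurable
      refine le_trans (le_of_eq ?_) h3
      congr 1
      ext ω
      simp [mul_sub]
  have := tendsto_integral_of_L1' _
    (hX2.integrable_mul (hI.memLp hN)).aestronglyMeasurable (Eventually.of_forall hgint) hlim
  refine tendsto_nhds_unique this ?_
  simp_rw [fun k => (S k).integral_mul_integral_eq_zero hN a b hX hX2]
  exact tendsto_const_nhds

/-- A subsequence of the simple integrals converges almost surely, and the null set where it fails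
belongs to `ℱ b`. -/
lemma measurable {b : ℝ≥0} (hU : UsualConditions P ℱ) (hN : IsPoissonNoise P ℱ m N)
    (hI : IsStochasticIntegral P ℱ m N a b φ I) : Measurable[ℱ b] I := by
  obtain ⟨S, -, h2⟩ := hI.exists_eLpNorm_tendsto
  have hmeas := tendstoInMeasure_of_tendsto_eLpNorm two_ne_zero
    (fun k => ((S k).memLp_integral hN a b).aestronglyMeasurable) hI.1 h2
  obtain ⟨ns, -, hns⟩ := hmeas.exists_seq_tendsto_ae
  set D := {ω | ¬ Tendsto (fun i => (S (ns i)).integral N a b ω) atTop (𝓝 (I ω))} with hD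
  have hD0 : P D = 0 := hns
  have hDm : MeasurableSet[ℱ b] D := ℱ.mono (zero_le : (0 : ℝ≥0) ≤ b) D (hU.null D hD0)
  have hlim : Measurable[ℱ b] (Dᶜ.indicator I) := by
    refine @measurable_of_tendsto_metrizable Ω ℝ (ℱ b) _ _ _ _
      (fun i => Dᶜ.indicator ((S (ns i)).integral N a b)) _ (fun i => ?_) ?_
    · exact ((S (ns i)).measurable_integral hN a b).indicator hDm.compl
    · rw [tendsto_pi_nhds]
      intro ω
      by_cases hω : ω ∈ D
      · simp [hω]
      · have : ω ∈ Dᶜ := hω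
        simp only [indicator_of_mem this]
        exact not_not.1 hω
  refine hU.measurable_congr hlim ?_
  filter_upwards [measure_eq_zero_iff_ae_notMem.1 hD0] with ω hω
  rw [indicator_of_mem (show ω ∈ Dᶜ from hω)]

/-- Only one direction of the isometry is needed. It follows from the triangle inequality in `L²(Ω)`
and on the product space, with the isometry for simple functions in between. -/
lemma lintegral_enorm_sq_le (hN : IsPoissonNoise P ℱ m N)
    (hI : IsStochasticIntegral P ℱ m N a b φ I)
    (hφ : Measurable fun q : Ω × ℝ × E => φ q.1 q.2.1 q.2.2) :
    ∫⁻ ω, ‖I ω‖ₑ ^ 2 ∂P ≤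
      ∫⁻ ω, ∫⁻ t in Ioc (a : ℝ) b, ∫⁻ z, ‖φ ω t z‖ₑ ^ 2 ∂m ∂volume ∂P := by
  obtain ⟨S, h1, h2⟩ := hI.exists_eLpNorm_tendsto
  have h1' := tendsto_rpow_half_zero h1
  have key : ∀ k, eLpNorm I 2 P ≤
      (∫⁻ ω, ∫⁻ t in Ioc (a : ℝ) b, ∫⁻ z, ‖φ ω t z‖ₑ ^ 2 ∂m ∂volume ∂P) ^ (1 / 2 : ℝ) +
      (∫⁻ ω, ∫⁻ t in Ioc (a : ℝ) b, ∫⁻ z, ‖(S k).val ω t z - φ ω t z‖ₑ ^ 2 ∂m ∂volume ∂P) ^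
        (1 / 2 : ℝ) + eLpNorm ((S k).integral N a b - I) 2 P := by
    intro k
    have hS := (S k).memLp_integral hN a b
    have e1 : eLpNorm I 2 P ≤
        eLpNorm ((S k).integral N a b) 2 P + eLpNorm ((S k).integral N a b - I) 2 P := by
      have := eLpNorm_sub_le (p := 2) hS.aestronglyMeasurable
        (hS.aestronglyMeasurable.sub hI.1) one_le_two
      simpa using this
    refine e1.trans (add_le_add_left ?_ _)
    rw [eLpNorm_two_eq, (S k).lintegral_enorm_integral_sq hN,
      ← eLpNorm_two_uncurry (S k).measurable_val, ← eLpNorm_two_uncurry hφ,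
      ← eLpNorm_two_uncurry (ψ := fun ω t z => (S k).val ω t z - φ ω t z)
        ((S k).measurable_val.sub hφ)]
    have := eLpNorm_add_le (p := 2) (μ := P.prod ((volume.restrict (Ioc (a : ℝ) b)).prod m))
      hφ.aestronglyMeasurable ((S k).measurable_val.sub hφ).aestronglyMeasurable one_le_two
    refine le_trans (le_of_eq ?_) this
    congr 1
    ext q
    simp
  have hlim := (tendsto_const_nhds (x := (∫⁻ ω, ∫⁻ t in Ioc (a : ℝ) b, ∫⁻ z,
    ‖φ ω t z‖ₑ ^ 2 ∂m ∂volume ∂P) ^ (1 / 2 : ℝ))).add h1' |>.add h2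
  rw [add_zero, add_zero] at hlim
  have := ge_of_tendsto' hlim key
  rw [eLpNorm_two_eq] at this
  exact (ENNReal.rpow_le_rpow_iff (by norm_num)).1 this

end IsStochasticIntegral

/-! ### The entropy associated with the flux function -/

/-- The entropy flux `∫₀ˣ s f'(s) ds` of the quadratic entropy. -/
noncomputable def entropyFlux (f : ℝ → ℝ) (x : ℝ) : ℝ := x * f x - ∫ s in (0 : ℝ)..x, f s

namespace FluxAssumption

variable {f : ℝ → ℝ} {cf : ℝ≥0}

lemma continuous (hf : FluxAssumption f cf) : Continuous f := hf.lipschitz.continuous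

lemma continuous_entropyFlux (hf : FluxAssumption f cf) : Continuous (entropyFlux f) := by
  refine (continuous_id.mul hf.continuous).sub ?_
  exact intervalIntegral.continuous_primitive (fun a b => hf.continuous.intervalIntegrable a b) 0

lemma abs_le (hf : FluxAssumption f cf) (x : ℝ) : |f x| ≤ cf * |x| := by
  have := hf.lipschitz.dist_le_mul x 0
  simpa [hf.map_zero, Real.dist_eq] using this

lemma abs_entropyFlux_le (hf : FluxAssumption f cf) (x : ℝ) :
    |entropyFlux f x| ≤ 2 * cf * x ^ 2 := by
  have h1 : |∫ s in (0 : ℝ)..x, f s| ≤ cf * |x| * |x - 0| := by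
    rw [← Real.norm_eq_abs]
    refine intervalIntegral.norm_integral_le_of_norm_le_const fun s hs => ?_
    refine (hf.abs_le s).trans (mul_le_mul_of_nonneg_left ?_ cf.2)
    rcases le_total 0 x with hx | hx
    · rw [uIoc_of_le hx] at hs
      rw [abs_of_pos hs.1, abs_of_nonneg hx]; exact hs.2
    · rw [uIoc_of_ge hx] at hs
      rw [abs_of_nonpos hs.2, abs_of_nonpos hx]; linarith [hs.1]
  have h2 : |x * f x| ≤ cf * |x| * |x| := by
    rw [abs_mul, mul_comm]
    exact mul_le_mul_of_nonneg_right (hf.abs_le x) (abs_nonneg x)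
  rw [sub_zero] at h1
  calc |entropyFlux f x| ≤ |x * f x| + |∫ s in (0 : ℝ)..x, f s| := abs_sub _ _
    _ ≤ cf * |x| * |x| + cf * |x| * |x| := add_le_add h2 h1
    _ = 2 * cf * x ^ 2 := by rw [← sq_abs x]; ring

/-- As a function of `b`, the difference of the two sides vanishes at `a` and has derivative `2 (f b
- f a) (cf - f' b)`, which has the sign of `b - a` because `f` is nondecreasing and `f' ≤ cf`. -/
lemma sq_sub_le (hf : FluxAssumption f cf) (a b : ℝ) :
    (f b - f a) ^ 2 ≤ 2 * cf * ((∫ s in a..b, f s) - (b - a) * f a) := by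
  let G : ℝ → ℝ := fun x => 2 * cf * ((∫ s in a..x, f s) - (x - a) * f a) - (f x - f a) ^ 2
  have hdf : ∀ x, HasDerivAt f (deriv f x) x := fun x =>
    (hf.contDiff.differentiable two_ne_zero x).hasDerivAt
  have hG : ∀ x, HasDerivAt G (2 * (f x - f a) * (cf - deriv f x)) x := by
    intro x
    have h1 : HasDerivAt (fun x => ∫ s in a..x, f s) (f x) x :=
      intervalIntegral.integral_hasDerivAt_right (hf.continuous.intervalIntegrable a x)
        (hf.continuous.stronglyMeasurableAtFilter _ _) hf.continuous.continuousAt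
    have h2 := ((h1.sub (((hasDerivAt_id x).sub_const a).mul_const (f a))).const_mul
      (2 * (cf : ℝ))).sub (((hdf x).sub_const (f a)).pow 2)
    refine h2.congr_deriv ?_
    simp
    ring
  have hder : ∀ x, deriv f x ≤ cf := fun x =>
    (le_abs_self _).trans (norm_deriv_le_of_lipschitz hf.lipschitz)
  have hcont : Continuous G := continuous_iff_continuousAt.2 fun x => (hG x).continuousAt
  have hGa : G a = 0 := by simp [G]
  have hGb : 0 ≤ G b := by
    rw [← hGa]
    rcases le_total a b with hab | hab
    · refine monotoneOn_of_deriv_nonneg (convex_Ici a) hcont.continuousOn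
        (fun x _ => (hG x).differentiableAt.differentiableWithinAt) (fun x hx => ?_)
        (mem_Ici.2 le_rfl) (mem_Ici.2 hab) hab
      rw [interior_Ici] at hx
      rw [(hG x).deriv]
      have := hf.monotone (le_of_lt hx)
      exact mul_nonneg (by linarith) (sub_nonneg.2 (hder x))
    · refine antitoneOn_of_deriv_nonpos (convex_Iic a) hcont.continuousOn
        (fun x _ => (hG x).differentiableAt.differentiableWithinAt) (fun x hx => ?_)
        (mem_Iic.2 hab) (mem_Iic.2 le_rfl) hab
      rw [interior_Iic] at hx
      rw [(hG x).deriv]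
      have := hf.monotone (le_of_lt hx)
      exact mul_nonpos_of_nonpos_of_nonneg (by linarith) (sub_nonneg.2 (hder x))
  have : G b = 2 * cf * ((∫ s in a..b, f s) - (b - a) * f a) - (f b - f a) ^ 2 := rfl
  linarith

/-- The difference of entropy fluxes equals `x (f x - f y)` minus the quantity `∫ s in y..x, f s -
(x - y) f y` that `sq_sub_le` bounds from below. -/
lemma entropy_inequality (hf : FluxAssumption f cf) (x y : ℝ) :
    (f y - f x) ^ 2 + 2 * cf * (entropyFlux f x - entropyFlux f y) ≤
      2 * cf * (x * (f x - f y)) := by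
  have h1 := hf.sq_sub_le y x
  have h2 : (∫ s in y..x, f s) = (∫ s in (0 : ℝ)..x, f s) - ∫ s in (0 : ℝ)..y, f s :=
    (intervalIntegral.integral_interval_sub_left (hf.continuous.intervalIntegrable _ _)
      (hf.continuous.intervalIntegrable _ _)).symm
  have h3 : entropyFlux f x - entropyFlux f y = x * (f x - f y) - ((∫ s in y..x, f s) -
      (x - y) * f y) := by
    rw [h2, entropyFlux, entropyFlux]; ring
  rw [h3]
  nlinarith [h1]

/-- The energy inequality for one explicit upwind step under a CFL condition. -/
lemma upwind_energy (hf : FluxAssumption f cf) {ι : Type*} (s : Finset ι) {w : ι → ℝ}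
    (hw : ∀ i ∈ s, 0 ≤ w i) {κ ξ : ℝ} (hκ : 0 ≤ κ) (hCFL : cf * (κ * ∑ i ∈ s, w i) ≤ 1 - ξ)
    (x : ℝ) (y : ι → ℝ) :
    cf * (x + κ * ∑ i ∈ s, w i * (f (y i) - f x)) ^ 2 ≤
      cf * x ^ 2 - 2 * cf * κ * ∑ i ∈ s, w i * (entropyFlux f x - entropyFlux f (y i)) -
        κ * ξ * ∑ i ∈ s, w i * (f (y i) - f x) ^ 2 := by
  have hCS : (∑ i ∈ s, w i * (f (y i) - f x)) ^ 2 ≤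
      (∑ i ∈ s, w i) * ∑ i ∈ s, w i * (f (y i) - f x) ^ 2 := by
    refine Finset.sum_sq_le_sum_mul_sum_of_sq_le_mul s hw
      (fun i hi => mul_nonneg (hw i hi) (sq_nonneg _)) fun i _ => le_of_eq (by ring)
  have hS : 0 ≤ ∑ i ∈ s, w i * (f (y i) - f x) ^ 2 :=
    Finset.sum_nonneg fun i hi => mul_nonneg (hw i hi) (sq_nonneg _)
  have hent : ∑ i ∈ s, w i * (f (y i) - f x) ^ 2 +
      2 * cf * ∑ i ∈ s, w i * (entropyFlux f x - entropyFlux f (y i)) ≤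
      -(2 * cf * (x * ∑ i ∈ s, w i * (f (y i) - f x))) := by
    rw [Finset.mul_sum, Finset.mul_sum, Finset.mul_sum, ← Finset.sum_add_distrib,
      ← Finset.sum_neg_distrib]
    refine Finset.sum_le_sum fun i hi => ?_
    have := mul_le_mul_of_nonneg_left (hf.entropy_inequality x (y i)) (hw i hi)
    linarith
  set A := ∑ i ∈ s, w i * (f (y i) - f x) with hA
  set B := ∑ i ∈ s, w i * (f (y i) - f x) ^ 2 with hB
  set C := ∑ i ∈ s, w i * (entropyFlux f x - entropyFlux f (y i)) with hC
  set W := ∑ i ∈ s, w i with hW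
  -- The quadratic term of the explicit step uses up a share `1 - ξ` of the dissipation `κ B`; this
  -- is where the CFL condition enters.
  have h1 : cf * κ ^ 2 * A ^ 2 ≤ κ * (1 - ξ) * B := by
    calc cf * κ ^ 2 * A ^ 2 ≤ cf * κ ^ 2 * (W * B) := by gcongr
      _ = κ * (cf * (κ * W)) * B := by ring
      _ ≤ κ * (1 - ξ) * B := by gcongr
  have h2 := mul_le_mul_of_nonneg_left hent hκ
  nlinarith [h1, h2]

end FluxAssumption

/-! ### Summation over the mesh -/

lemma summable_row_mul {ι : Type*} {w : ι → ι → ℝ} {W p : ι → ℝ} {M : ℝ} (hw : ∀ i j, 0 ≤ w i j)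
    (hrow : ∀ i, HasSum (fun j => w i j) (W i)) (hW : ∀ i, W i ≤ M) (hp : Summable p) :
    Summable (fun q : ι × ι => w q.1 q.2 * p q.1) ∧
      ∑' q : ι × ι, w q.1 q.2 * p q.1 = ∑' i, W i * p i := by
  have hrow' : ∀ (p : ι → ℝ) i, HasSum (fun j => w i j * p i) (W i * p i) := fun p i =>
    (hrow i).mul_right (p i)
  have hWp : Summable fun i => W i * |p i| :=
    Summable.of_nonneg_of_le
      (fun i => mul_nonneg ((hrow i).nonneg (hw i)) (abs_nonneg _))
      (fun i => mul_le_mul_of_nonneg_right (hW i) (abs_nonneg _)) (hp.abs.mul_left M)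
  have hs : Summable fun q : ι × ι => w q.1 q.2 * p q.1 := by
    have habs : Summable fun q : ι × ι => w q.1 q.2 * |p q.1| := by
      refine (summable_prod_of_nonneg fun q => mul_nonneg (hw _ _) (abs_nonneg _)).2
        ⟨fun i => (hrow' (fun i => |p i|) i).summable, ?_⟩
      exact hWp.congr fun i => ((hrow' (fun i => |p i|) i).tsum_eq).symm
    refine Summable.of_abs (habs.congr fun q => ?_)
    rw [abs_mul, abs_of_nonneg (hw _ _)]
  refine ⟨hs, ?_⟩
  rw [hs.tsum_prod]
  exact tsum_congr fun i => (hrow' p i).tsum_eq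

/-- Summation by parts for a conservative exchange `w`. -/
lemma hasSum_exchange {ι : Type*} {w : ι → ι → ℝ} {W p : ι → ℝ} {M : ℝ} (hw : ∀ i j, 0 ≤ w i j)
    (hrow : ∀ i, HasSum (fun j => w i j) (W i)) (hcol : ∀ j, HasSum (fun i => w i j) (W j))
    (hW : ∀ i, W i ≤ M) (hp : Summable p) :
    HasSum (fun i => ∑' j, w i j * (p i - p j)) 0 := by
  obtain ⟨hs1, ht1⟩ := summable_row_mul hw hrow hW hp
  -- Since the column sums are also `W`, both double sums, with weight `p i` and with weight `p j`,
  -- equal `∑ W i * p i` and cancel.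
  obtain ⟨hs2, ht2⟩ := summable_row_mul (w := fun i j => w j i) (fun i j => hw j i) hcol hW hp
  have hs3 : Summable fun q : ι × ι => w q.1 q.2 * p q.2 :=
    ((Equiv.prodComm ι ι).summable_iff).1 hs2
  have ht3 : ∑' q : ι × ι, w q.1 q.2 * p q.2 = ∑' i, W i * p i := by
    rw [← ht2, ← (Equiv.prodComm ι ι).tsum_eq]
    rfl
  have hs := hs1.hasSum.sub hs3.hasSum
  rw [ht1, ht3, sub_self] at hs
  refine hs.prod_fiberwise fun i => ?_
  have := (hs1.sub hs3).prod_factor i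
  simp only [← mul_sub] at this ⊢
  exact this.hasSum

/-! ### The noise coefficient -/

namespace NoiseAssumption

variable {Ω E : Type*} [mΩ : MeasurableSpace Ω] [MeasurableSpace E] {m : Measure E} {η : ℝ → E → ℝ}
  {cη : ℝ}

lemma nonneg (hη : NoiseAssumption m η cη) : 0 ≤ cη := by
  obtain ⟨-, -, h₁, -, -, -, -, -, rfl, -, -⟩ := hη.bounds
  exact integral_nonneg fun z => sq_nonneg _

/-- A Carathéodory argument: `η` is continuous in the state and measurable in the mark, hence
jointly measurable. -/
lemma measurable_comp (hη : NoiseAssumption m η cη) {X : Ω → ℝ} (hX : Measurable X) :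
    Measurable fun q : Ω × ℝ × E => η (X q.1) q.2.2 := by
  obtain ⟨lam, -, h₁, hlam, -, -, -, h01, -, hlip, -⟩ := hη.bounds
  have hc : ∀ z, Continuous fun x => η x z := fun z => by
    refine (LipschitzWith.of_dist_le_mul (K := (lam * h₁ z).toNNReal) fun x y => ?_).continuous
    rw [Real.dist_eq, Real.dist_eq, Real.coe_toNNReal _ (mul_nonneg hlam.le (h01 z).1)]
    linarith [hlip x y z]
  have h := measurable_uncurry_of_continuous_of_measurable (u := η) hc hη.measurable
  exact h.comp ((hX.comp measurable_fst).prodMk (measurable_snd.comp measurable_snd))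

/-- Comparison with the state `0`, where `η` vanishes, and `lam < 1` give `|η x z| ≤ |x| h₁ z`. The
isometry bound then produces `cη`. -/
lemma integral_sq_le [SigmaFinite m] {P : Measure Ω} [IsProbabilityMeasure P]
    {ℱ : Filtration ℝ≥0 mΩ} {N : Ω → Measure (ℝ × E)} (hη : NoiseAssumption m η cη)
    (hN : IsPoissonNoise P ℱ m N) {a : ℝ≥0} {b : ℝ} (hab : a ≤ b) {X I : Ω → ℝ}
    (hXm : Measurable X) (hX : MemLp X 2 P)
    (hI : IsStochasticIntegral P ℱ m N a b (fun ω _ z => η (X ω) z) I) :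
    ∫ ω, I ω ^ 2 ∂P ≤ (b - a) * cη * ∫ ω, X ω ^ 2 ∂P := by
  have hcη := hη.nonneg
  have hle := hI.lintegral_enorm_sq_le hN (hη.measurable_comp hXm)
  obtain ⟨lam, -, h₁, hlam, hlam1, -, hh₁, h01, rfl, hlip, -⟩ := hη.bounds
  have hpt : ∀ x z, ‖η x z‖ₑ ^ 2 ≤ ENNReal.ofReal (x ^ 2) * ENNReal.ofReal (h₁ z ^ 2) := by
    intro x z
    rw [← enorm_pow, Real.enorm_of_nonneg (sq_nonneg _), ← ENNReal.ofReal_mul (sq_nonneg x)]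
    refine ENNReal.ofReal_le_ofReal ?_
    have h1 := hlip x 0 z
    rw [hη.map_zero, sub_zero, sub_zero] at h1
    have h2 : |η x z| ≤ |x| * h₁ z := h1.trans
      (mul_le_mul_of_nonneg_right (mul_le_of_le_one_left (abs_nonneg x) hlam1.le) (h01 z).1)
    calc η x z ^ 2 = |η x z| ^ 2 := (sq_abs _).symm
      _ ≤ (|x| * h₁ z) ^ 2 := by gcongr
      _ = x ^ 2 * h₁ z ^ 2 := by rw [mul_pow, sq_abs]
  have hz : ∀ x, ∫⁻ z, ‖η x z‖ₑ ^ 2 ∂m ≤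
      ENNReal.ofReal (x ^ 2) * ENNReal.ofReal (∫ z, h₁ z ^ 2 ∂m) := by
    intro x
    refine (lintegral_mono (hpt x)).trans ?_
    rw [lintegral_const_mul' _ _ ENNReal.ofReal_ne_top,
      ofReal_integral_eq_lintegral_ofReal hh₁.integrable_sq (Eventually.of_forall fun z => sq_nonneg _)]
  have htot : ∫⁻ ω, ∫⁻ t in Ioc (a : ℝ) b, ∫⁻ z, ‖η (X ω) z‖ₑ ^ 2 ∂m ∂volume ∂P ≤
      ENNReal.ofReal ((b - a) * (∫ z, h₁ z ^ 2 ∂m) * ∫ ω, X ω ^ 2 ∂P) := by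
    calc _ ≤ ∫⁻ ω, ENNReal.ofReal (X ω ^ 2) * (ENNReal.ofReal (∫ z, h₁ z ^ 2 ∂m) *
          ENNReal.ofReal (b - a)) ∂P := by
          refine lintegral_mono fun ω => ?_
          rw [lintegral_const, Measure.restrict_apply_univ, Real.volume_Ioc, ← mul_assoc]
          exact mul_le_mul_left (hz (X ω)) _
      _ = _ := by
          rw [lintegral_mul_const' _ _ (ENNReal.mul_ne_top ENNReal.ofReal_ne_top
            ENNReal.ofReal_ne_top), ← ofReal_integral_eq_lintegral_ofReal hX.integrable_sq
            (Eventually.of_forall fun ω => sq_nonneg _), ← ENNReal.ofReal_mul hcη,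
            ← ENNReal.ofReal_mul (integral_nonneg fun ω => sq_nonneg _)]
          congr 1
          ring
  have hIe : ∫⁻ ω, ‖I ω‖ₑ ^ 2 ∂P = ENNReal.ofReal (∫ ω, I ω ^ 2 ∂P) := by
    rw [ofReal_integral_eq_lintegral_ofReal (hI.memLp hN).integrable_sq
      (Eventually.of_forall fun ω => sq_nonneg _)]
    refine lintegral_congr fun ω => ?_
    rw [← enorm_pow, Real.enorm_of_nonneg (sq_nonneg _)]
  rw [hIe] at hle
  refine (ENNReal.ofReal_le_ofReal_iff ?_).1 (hle.trans htot)
  exact mul_nonneg (mul_nonneg (sub_nonneg.2 hab) hcη) (integral_nonneg fun ω => sq_nonneg _)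

end NoiseAssumption

/-! ### The scheme -/

/-- The assumptions on the data, the mesh and the discrete unknowns. -/
structure IsSchemeSetting {d : ℕ} {Ω E : Type*} [mΩ : MeasurableSpace Ω] [MeasurableSpace E]
    (P : Measure Ω) (ℱ : Filtration ℝ≥0 mΩ) (m : Measure E) (N : Ω → Measure (ℝ × E))
    (f : ℝ → ℝ) (v : ℝ → Rd d → Rd d) (η : ℝ → E → ℝ)
    (u₀ : Ω → Lp ℝ 2 (volume : Measure (Rd d))) (𝒯 : Set (Set (Rd d))) (Δt : ℝ) (Nt : ℕ)
    (u : ℕ → Set (Rd d) → Ω → ℝ) (T V α h ξ : ℝ) (cf : ℝ≥0) (cη : ℝ) : Prop where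
  dim_pos : 0 < d
  T_pos : 0 < T
  init_finite : ∫⁻ ω, ‖u₀ ω‖ₑ ^ 2 ∂P < ∞
  usual : UsualConditions P ℱ
  init_measurable : StronglyMeasurable[ℱ 0] u₀
  noise : IsPoissonNoise P ℱ m N
  flux : FluxAssumption f cf
  velocity : VelocityAssumption v T V
  coeff : NoiseAssumption m η cη
  mesh : IsAdmissibleMesh 𝒯 α h
  Nt_pos : 0 < Nt
  step_eq : Δt = T / Nt
  cfl : Δt * (cf * V) ≤ (1 - ξ) * α ^ 2 * h
  solution : IsUpwindSolution P ℱ m N f v η u₀ 𝒯 Δt Nt u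

/-- The amount that flows into `K` through `K|L` in the `n`-th time step. -/
noncomputable def inflow {d : ℕ} (𝒯 : Set (Set (Rd d))) (v : ℝ → Rd d → Rd d) (Δt : ℝ) (n : ℕ)
    (K L : Set (Rd d)) : ℝ :=
  max (-(meshFlux 𝒯 v (n * Δt) ((n + 1) * Δt) K L)) 0

lemma inflow_nonneg {d : ℕ} (𝒯 : Set (Set (Rd d))) (v : ℝ → Rd d → Rd d) (Δt : ℝ) (n : ℕ)
    (K L : Set (Rd d)) : 0 ≤ inflow 𝒯 v Δt n K L := le_max_right _ _

lemma meshFlux_of_notMem {d : ℕ} {𝒯 : Set (Set (Rd d))} {v : ℝ → Rd d → Rd d} {a b : ℝ}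
    {K L : Set (Rd d)} (h : L ∉ neighbors 𝒯 K) : meshFlux 𝒯 v a b K L = 0 := if_neg h

lemma inflow_of_notMem {d : ℕ} {𝒯 : Set (Set (Rd d))} {v : ℝ → Rd d → Rd d} {Δt : ℝ} {n : ℕ}
    {K L : Set (Rd d)} (h : L ∉ neighbors 𝒯 K) : inflow 𝒯 v Δt n K L = 0 := by
  rw [inflow, meshFlux_of_notMem h]; simp

namespace IsSchemeSetting

variable {d : ℕ} {Ω E : Type*} [mΩ : MeasurableSpace Ω] [MeasurableSpace E]
  {P : Measure Ω} {ℱ : Filtration ℝ≥0 mΩ} {m : Measure E} {N : Ω → Measure (ℝ × E)}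
  {f : ℝ → ℝ} {v : ℝ → Rd d → Rd d} {η : ℝ → E → ℝ}
  {u₀ : Ω → Lp ℝ 2 (volume : Measure (Rd d))} {𝒯 : Set (Set (Rd d))} {Δt : ℝ} {Nt : ℕ}
  {u : ℕ → Set (Rd d) → Ω → ℝ} {T V α h ξ : ℝ} {cf : ℝ≥0} {cη : ℝ} {n : ℕ} {K L : Set (Rd d)}

lemma step_pos (hS : IsSchemeSetting P ℱ m N f v η u₀ 𝒯 Δt Nt u T V α h ξ cf cη) : 0 < Δt := by
  rw [hS.step_eq]
  exact div_pos hS.T_pos (Nat.cast_pos.2 hS.Nt_pos)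

lemma Nt_mul (hS : IsSchemeSetting P ℱ m N f v η u₀ 𝒯 Δt Nt u T V α h ξ cf cη) : Nt * Δt = T := by
  rw [hS.step_eq]
  have : (Nt : ℝ) ≠ 0 := Nat.cast_ne_zero.2 hS.Nt_pos.ne'
  field_simp

lemma time_lt (hS : IsSchemeSetting P ℱ m N f v η u₀ 𝒯 Δt Nt u T V α h ξ cf cη) :
    (n : ℝ) * Δt < (n + 1) * Δt := by
  have := hS.step_pos
  linarith

lemma time_nonneg (hS : IsSchemeSetting P ℱ m N f v η u₀ 𝒯 Δt Nt u T V α h ξ cf cη) :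
    0 ≤ (n : ℝ) * Δt := mul_nonneg (Nat.cast_nonneg n) hS.step_pos.le

lemma time_le (hS : IsSchemeSetting P ℱ m N f v η u₀ 𝒯 Δt Nt u T V α h ξ cf cη) (hn : n < Nt) :
    ((n : ℝ) + 1) * Δt ≤ T := by
  rw [← hS.Nt_mul]
  refine mul_le_mul_of_nonneg_right ?_ hS.step_pos.le
  exact_mod_cast hn

/-- The finite set of neighbours of a control volume. -/
noncomputable def nb (hS : IsSchemeSetting P ℱ m N f v η u₀ 𝒯 Δt Nt u T V α h ξ cf cη)
    (hK : K ∈ 𝒯) : Finset (Set (Rd d)) :=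
  (hS.mesh.finite_neighbors hS.dim_pos hK).toFinset

lemma mem_nb (hS : IsSchemeSetting P ℱ m N f v η u₀ 𝒯 Δt Nt u T V α h ξ cf cη) (hK : K ∈ 𝒯) :
    L ∈ hS.nb hK ↔ L ∈ neighbors 𝒯 K := Finite.mem_toFinset _

lemma hasSum_neighbors (hS : IsSchemeSetting P ℱ m N f v η u₀ 𝒯 Δt Nt u T V α h ξ cf cη)
    (hK : K ∈ 𝒯) {g : Set (Rd d) → ℝ} (hg : ∀ L, L ∉ neighbors 𝒯 K → g L = 0) :
    HasSum (fun L : 𝒯 => g L) (∑ L ∈ hS.nb hK, g L) := by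
  refine (hasSum_subtype_iff_of_support_subset (s := 𝒯) fun L hL => ?_).2
    (hasSum_sum_of_ne_finset_zero fun L hL => hg L fun h => hL ((hS.mem_nb hK).2 h))
  by_contra hcon
  exact hL (hg L fun h => hcon h.1)

lemma sum_meshFlux (hS : IsSchemeSetting P ℱ m N f v η u₀ 𝒯 Δt Nt u T V α h ξ cf cη)
    (hK : K ∈ 𝒯) (hn : n < Nt) :
    ∑ L ∈ hS.nb hK, meshFlux 𝒯 v (n * Δt) ((n + 1) * Δt) K L = 0 :=
  hS.mesh.sum_meshFlux hS.dim_pos hS.velocity hS.time_nonneg hS.time_lt.le (hS.time_le hn) hK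

lemma inflow_sub_inflow (hS : IsSchemeSetting P ℱ m N f v η u₀ 𝒯 Δt Nt u T V α h ξ cf cη)
    (hK : K ∈ 𝒯) (hL : L ∈ 𝒯) :
    inflow 𝒯 v Δt n L K = inflow 𝒯 v Δt n K L + meshFlux 𝒯 v (n * Δt) ((n + 1) * Δt) K L := by
  rw [inflow, inflow, hS.mesh.meshFlux_antisymm hK hL, neg_neg]
  rcases le_total 0 (meshFlux 𝒯 v (n * Δt) ((n + 1) * Δt) K L) with h | h
  · rw [max_eq_left h, max_eq_right (by linarith)]; ring
  · rw [max_eq_right h, max_eq_left (by linarith)]; ring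

lemma hasSum_inflow_row (hS : IsSchemeSetting P ℱ m N f v η u₀ 𝒯 Δt Nt u T V α h ξ cf cη)
    (hK : K ∈ 𝒯) : HasSum (fun L : 𝒯 => inflow 𝒯 v Δt n K L) (∑ L ∈ hS.nb hK, inflow 𝒯 v Δt n K L) :=
  hS.hasSum_neighbors hK fun _ => inflow_of_notMem

/-- What leaves `K` exceeds what enters it by the net flux, which is zero for a divergence-free
velocity. Rows and columns of the inflow matrix therefore have equal sums. -/
lemma hasSum_inflow_col (hS : IsSchemeSetting P ℱ m N f v η u₀ 𝒯 Δt Nt u T V α h ξ cf cη)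
    (hK : K ∈ 𝒯) (hn : n < Nt) :
    HasSum (fun L : 𝒯 => inflow 𝒯 v Δt n L K) (∑ L ∈ hS.nb hK, inflow 𝒯 v Δt n K L) := by
  have h1 := hS.hasSum_neighbors hK (g := meshFlux 𝒯 v (n * Δt) ((n + 1) * Δt) K)
    fun _ => meshFlux_of_notMem
  rw [hS.sum_meshFlux hK hn] at h1
  have h2 := (hS.hasSum_inflow_row (n := n) hK).add h1
  rw [add_zero] at h2
  exact h2.congr_fun fun L => hS.inflow_sub_inflow hK L.2

lemma sum_inflow_le (hS : IsSchemeSetting P ℱ m N f v η u₀ 𝒯 Δt Nt u T V α h ξ cf cη)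
    (hK : K ∈ 𝒯) (hn : n < Nt) :
    ∑ L ∈ hS.nb hK, inflow 𝒯 v Δt n K L ≤ V * (1 / α * h ^ (d - 1)) := by
  refine (Finset.sum_le_sum fun L _ => ?_).trans (hS.mesh.sum_abs_meshFlux_le hS.dim_pos
    hS.velocity hS.time_nonneg hS.time_lt (hS.time_le hn) hK)
  exact max_le (neg_le_abs _) (abs_nonneg _)

/-- The perimeter bound `h ^ (d-1) / α` over the volume bound `α h ^ d` gives `1 / (α ^ 2 h)`, the
scale in the CFL condition. -/
lemma cfl_inflow (hS : IsSchemeSetting P ℱ m N f v η u₀ 𝒯 Δt Nt u T V α h ξ cf cη)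
    (hK : K ∈ 𝒯) (hn : n < Nt) :
    cf * (Δt / (volume K).toReal * ∑ L ∈ hS.nb hK, inflow 𝒯 v Δt n K L) ≤ 1 - ξ := by
  have hα := hS.mesh.alpha_pos
  have hh := hS.mesh.size_pos hS.dim_pos
  have hvol := hS.mesh.mul_pow_le_volume hK
  have hV := hS.velocity.nonneg hS.T_pos
  have hd := hS.step_pos
  obtain ⟨k, hk⟩ : ∃ k, d = k + 1 := ⟨d - 1, (Nat.succ_pred_eq_of_pos hS.dim_pos).symm⟩
  have hpos : 0 < α * h ^ d := by positivity
  calc cf * (Δt / (volume K).toReal * ∑ L ∈ hS.nb hK, inflow 𝒯 v Δt n K L)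
      ≤ cf * (Δt / (α * h ^ d) * (V * (1 / α * h ^ (d - 1)))) := by
        have := hS.sum_inflow_le hK hn
        gcongr
        exact Finset.sum_nonneg fun L _ => inflow_nonneg _ _ _ _ _ _
    _ = Δt * (cf * V) / (α ^ 2 * h) := by
        rw [hk, Nat.add_sub_cancel, pow_succ]
        field_simp
    _ ≤ 1 - ξ := by
        rw [div_le_iff₀ (by positivity)]
        linarith [hS.cfl]

lemma finsum_flux_eq (hS : IsSchemeSetting P ℱ m N f v η u₀ 𝒯 Δt Nt u T V α h ξ cf cη)
    (hK : K ∈ 𝒯) (hn : n < Nt) (ω : Ω) :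
    ∑ᶠ L ∈ neighbors 𝒯 K, (surf d (interface K L)).toReal *
        normalVelocity v K L (n * Δt) ((n + 1) * Δt) * f (uInterface v Δt u n K L ω) =
      -∑ L ∈ hS.nb hK, inflow 𝒯 v Δt n K L * (f (u n L ω) - f (u n K ω)) := by
  rw [finsum_mem_eq_finite_toFinset_sum _ (hS.mesh.finite_neighbors hS.dim_pos hK)]
  change ∑ L ∈ hS.nb hK, _ = _
  -- Subtracting this zero sum removes the outflow interfaces, where the upstream value is `u n K`
  -- itself.
  have h0 : ∑ L ∈ hS.nb hK, meshFlux 𝒯 v (n * Δt) ((n + 1) * Δt) K L * f (u n K ω) = 0 := by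
    rw [← Finset.sum_mul, hS.sum_meshFlux hK hn, zero_mul]
  rw [← sub_zero (∑ L ∈ hS.nb hK, (surf d (interface K L)).toReal * _ * _), ← h0,
    ← Finset.sum_sub_distrib, ← Finset.sum_neg_distrib]
  refine Finset.sum_congr rfl fun L hL => ?_
  have hL' := (hS.mem_nb hK).1 hL
  have hσ := hS.mesh.toReal_surf_pos hK hL'
  rw [inflow, meshFlux, if_pos hL', uInterface, upstream]
  split_ifs with h
  · rw [max_eq_right (neg_nonpos.2 (mul_nonneg hσ.le h))]; ring
  · rw [max_eq_left (neg_nonneg.2 (mul_nonpos_of_nonneg_of_nonpos hσ.le (not_le.1 h).le))]; ring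

/-- The discrete unknown before the noise is added. -/
noncomputable def transported (hS : IsSchemeSetting P ℱ m N f v η u₀ 𝒯 Δt Nt u T V α h ξ cf cη)
    (n : ℕ) (hK : K ∈ 𝒯) (ω : Ω) : ℝ :=
  u n K ω + Δt / (volume K).toReal *
    ∑ L ∈ hS.nb hK, inflow 𝒯 v Δt n K L * (f (u n L ω) - f (u n K ω))

lemma exists_step (hS : IsSchemeSetting P ℱ m N f v η u₀ 𝒯 Δt Nt u T V α h ξ cf cη)
    (hK : K ∈ 𝒯) (hn : n < Nt) :
    ∃ I : Ω → ℝ, IsStochasticIntegral P ℱ m N (n * Δt) ((n + 1) * Δt)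
      (fun ω _ z => η (u n K ω) z) I ∧
      u (n + 1) K =ᵐ[P] fun ω => hS.transported n hK ω + I ω := by
  obtain ⟨I, hI, hstep⟩ := hS.solution.step K hK n hn
  refine ⟨I, hI, ?_⟩
  filter_upwards [hstep] with ω hω
  rw [hS.finsum_flux_eq hK hn] at hω
  have hvol := (hS.mesh.volume_pos hK).ne'
  have hd := hS.step_pos.ne'
  rw [transported]
  field_simp at hω ⊢
  linarith

/-- The `n`-th discrete time. -/
noncomputable def time (_hS : IsSchemeSetting P ℱ m N f v η u₀ 𝒯 Δt Nt u T V α h ξ cf cη)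
    (n : ℕ) : ℝ≥0 := (n * Δt).toNNReal

lemma coe_time (hS : IsSchemeSetting P ℱ m N f v η u₀ 𝒯 Δt Nt u T V α h ξ cf cη) (n : ℕ) :
    (hS.time n : ℝ) = n * Δt := Real.coe_toNNReal _ hS.time_nonneg

/-- The cell mean is a continuous linear functional of the `L²` class, a multiple of the inner
product with an indicator, so joint measurability in `(ω, x)` is not required. -/
lemma measurable_init_mean (hS : IsSchemeSetting P ℱ m N f v η u₀ 𝒯 Δt Nt u T V α h ξ cf cη)
    (hK : K ∈ 𝒯) : Measurable[ℱ 0] fun ω => 1 / (volume K).toReal * ∫ x in K, u₀ ω x := by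
  have hKfin : volume K ≠ ∞ := (hS.mesh.polygonal K hK).isBounded.measure_lt_top.ne
  have hKm := (hS.mesh.isOpen hK).measurableSet
  have heq : ∀ g : Lp ℝ 2 (volume : Measure (Rd d)), ∫ x in K, g x =
      inner ℝ (indicatorConstLp 2 hKm hKfin (1 : ℝ)) g := fun g =>
    (L2.inner_indicatorConstLp_one hKm hKfin g).symm
  simp_rw [heq]
  have hc : Continuous fun g : Lp ℝ 2 (volume : Measure (Rd d)) => 1 / (volume K).toReal *
      inner ℝ (indicatorConstLp 2 hKm hKfin (1 : ℝ)) g := by fun_prop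
  exact (hc.comp_stronglyMeasurable hS.init_measurable).measurable

/-- Expand `0 ≤ ∫ (g - c)²` over `K`, with `c` the mean. -/
lemma mean_sq_le {g : Lp ℝ 2 (volume : Measure (Rd d))}
    (hKpos : 0 < (volume K).toReal) :
    (volume K).toReal * (1 / (volume K).toReal * ∫ x in K, g x) ^ 2 ≤ ∫ x in K, g x ^ 2 := by
  have hKfin : volume K ≠ ∞ := fun h => by simp [h] at hKpos
  have : IsFiniteMeasure (volume.restrict K) := isFiniteMeasure_restrict.2 hKfin
  have hg : MemLp g 2 (volume.restrict K) := (Lp.memLp g).restrict K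
  have hgi : Integrable g (volume.restrict K) := hg.integrable one_le_two
  set c := 1 / (volume K).toReal * ∫ x in K, g x with hc
  have hcK : ∫ x in K, g x = c * (volume K).toReal := by rw [hc]; field_simp
  have h0 : 0 ≤ ∫ x in K, (g x - c) ^ 2 := integral_nonneg fun x => sq_nonneg _
  have e : ∀ x, (g x - c) ^ 2 = (g x ^ 2 - 2 * c * g x) + c ^ 2 := fun x => by ring
  simp_rw [e] at h0
  have hi : Integrable (fun x => g x ^ 2 - 2 * c * g x) (volume.restrict K) :=
    hg.integrable_sq.sub (hgi.const_mul _)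
  rw [integral_add hi (integrable_const _), integral_sub hg.integrable_sq (hgi.const_mul _),
    integral_const_mul, hcK, integral_const, measureReal_restrict_apply_univ, smul_eq_mul,
    measureReal_def] at h0
  linarith

end IsSchemeSetting

/-! ### Adaptedness, square integrability and the one-step estimate in a cell -/

lemma FluxAssumption.memLp_comp {Ω : Type*} [MeasurableSpace Ω] {P : Measure Ω} {f : ℝ → ℝ}
    {cf : ℝ≥0} (hf : FluxAssumption f cf) {X : Ω → ℝ} (hX : MemLp X 2 P) :
    MemLp (fun ω => f (X ω)) 2 P :=
  hX.of_le_mul (hf.continuous.comp_aestronglyMeasurable hX.1)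
    (Eventually.of_forall fun ω => hf.abs_le (X ω))

lemma FluxAssumption.integrable_entropyFlux_comp {Ω : Type*} [MeasurableSpace Ω] {P : Measure Ω}
    {f : ℝ → ℝ} {cf : ℝ≥0} (hf : FluxAssumption f cf) {X : Ω → ℝ} (hX : MemLp X 2 P) :
    Integrable (fun ω => entropyFlux f (X ω)) P :=
  (hX.integrable_sq.const_mul (2 * (cf : ℝ))).mono'
    (hf.continuous_entropyFlux.comp_aestronglyMeasurable hX.1)
    (Eventually.of_forall fun ω => hf.abs_entropyFlux_le (X ω))

namespace IsSchemeSetting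

variable {d : ℕ} {Ω E : Type*} [mΩ : MeasurableSpace Ω] [MeasurableSpace E]
  {P : Measure Ω} {ℱ : Filtration ℝ≥0 mΩ} {m : Measure E} {N : Ω → Measure (ℝ × E)}
  {f : ℝ → ℝ} {v : ℝ → Rd d → Rd d} {η : ℝ → E → ℝ}
  {u₀ : Ω → Lp ℝ 2 (volume : Measure (Rd d))} {𝒯 : Set (Set (Rd d))} {Δt : ℝ} {Nt : ℕ}
  {u : ℕ → Set (Rd d) → Ω → ℝ} {T V α h ξ : ℝ} {cf : ℝ≥0} {cη : ℝ} {n : ℕ} {K L : Set (Rd d)}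

lemma memLp_init (hS : IsSchemeSetting P ℱ m N f v η u₀ 𝒯 Δt Nt u T V α h ξ cf cη) :
    MemLp u₀ 2 P := by
  refine ⟨(hS.init_measurable.mono (ℱ.le 0)).aestronglyMeasurable, ?_⟩
  refine (eLpNorm_lt_top_iff_lintegral_rpow_enorm_lt_top two_ne_zero ENNReal.ofNat_ne_top).2 ?_
  simpa using hS.init_finite

lemma memLp_init_mean (hS : IsSchemeSetting P ℱ m N f v η u₀ 𝒯 Δt Nt u T V α h ξ cf cη)
    (hK : K ∈ 𝒯) : MemLp (fun ω => 1 / (volume K).toReal * ∫ x in K, u₀ ω x) 2 P := by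
  have hKfin : volume K ≠ ∞ := (hS.mesh.polygonal K hK).isBounded.measure_lt_top.ne
  have hKm := (hS.mesh.isOpen hK).measurableSet
  refine MemLp.const_mul (hS.memLp_init.of_le_mul
    (c := ‖indicatorConstLp 2 hKm hKfin (1 : ℝ)‖) ?_ (Eventually.of_forall fun ω => ?_)) _
  · have hvol := (hS.mesh.volume_pos hK).ne'
    have := ((hS.measurable_init_mean hK).mono (ℱ.le 0) le_rfl).const_mul (volume K).toReal
    refine this.aestronglyMeasurable.congr (Eventually.of_forall fun ω => ?_)
    field_simp
  · rw [← L2.inner_indicatorConstLp_one hKm hKfin]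
    exact norm_inner_le_norm _ _

lemma measurable_transported (hS : IsSchemeSetting P ℱ m N f v η u₀ 𝒯 Δt Nt u T V α h ξ cf cη)
    {t : ℝ≥0} (hu : ∀ K ∈ 𝒯, Measurable[ℱ t] (u n K)) (hK : K ∈ 𝒯) :
    Measurable[ℱ t] (hS.transported n hK) := by
  refine (hu K hK).add (Measurable.const_mul (Finset.measurable_fun_sum _ fun L hL => ?_) _)
  have hL' := ((hS.mem_nb hK).1 hL).1
  exact ((hS.flux.continuous.measurable.comp (hu L hL')).sub
    (hS.flux.continuous.measurable.comp (hu K hK))).const_mul _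

lemma memLp_transported (hS : IsSchemeSetting P ℱ m N f v η u₀ 𝒯 Δt Nt u T V α h ξ cf cη)
    (hu : ∀ K ∈ 𝒯, MemLp (u n K) 2 P) (hK : K ∈ 𝒯) :
    MemLp (hS.transported n hK) 2 P := by
  have h1 : MemLp (fun ω => ∑ L ∈ hS.nb hK, inflow 𝒯 v Δt n K L * (f (u n L ω) - f (u n K ω)))
      2 P := memLp_finsetSum _ fun L hL =>
    ((hS.flux.memLp_comp (hu L ((hS.mem_nb hK).1 hL).1)).sub
      (hS.flux.memLp_comp (hu K hK))).const_mul _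
  exact (hu K hK).add (h1.const_mul _)

lemma exists_step_time (hS : IsSchemeSetting P ℱ m N f v η u₀ 𝒯 Δt Nt u T V α h ξ cf cη)
    (hK : K ∈ 𝒯) (hn : n < Nt) :
    ∃ I : Ω → ℝ, IsStochasticIntegral P ℱ m N (hS.time n) (hS.time (n + 1))
      (fun ω _ z => η (u n K ω) z) I ∧
      u (n + 1) K =ᵐ[P] fun ω => hS.transported n hK ω + I ω := by
  rw [hS.coe_time, hS.coe_time, Nat.cast_succ]
  exact hS.exists_step hK hn

lemma time_mono (hS : IsSchemeSetting P ℱ m N f v η u₀ 𝒯 Δt Nt u T V α h ξ cf cη) :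
    hS.time n ≤ hS.time (n + 1) := by
  rw [← NNReal.coe_le_coe, hS.coe_time, hS.coe_time, Nat.cast_succ]
  exact hS.time_lt.le

variable [IsProbabilityMeasure P] [SigmaFinite m]

lemma regular (hS : IsSchemeSetting P ℱ m N f v η u₀ 𝒯 Δt Nt u T V α h ξ cf cη) :
    ∀ n ≤ Nt, ∀ K ∈ 𝒯, Measurable[ℱ (hS.time n)] (u n K) ∧ MemLp (u n K) 2 P := by
  intro n
  induction n with
  | zero =>
    intro _ K hK
    have h0 : hS.time 0 = 0 := by rw [← NNReal.coe_inj, hS.coe_time]; simp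
    have hinit := hS.solution.init K hK
    rw [h0]
    exact ⟨hS.usual.measurable_congr (hS.measurable_init_mean hK) hinit,
      (memLp_congr_ae hinit).2 (hS.memLp_init_mean hK)⟩
  | succ n ih =>
    intro hn K hK
    have ih' := ih (Nat.le_of_succ_le hn)
    obtain ⟨I, hI, hstep⟩ := hS.exists_step_time hK hn
    have hm := hS.measurable_transported (fun K hK => (ih' K hK).1) hK
    have hL := hS.memLp_transported (fun K hK => (ih' K hK).2) hK
    exact ⟨hS.usual.measurable_congr ((hm.mono (ℱ.mono hS.time_mono) le_rfl).add
      (hI.measurable hS.usual hS.noise)) hstep, (memLp_congr_ae hstep).2 (hL.add (hI.memLp hS.noise))⟩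

lemma memLp (hS : IsSchemeSetting P ℱ m N f v η u₀ 𝒯 Δt Nt u T V α h ξ cf cη) (hn : n ≤ Nt)
    (hK : K ∈ 𝒯) : MemLp (u n K) 2 P := (hS.regular n hn K hK).2

/-- The transported value is known at the start of the step, so the cross term with the stochastic
integral has mean zero. -/
lemma integral_sq_succ_le (hS : IsSchemeSetting P ℱ m N f v η u₀ 𝒯 Δt Nt u T V α h ξ cf cη)
    (hK : K ∈ 𝒯) (hn : n < Nt) :
    ∫ ω, u (n + 1) K ω ^ 2 ∂P ≤
      ∫ ω, hS.transported n hK ω ^ 2 ∂P + Δt * cη * ∫ ω, u n K ω ^ 2 ∂P := by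
  obtain ⟨I, hI, hstep⟩ := hS.exists_step_time hK hn
  have hr := hS.regular n hn.le
  have hm := hS.measurable_transported (fun K hK => (hr K hK).1) hK
  have hL := hS.memLp_transported (fun K hK => (hr K hK).2) hK
  have hI2 := hI.memLp hS.noise
  have hcross := hI.integral_mul_eq_zero hS.noise hm hL
  have hIle := hS.coeff.integral_sq_le hS.noise (NNReal.coe_le_coe.2 hS.time_mono)
    ((hr K hK).1.mono (ℱ.le _) le_rfl) (hr K hK).2 hI
  have htime : (hS.time (n + 1) : ℝ) - hS.time n = Δt := by
    rw [hS.coe_time, hS.coe_time, Nat.cast_succ]; ring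
  rw [htime] at hIle
  have hci : Integrable (fun ω => hS.transported n hK ω * I ω) P := hL.integrable_mul hI2
  calc ∫ ω, u (n + 1) K ω ^ 2 ∂P
      = ∫ ω, (hS.transported n hK ω ^ 2 + I ω ^ 2) + 2 * (hS.transported n hK ω * I ω) ∂P := by
        refine integral_congr_ae ?_
        filter_upwards [hstep] with ω hω
        rw [hω]; ring
    _ = ∫ ω, hS.transported n hK ω ^ 2 ∂P + ∫ ω, I ω ^ 2 ∂P := by
        have hsum : Integrable (fun ω => hS.transported n hK ω ^ 2 + I ω ^ 2) P :=
          hL.integrable_sq.add hI2.integrable_sq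
        rw [integral_add hsum (hci.const_mul 2), integral_add hL.integrable_sq hI2.integrable_sq, integral_const_mul, hcross]
        ring
    _ ≤ _ := by linarith

lemma integral_sq_transported_le
    (hS : IsSchemeSetting P ℱ m N f v η u₀ 𝒯 Δt Nt u T V α h ξ cf cη)
    (hK : K ∈ 𝒯) (hn : n < Nt) :
    cf * ∫ ω, hS.transported n hK ω ^ 2 ∂P ≤ cf * ∫ ω, u n K ω ^ 2 ∂P -
      2 * cf * (Δt / (volume K).toReal) * ∑ L ∈ hS.nb hK, inflow 𝒯 v Δt n K L *
        (∫ ω, entropyFlux f (u n K ω) ∂P - ∫ ω, entropyFlux f (u n L ω) ∂P) -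
      Δt / (volume K).toReal * ξ * ∑ L ∈ hS.nb hK, inflow 𝒯 v Δt n K L *
        ∫ ω, (f (u n L ω) - f (u n K ω)) ^ 2 ∂P := by
  have hr : ∀ L ∈ 𝒯, MemLp (u n L) 2 P := fun L hL => hS.memLp hn.le hL
  have hnb : ∀ L ∈ hS.nb hK, L ∈ 𝒯 := fun L hL => ((hS.mem_nb hK).1 hL).1
  have hκ : 0 ≤ Δt / (volume K).toReal :=
    div_nonneg hS.step_pos.le ENNReal.toReal_nonneg
  have hp : ∀ L ∈ 𝒯, Integrable (fun ω => entropyFlux f (u n L ω)) P := fun L hL =>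
    hS.flux.integrable_entropyFlux_comp (hr L hL)
  have hp2 : ∀ L ∈ 𝒯, Integrable (fun ω => inflow 𝒯 v Δt n K L *
      (entropyFlux f (u n K ω) - entropyFlux f (u n L ω))) P := fun L hL =>
    ((hp K hK).sub (hp L hL)).const_mul _
  have hi1 : Integrable (fun ω => ∑ L ∈ hS.nb hK, inflow 𝒯 v Δt n K L *
      (entropyFlux f (u n K ω) - entropyFlux f (u n L ω))) P :=
    integrable_finsetSum _ fun L hL => hp2 L (hnb L hL)
  have hD : ∀ L ∈ 𝒯, Integrable (fun ω => (f (u n L ω) - f (u n K ω)) ^ 2) P := fun L hL =>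
    ((hS.flux.memLp_comp (hr L hL)).sub (hS.flux.memLp_comp (hr K hK))).integrable_sq
  have hi2 : Integrable (fun ω => ∑ L ∈ hS.nb hK, inflow 𝒯 v Δt n K L *
      (f (u n L ω) - f (u n K ω)) ^ 2) P :=
    integrable_finsetSum _ fun L hL => (hD L (hnb L hL)).const_mul _
  have hi0 := (hr K hK).integrable_sq.const_mul (cf : ℝ)
  have hi3 : Integrable (fun ω => cf * u n K ω ^ 2 - 2 * cf * (Δt / (volume K).toReal) *
      ∑ L ∈ hS.nb hK, inflow 𝒯 v Δt n K L *
        (entropyFlux f (u n K ω) - entropyFlux f (u n L ω))) P := hi0.sub (hi1.const_mul _)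
  have hmono := integral_mono ((hS.memLp_transported hr hK).integrable_sq.const_mul (cf : ℝ))
    (hi3.sub (hi2.const_mul (Δt / (volume K).toReal * ξ))) fun ω =>
    hS.flux.upwind_energy (ξ := ξ) (hS.nb hK) (fun L _ => inflow_nonneg _ _ _ _ _ _) hκ
      (hS.cfl_inflow hK hn) (u n K ω) (fun L => u n L ω)
  rw [integral_const_mul] at hmono
  refine hmono.trans_eq ?_
  simp only [Pi.sub_apply]
  rw [integral_sub hi3 (hi2.const_mul _), integral_sub hi0
    (hi1.const_mul _), integral_const_mul, integral_const_mul, integral_const_mul,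
    integral_finsetSum _ fun L hL => hp2 L (hnb L hL),
    integral_finsetSum _ fun L hL => (hD L (hnb L hL)).const_mul _]
  congr 2
  · congr 1
    refine Finset.sum_congr rfl fun L hL => ?_
    rw [integral_const_mul, integral_sub (hp K hK) (hp L (hnb L hL))]
  · exact Finset.sum_congr rfl fun L hL => integral_const_mul _ _

end IsSchemeSetting

/-! ### The global energy estimate -/

lemma discrete_gronwall {e r : ℕ → ℝ} {c g k : ℝ} {M : ℕ} (hg : 1 ≤ g) (hk : 0 ≤ k)
    (hr : ∀ n, 0 ≤ r n) (h : ∀ n < M, c * e (n + 1) + k * r n ≤ c * g * e n) :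
    k * ∑ n ∈ Finset.range M, r n + c * e M ≤ c * g ^ M * e 0 := by
  induction M with
  | zero => simp
  | succ M ih =>
    have h1 := ih fun n hn => h n (hn.trans M.lt_succ_self)
    have h2 := h M M.lt_succ_self
    have h3 := mul_le_mul_of_nonneg_left h1 (zero_le_one.trans hg)
    -- Multiplying the induction hypothesis by `g` enlarges the earlier dissipation; the surplus is
    -- nonnegative and is dropped.
    have h4 : 0 ≤ (g - 1) * (k * ∑ n ∈ Finset.range M, r n) :=
      mul_nonneg (sub_nonneg.2 hg) (mul_nonneg hk (Finset.sum_nonneg fun n _ => hr n))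
    rw [Finset.sum_range_succ, pow_succ]
    linarith

namespace IsSchemeSetting

variable {d : ℕ} {Ω E : Type*} [mΩ : MeasurableSpace Ω] [MeasurableSpace E]
  {P : Measure Ω} {ℱ : Filtration ℝ≥0 mΩ} {m : Measure E} {N : Ω → Measure (ℝ × E)}
  {f : ℝ → ℝ} {v : ℝ → Rd d → Rd d} {η : ℝ → E → ℝ}
  {u₀ : Ω → Lp ℝ 2 (volume : Measure (Rd d))} {𝒯 : Set (Set (Rd d))} {Δt : ℝ} {Nt : ℕ}
  {u : ℕ → Set (Rd d) → Ω → ℝ} {T V α h ξ : ℝ} {cf : ℝ≥0} {cη : ℝ} {n : ℕ} {K L : Set (Rd d)}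

/-- The energy of the discrete solution in a control volume at the `n`-th time. -/
noncomputable def energy (_hS : IsSchemeSetting P ℱ m N f v η u₀ 𝒯 Δt Nt u T V α h ξ cf cη)
    (n : ℕ) (K : 𝒯) : ℝ := (volume K.1).toReal * ∫ ω, u n K ω ^ 2 ∂P

/-- The energy dissipated in a control volume by the upwind flux. -/
noncomputable def dissipation (hS : IsSchemeSetting P ℱ m N f v η u₀ 𝒯 Δt Nt u T V α h ξ cf cη)
    (n : ℕ) (K : 𝒯) : ℝ :=
  ∑ L ∈ hS.nb K.2, inflow 𝒯 v Δt n K L * ∫ ω, (f (u n L ω) - f (u n K ω)) ^ 2 ∂P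

lemma energy_nonneg (hS : IsSchemeSetting P ℱ m N f v η u₀ 𝒯 Δt Nt u T V α h ξ cf cη)
    (n : ℕ) (K : 𝒯) : 0 ≤ hS.energy n K :=
  mul_nonneg ENNReal.toReal_nonneg (integral_nonneg fun _ => sq_nonneg _)

lemma dissipation_nonneg (hS : IsSchemeSetting P ℱ m N f v η u₀ 𝒯 Δt Nt u T V α h ξ cf cη)
    (n : ℕ) (K : 𝒯) : 0 ≤ hS.dissipation n K :=
  Finset.sum_nonneg fun _ _ => mul_nonneg (inflow_nonneg _ _ _ _ _ _)
    (integral_nonneg fun _ => sq_nonneg _)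

lemma sum_mean_sq_le (hS : IsSchemeSetting P ℱ m N f v η u₀ 𝒯 Δt Nt u T V α h ξ cf cη)
    (s : Finset 𝒯) (g : Lp ℝ 2 (volume : Measure (Rd d))) :
    ∑ K ∈ s, (volume K.1).toReal * (1 / (volume K.1).toReal * ∫ x in K.1, g x) ^ 2 ≤ ‖g‖ ^ 2 := by
  have hg : Integrable (fun x => g x ^ 2) := (Lp.memLp g).integrable_sq
  calc _ ≤ ∑ K ∈ s, ∫ x in K.1, g x ^ 2 :=
        Finset.sum_le_sum fun K _ => mean_sq_le (hS.mesh.volume_pos K.2)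
    _ = ∫ x in ⋃ K ∈ s, K.1, g x ^ 2 := by
        rw [integral_biUnion_finset s (fun K _ => (hS.mesh.isOpen K.2).measurableSet)
          (fun K _ L _ hKL => hS.mesh.disjoint K.1 K.2 L.1 L.2 (Subtype.coe_injective.ne hKL))
          (fun K _ => hg.integrableOn)]
    _ ≤ ∫ x, g x ^ 2 := setIntegral_le_integral hg (Eventually.of_forall fun x => sq_nonneg _)
    _ = ‖g‖ ^ 2 := by
        rw [← real_inner_self_eq_norm_sq, L2.inner_def]
        simp [sq]

lemma sum_energy_zero_le (hS : IsSchemeSetting P ℱ m N f v η u₀ 𝒯 Δt Nt u T V α h ξ cf cη)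
    (s : Finset 𝒯) : ∑ K ∈ s, hS.energy 0 K ≤ (∫⁻ ω, ‖u₀ ω‖ₑ ^ 2 ∂P).toReal := by
  have hi : Integrable (fun ω => ‖u₀ ω‖ ^ 2) P := hS.memLp_init.norm.integrable_sq
  have hmean : ∀ K : 𝒯, Integrable (fun ω => (volume K.1).toReal *
      (1 / (volume K.1).toReal * ∫ x in K.1, u₀ ω x) ^ 2) P := fun K =>
    (hS.memLp_init_mean K.2).integrable_sq.const_mul _
  calc ∑ K ∈ s, hS.energy 0 K
      = ∫ ω, ∑ K ∈ s, (volume K.1).toReal *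
          (1 / (volume K.1).toReal * ∫ x in K.1, u₀ ω x) ^ 2 ∂P := by
        rw [integral_finsetSum _ fun K _ => hmean K]
        refine Finset.sum_congr rfl fun K _ => ?_
        rw [energy, integral_const_mul]
        congr 1
        refine integral_congr_ae ?_
        filter_upwards [hS.solution.init K.1 K.2] with ω hω
        rw [hω]
    _ ≤ ∫ ω, ‖u₀ ω‖ ^ 2 ∂P := integral_mono (integrable_finsetSum _ fun K _ => hmean K) hi
        fun ω => hS.sum_mean_sq_le s (u₀ ω)
    _ = _ := by
        rw [integral_eq_lintegral_of_nonneg_ae (Eventually.of_forall fun ω => sq_nonneg _) hi.1]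
        congr 1
        refine lintegral_congr fun ω => ?_
        rw [ENNReal.ofReal_pow (norm_nonneg _), ofReal_norm]

lemma summable_energy_zero (hS : IsSchemeSetting P ℱ m N f v η u₀ 𝒯 Δt Nt u T V α h ξ cf cη) :
    Summable (hS.energy 0) := summable_of_sum_le (hS.energy_nonneg 0) hS.sum_energy_zero_le

variable [IsProbabilityMeasure P] [SigmaFinite m]

lemma energy_succ_le (hS : IsSchemeSetting P ℱ m N f v η u₀ 𝒯 Δt Nt u T V α h ξ cf cη)
    (hn : n < Nt) (K : 𝒯) :
    cf * hS.energy (n + 1) K + Δt * ξ * hS.dissipation n K ≤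
      cf * (1 + Δt * cη) * hS.energy n K - 2 * cf * Δt * ∑ L ∈ hS.nb K.2, inflow 𝒯 v Δt n K L *
        (∫ ω, entropyFlux f (u n K ω) ∂P - ∫ ω, entropyFlux f (u n L ω) ∂P) := by
  have hvol := hS.mesh.volume_pos K.2
  have h1 := mul_le_mul_of_nonneg_left (hS.integral_sq_succ_le K.2 hn)
    (mul_nonneg hvol.le cf.coe_nonneg)
  have h2 := mul_le_mul_of_nonneg_left (hS.integral_sq_transported_le K.2 hn) hvol.le
  have h3 : (volume K.1).toReal * (Δt / (volume K.1).toReal) = Δt := by field_simp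
  unfold energy dissipation
  have e : ∀ a b c : ℝ, (volume K.1).toReal * (cf * a - 2 * cf * (Δt / (volume K.1).toReal) * b -
      Δt / (volume K.1).toReal * ξ * c) = (volume K.1).toReal * cf * a -
        2 * cf * ((volume K.1).toReal * (Δt / (volume K.1).toReal)) * b -
      (volume K.1).toReal * (Δt / (volume K.1).toReal) * ξ * c := fun a b c => by ring
  rw [e, h3] at h2
  linarith

/-- Summability at the next time comes out of the estimate itself: the nonnegative left sides of
`energy_succ_le` are dominated by a summable family in which the entropy exchange has total zero.
Dividing by `cf` and `ξ` requires both to be positive. -/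
lemma sum_energy_succ_le (hS : IsSchemeSetting P ℱ m N f v η u₀ 𝒯 Δt Nt u T V α h ξ cf cη)
    (hcf : 0 < cf) (hξ : 0 < ξ) (hn : n < Nt) (hsum : Summable (hS.energy n)) :
    Summable (hS.energy (n + 1)) ∧ Summable (hS.dissipation n) ∧
      cf * ∑' K, hS.energy (n + 1) K + Δt * ξ * ∑' K, hS.dissipation n K ≤
        cf * (1 + Δt * cη) * ∑' K, hS.energy n K := by
  have hΔ := hS.step_pos
  have hcf' : (0 : ℝ) < cf := hcf
  have hh := hS.mesh.size_pos hS.dim_pos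
  have hα := hS.mesh.alpha_pos
  have hpos : 0 < α * h ^ d := by positivity
  -- The energies carry the weight `|K|` and the entropy fluxes do not; the uniform lower bound `α h
  -- ^ d` on the volumes closes the gap.
  have hp : Summable fun K : 𝒯 => ∫ ω, entropyFlux f (u n K ω) ∂P := by
    refine Summable.of_norm_bounded (hsum.mul_left (2 * cf / (α * h ^ d))) fun K => ?_
    have hu := hS.memLp hn.le K.2
    calc ‖∫ ω, entropyFlux f (u n K ω) ∂P‖ ≤ ∫ ω, 2 * cf * u n K ω ^ 2 ∂P :=
          norm_integral_le_of_norm_le (hu.integrable_sq.const_mul _)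
            (Eventually.of_forall fun ω => hS.flux.abs_entropyFlux_le _)
      _ = 2 * cf / (α * h ^ d) * (α * h ^ d * ∫ ω, u n K ω ^ 2 ∂P) := by
          rw [integral_const_mul]; field_simp
      _ ≤ _ := by
          have := hS.mesh.mul_pow_le_volume K.2
          have h0 : 0 ≤ ∫ ω, u n K ω ^ 2 ∂P := integral_nonneg fun _ => sq_nonneg _
          rw [energy]
          gcongr
  have hq := hasSum_exchange (w := fun K L : 𝒯 => inflow 𝒯 v Δt n K L)
    (fun K L => inflow_nonneg _ _ _ _ _ _) (fun K => hS.hasSum_inflow_row K.2)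
    (fun K => hS.hasSum_inflow_col K.2 hn) (fun K => hS.sum_inflow_le K.2 hn) hp
  have hq' : HasSum (fun K : 𝒯 => ∑ L ∈ hS.nb K.2, inflow 𝒯 v Δt n K L *
      (∫ ω, entropyFlux f (u n K ω) ∂P - ∫ ω, entropyFlux f (u n L ω) ∂P)) 0 := by
    refine hq.congr_fun fun K => ?_
    exact (hS.hasSum_neighbors K.2 (g := fun L => inflow 𝒯 v Δt n K L *
      (∫ ω, entropyFlux f (u n K ω) ∂P - ∫ ω, entropyFlux f (u n L ω) ∂P)) fun L hL => by
        rw [inflow_of_notMem hL, zero_mul]).tsum_eq.symm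
  have hR := (hsum.hasSum.mul_left (cf * (1 + Δt * cη))).sub (hq'.mul_left (2 * cf * Δt))
  rw [mul_zero, sub_zero] at hR
  have he : ∀ K, 0 ≤ cf * hS.energy (n + 1) K := fun K =>
    mul_nonneg hcf'.le (hS.energy_nonneg _ K)
  have hr : ∀ K, 0 ≤ Δt * ξ * hS.dissipation n K := fun K =>
    mul_nonneg (mul_pos hΔ hξ).le (hS.dissipation_nonneg n K)
  have hs1 : Summable fun K => cf * hS.energy (n + 1) K :=
    Summable.of_nonneg_of_le he
      (fun K => (le_add_of_nonneg_right (hr K)).trans (hS.energy_succ_le hn K)) hR.summable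
  have hs2 : Summable fun K => Δt * ξ * hS.dissipation n K :=
    Summable.of_nonneg_of_le hr
      (fun K => (le_add_of_nonneg_left (he K)).trans (hS.energy_succ_le hn K)) hR.summable
  refine ⟨(summable_mul_left_iff hcf'.ne').1 hs1,
    (summable_mul_left_iff (mul_pos hΔ hξ).ne').1 hs2, ?_⟩
  rw [← tsum_mul_left, ← tsum_mul_left, ← hs1.tsum_add hs2, ← hR.tsum_eq]
  exact (hs1.add hs2).tsum_le_tsum (hS.energy_succ_le hn) hR.summable

lemma summable_energy (hS : IsSchemeSetting P ℱ m N f v η u₀ 𝒯 Δt Nt u T V α h ξ cf cη)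
    (hcf : 0 < cf) (hξ : 0 < ξ) : ∀ n ≤ Nt, Summable (hS.energy n) := by
  intro n
  induction n with
  | zero => exact fun _ => hS.summable_energy_zero
  | succ n ih => exact fun hn => (hS.sum_energy_succ_le hcf hξ hn (ih (Nat.le_of_succ_le hn))).1

lemma sum_dissipation_le (hS : IsSchemeSetting P ℱ m N f v η u₀ 𝒯 Δt Nt u T V α h ξ cf cη)
    (hcf : 0 < cf) (hξ : 0 < ξ) :
    Δt * ξ * ∑ n ∈ Finset.range Nt, ∑' K, hS.dissipation n K ≤
      cf * Real.exp (cη * T) * (∫⁻ ω, ‖u₀ ω‖ₑ ^ 2 ∂P).toReal := by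
  have hΔ := hS.step_pos
  have hcη := hS.coeff.nonneg
  have h1 := discrete_gronwall (M := Nt) (e := fun n => ∑' K, hS.energy n K)
    (r := fun n => ∑' K, hS.dissipation n K) (c := cf) (g := 1 + Δt * cη) (k := Δt * ξ)
    (le_add_of_nonneg_right (mul_nonneg hΔ.le hcη)) (mul_pos hΔ hξ).le
    (fun n => tsum_nonneg (hS.dissipation_nonneg n))
    (fun n hn => (hS.sum_energy_succ_le hcf hξ hn (hS.summable_energy hcf hξ n hn.le)).2.2)
  have h2 : 0 ≤ cf * ∑' K, hS.energy Nt K :=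
    mul_nonneg cf.2 (tsum_nonneg (hS.energy_nonneg Nt))
  refine (le_trans (by linarith) h1).trans ?_
  have h3 : (1 + Δt * cη) ^ Nt ≤ Real.exp (cη * T) := by
    calc (1 + Δt * cη) ^ Nt ≤ Real.exp (Δt * cη) ^ Nt := by
          gcongr
          linarith [Real.add_one_le_exp (Δt * cη)]
      _ = Real.exp (cη * T) := by
          rw [← Real.exp_nat_mul, ← hS.Nt_mul]; ring_nf
  have h4 := Real.tsum_le_of_sum_le (hS.energy_nonneg 0) hS.sum_energy_zero_le
  have h5 : 0 ≤ ∑' K, hS.energy 0 K := tsum_nonneg (hS.energy_nonneg 0)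
  gcongr

end IsSchemeSetting

/-! ### From squared jumps to absolute jumps on a ball -/

lemma lintegral_ofReal_abs_le {Ω : Type*} [MeasurableSpace Ω] (P : Measure Ω)
    [IsProbabilityMeasure P] (X : Ω → ℝ) {θ : ℝ} (hθ : 0 < θ) :
    ∫⁻ ω, ENNReal.ofReal |X ω| ∂P ≤ ENNReal.ofReal (θ / 2) * ∫⁻ ω, ENNReal.ofReal (X ω ^ 2) ∂P +
      ENNReal.ofReal (1 / (2 * θ)) := by
  calc ∫⁻ ω, ENNReal.ofReal |X ω| ∂P
      ≤ ∫⁻ ω, ENNReal.ofReal (θ / 2) * ENNReal.ofReal (X ω ^ 2) +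
          ENNReal.ofReal (1 / (2 * θ)) ∂P := by
        refine lintegral_mono fun ω => ?_
        rw [← ENNReal.ofReal_mul (by positivity), ← ENNReal.ofReal_add (by positivity)
          (by positivity)]
        refine ENNReal.ofReal_le_ofReal ?_
        have h1 : θ / 2 * X ω ^ 2 + 1 / (2 * θ) - |X ω| = (θ * |X ω| - 1) ^ 2 / (2 * θ) := by
          rw [← sq_abs (X ω)]
          field_simp
          ring
        have h2 : 0 ≤ (θ * |X ω| - 1) ^ 2 / (2 * θ) := by positivity
        linarith
    _ = _ := by
        rw [lintegral_add_right _ measurable_const, lintegral_const_mul' _ _ ENNReal.ofReal_ne_top,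
          lintegral_const, measure_univ, mul_one]

namespace IsAdmissibleMesh

variable {d : ℕ} {𝒯 : Set (Set (Rd d))} {α h : ℝ}

lemma surf_mul_normalVelocity (hM : IsAdmissibleMesh 𝒯 α h) {K L : Set (Rd d)} (hK : K ∈ 𝒯)
    (hL : L ∈ neighbors 𝒯 K) (v : ℝ → Rd d → Rd d) (a b : ℝ) :
    surf d (interface K L) * ENNReal.ofReal |normalVelocity v K L a b| =
      ENNReal.ofReal |meshFlux 𝒯 v a b K L| := by
  rw [meshFlux, if_pos hL, abs_mul, abs_of_pos (hM.toReal_surf_pos hK hL),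
    ENNReal.ofReal_mul ENNReal.toReal_nonneg, ENNReal.ofReal_toReal
      (ENNReal.toReal_pos_iff.1 (hM.toReal_surf_pos hK hL)).2.ne]

lemma tsum_indicator_meshInBall_le (hM : IsAdmissibleMesh 𝒯 α h) (R : ℝ) :
    ∑' K : 𝒯, (meshInBall 𝒯 R).indicator (fun _ => (1 : ℝ≥0∞)) K.1 * ENNReal.ofReal (α * h ^ d) ≤
      volume (Metric.ball (0 : Rd d) R) := by
  calc _ ≤ ∑' K : 𝒯, volume (K.1 ∩ Metric.ball (0 : Rd d) R) := by
        refine ENNReal.tsum_le_tsum fun K => ?_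
        by_cases hK : K.1 ∈ meshInBall 𝒯 R
        · rw [indicator_of_mem hK, one_mul, inter_eq_left.2 hK.2]
          exact hM.volume_ge K.1 K.2
        · rw [indicator_of_notMem hK, zero_mul]
          exact zero_le
    _ ≤ volume (⋃ K : 𝒯, K.1 ∩ Metric.ball (0 : Rd d) R) :=
        tsum_meas_le_meas_iUnion_of_disjoint _
          (fun K => (hM.isOpen K.2).measurableSet.inter Metric.isOpen_ball.measurableSet)
          fun K L hKL => (hM.disjoint K.1 K.2 L.1 L.2 (Subtype.coe_injective.ne hKL)).mono
            inter_subset_left inter_subset_left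
    _ ≤ _ := measure_mono (iUnion_subset fun K => inter_subset_right)

end IsAdmissibleMesh

namespace IsSchemeSetting

variable {d : ℕ} {Ω E : Type*} [mΩ : MeasurableSpace Ω] [MeasurableSpace E]
  {P : Measure Ω} {ℱ : Filtration ℝ≥0 mΩ} {m : Measure E} {N : Ω → Measure (ℝ × E)}
  {f : ℝ → ℝ} {v : ℝ → Rd d → Rd d} {η : ℝ → E → ℝ}
  {u₀ : Ω → Lp ℝ 2 (volume : Measure (Rd d))} {𝒯 : Set (Set (Rd d))} {Δt : ℝ} {Nt : ℕ}
  {u : ℕ → Set (Rd d) → Ω → ℝ} {T V α h ξ : ℝ} {cf : ℝ≥0} {cη : ℝ} {n : ℕ} {K L : Set (Rd d)}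

lemma abs_meshFlux_eq (hS : IsSchemeSetting P ℱ m N f v η u₀ 𝒯 Δt Nt u T V α h ξ cf cη)
    (K L : 𝒯) : |meshFlux 𝒯 v (n * Δt) ((n + 1) * Δt) L K| =
      |meshFlux 𝒯 v (n * Δt) ((n + 1) * Δt) K L| := by
  rw [hS.mesh.meshFlux_antisymm K.2 L.2, abs_neg]

lemma tsum_abs_meshFlux_le (hS : IsSchemeSetting P ℱ m N f v η u₀ 𝒯 Δt Nt u T V α h ξ cf cη)
    (hn : n < Nt) (K : 𝒯) :
    ∑' L : 𝒯, ENNReal.ofReal |meshFlux 𝒯 v (n * Δt) ((n + 1) * Δt) K L| ≤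
      ENNReal.ofReal (V * (1 / α * h ^ (d - 1))) := by
  have hs := hS.hasSum_neighbors K.2
    (g := fun L => |meshFlux 𝒯 v (n * Δt) ((n + 1) * Δt) K L|) fun L hL => by
      rw [meshFlux_of_notMem hL, abs_zero]
  rw [← ENNReal.ofReal_tsum_of_nonneg (fun L => abs_nonneg _) hs.summable, hs.tsum_eq]
  exact ENNReal.ofReal_le_ofReal (hS.mesh.sum_abs_meshFlux_le hS.dim_pos hS.velocity
    hS.time_nonneg hS.time_lt (hS.time_le hn) K.2)

/-- Each counted pair has an endpoint in the ball, so its flux is at most the sum of the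
contributions charged to the two endpoints; by symmetry both charges have the same total, hence the
factor `2`. A cell in the ball carries flux at most `V / (α ^ 2 h)` times `α h ^ d`, and these lower
volume bounds sum to at most the volume of the ball. -/
lemma tsum_abs_meshFlux_meshInBall_le
    (hS : IsSchemeSetting P ℱ m N f v η u₀ 𝒯 Δt Nt u T V α h ξ cf cη) (hn : n < Nt) (R : ℝ) :
    ∑' K : 𝒯, ∑' L : {L // L ∈ neighbors 𝒯 K.1 ∧ (K.1 ∈ meshInBall 𝒯 R ∨ L ∈ meshInBall 𝒯 R)},
        ENNReal.ofReal |meshFlux 𝒯 v (n * Δt) ((n + 1) * Δt) K L| ≤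
      ENNReal.ofReal (2 * V / (α ^ 2 * h)) * volume (Metric.ball (0 : Rd d) R) := by
  have hα := hS.mesh.alpha_pos
  have hh := hS.mesh.size_pos hS.dim_pos
  have hV := hS.velocity.nonneg hS.T_pos
  set χ : Set (Rd d) → ℝ≥0∞ := (meshInBall 𝒯 R).indicator fun _ => (1 : ℝ≥0∞) with hχ
  set G : 𝒯 → 𝒯 → ℝ≥0∞ := fun K L =>
    ENNReal.ofReal |meshFlux 𝒯 v (n * Δt) ((n + 1) * Δt) K L| with hG
  have hsymm : ∀ K L, G L K = G K L := fun K L => by rw [hG]; simp only [hS.abs_meshFlux_eq K L]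
  have hrow : ∑' K : 𝒯, ∑' L : 𝒯, G K L * χ K.1 ≤
      ENNReal.ofReal (V / (α ^ 2 * h)) * volume (Metric.ball (0 : Rd d) R) := by
    calc ∑' K : 𝒯, ∑' L : 𝒯, G K L * χ K.1
        ≤ ∑' K : 𝒯, ENNReal.ofReal (V / (α ^ 2 * h)) * (χ K.1 * ENNReal.ofReal (α * h ^ d)) := by
          refine ENNReal.tsum_le_tsum fun K => ?_
          rw [ENNReal.tsum_mul_right, mul_comm (χ K.1), ← mul_assoc,
            ← ENNReal.ofReal_mul (by positivity)]
          refine mul_le_mul_left ((hS.tsum_abs_meshFlux_le hn K).trans_eq ?_) _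
          congr 1
          obtain ⟨k, hk⟩ : ∃ k, d = k + 1 := ⟨d - 1, (Nat.succ_pred_eq_of_pos hS.dim_pos).symm⟩
          rw [hk, Nat.add_sub_cancel]
          field_simp
          ring
      _ ≤ _ := by
          rw [ENNReal.tsum_mul_left]
          exact mul_le_mul_right (hS.mesh.tsum_indicator_meshInBall_le R) _
  have hcol : ∑' K : 𝒯, ∑' L : 𝒯, G K L * χ L.1 = ∑' K : 𝒯, ∑' L : 𝒯, G K L * χ K.1 := by
    rw [ENNReal.tsum_comm]
    simp_rw [hsymm]
  calc _ ≤ ∑' K : 𝒯, ∑' L : 𝒯, (G K L * χ K.1 + G K L * χ L.1) := by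
        refine ENNReal.tsum_le_tsum fun K => ?_
        let i : {L // L ∈ neighbors 𝒯 K.1 ∧ (K.1 ∈ meshInBall 𝒯 R ∨ L ∈ meshInBall 𝒯 R)} → 𝒯 :=
          fun L => ⟨L.1, L.2.1.1⟩
        have hi : Function.Injective i := fun L L' hLL => Subtype.ext (congrArg (·.1) hLL)
        refine le_trans (ENNReal.tsum_le_tsum fun L => ?_)
          (ENNReal.tsum_comp_le_tsum_of_injective hi fun L => G K L * χ K.1 + G K L * χ L.1)
        rw [← mul_add]
        refine le_mul_of_one_le_right' ?_
        rcases L.2.2 with h | h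
        · rw [hχ, indicator_of_mem h]; exact le_self_add
        · simp only [i]
          rw [hχ, indicator_of_mem h]; exact le_add_self
    _ = ∑' K : 𝒯, ∑' L : 𝒯, G K L * χ K.1 + ∑' K : 𝒯, ∑' L : 𝒯, G K L * χ K.1 := by
        simp_rw [ENNReal.tsum_add]
        rw [hcol]
    _ ≤ _ := by
        refine (add_le_add hrow hrow).trans_eq ?_
        rw [← add_mul, ← ENNReal.ofReal_add (by positivity) (by positivity)]
        congr 2
        ring

variable [IsProbabilityMeasure P] [SigmaFinite m]

/-- On an outflow interface the upstream value is that of `K`, so the jump vanishes; on an inflow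
interface the weight is the inflow. -/
lemma tsum_neighbors_eq_dissipation
    (hS : IsSchemeSetting P ℱ m N f v η u₀ 𝒯 Δt Nt u T V α h ξ cf cη) (hn : n < Nt) (K : 𝒯) :
    ∑' L : neighbors 𝒯 K.1, surf d (interface K.1 L.1) *
        ENNReal.ofReal |normalVelocity v K.1 L.1 (n * Δt) ((n + 1) * Δt)| *
        ∫⁻ ω, ENNReal.ofReal ((f (uInterface v Δt u n K.1 L.1 ω) - f (u n K.1 ω)) ^ 2) ∂P =
      ENNReal.ofReal (hS.dissipation n K) := by
  rw [tsum_subtype (neighbors 𝒯 K.1) fun L => surf d (interface K.1 L) *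
        ENNReal.ofReal |normalVelocity v K.1 L (n * Δt) ((n + 1) * Δt)| *
        ∫⁻ ω, ENNReal.ofReal ((f (uInterface v Δt u n K.1 L ω) - f (u n K.1 ω)) ^ 2) ∂P,
    tsum_eq_sum (s := hS.nb K.2) fun L hL => indicator_of_notMem
      (fun h => hL ((hS.mem_nb K.2).2 h)) _, dissipation, ENNReal.ofReal_sum_of_nonneg
      fun L _ => mul_nonneg (inflow_nonneg _ _ _ _ _ _) (integral_nonneg fun _ => sq_nonneg _)]
  refine Finset.sum_congr rfl fun L hL => ?_
  have hL' := (hS.mem_nb K.2).1 hL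
  have hσ := hS.mesh.toReal_surf_pos K.2 hL'
  rw [indicator_of_mem hL', hS.mesh.surf_mul_normalVelocity K.2 hL', inflow]
  have hflux : meshFlux 𝒯 v (n * Δt) ((n + 1) * Δt) K L = (surf d (interface K.1 L)).toReal *
    normalVelocity v K.1 L (n * Δt) ((n + 1) * Δt) := if_pos hL'
  simp only [uInterface, upstream]
  split_ifs with h
  · have : 0 ≤ meshFlux 𝒯 v (n * Δt) ((n + 1) * Δt) K L := hflux ▸ mul_nonneg hσ.le h
    simp [max_eq_right (neg_nonpos.2 this)]
  · have hi : Integrable (fun ω => (f (u n L ω) - f (u n K ω)) ^ 2) P :=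
      ((hS.flux.memLp_comp (hS.memLp hn.le hL'.1)).sub
        (hS.flux.memLp_comp (hS.memLp hn.le K.2))).integrable_sq
    have : meshFlux 𝒯 v (n * Δt) ((n + 1) * Δt) K L ≤ 0 :=
      hflux ▸ mul_nonpos_of_nonneg_of_nonpos hσ.le (not_le.1 h).le
    rw [max_eq_left (neg_nonneg.2 this), abs_of_nonpos this,
      ENNReal.ofReal_mul (neg_nonneg.2 this), ofReal_integral_eq_lintegral_ofReal hi
        (Eventually.of_forall fun _ => sq_nonneg _)]

/-- The squared jumps of the flux are summable over the whole mesh. -/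
lemma sum_sq_jump_le (hS : IsSchemeSetting P ℱ m N f v η u₀ 𝒯 Δt Nt u T V α h ξ cf cη)
    (hξ : 0 < ξ) :
    ∑ n ∈ Finset.range Nt, ENNReal.ofReal Δt * ∑' K : 𝒯,
        ∑' L : neighbors 𝒯 K.1, surf d (interface K.1 L.1) *
          ENNReal.ofReal |normalVelocity v K.1 L.1 (n * Δt) ((n + 1) * Δt)| *
          ∫⁻ ω, ENNReal.ofReal ((f (uInterface v Δt u n K.1 L.1 ω) - f (u n K.1 ω)) ^ 2) ∂P ≤
      ENNReal.ofReal (cf / ξ * Real.exp (cη * T) * (∫⁻ ω, ‖u₀ ω‖ₑ ^ 2 ∂P).toReal) := by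
  -- The energy estimate carries a factor `cf` and says nothing when `cf = 0`; in that case `f`
  -- vanishes identically.
  rcases eq_or_lt_of_le (zero_le : 0 ≤ cf) with hcf | hcf
  · have hf : ∀ x, f x = 0 := fun x => by
      have := hS.flux.abs_le x
      rwa [← hcf, NNReal.coe_zero, zero_mul, abs_nonpos_iff] at this
    simp [hf]
  have hΔ := hS.step_pos
  have hsum : ∀ n < Nt, Summable (hS.dissipation n) := fun n hn =>
    (hS.sum_energy_succ_le hcf hξ hn (hS.summable_energy hcf hξ n hn.le)).2.1
  have hterm : ∀ n ∈ Finset.range Nt, ENNReal.ofReal Δt * ∑' K : 𝒯,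
        ∑' L : neighbors 𝒯 K.1, surf d (interface K.1 L.1) *
          ENNReal.ofReal |normalVelocity v K.1 L.1 (n * Δt) ((n + 1) * Δt)| *
          ∫⁻ ω, ENNReal.ofReal ((f (uInterface v Δt u n K.1 L.1 ω) - f (u n K.1 ω)) ^ 2) ∂P =
      ENNReal.ofReal (Δt * ∑' K, hS.dissipation n K) := by
    intro n hn
    have hn' := Finset.mem_range.1 hn
    simp_rw [hS.tsum_neighbors_eq_dissipation hn']
    rw [← ENNReal.ofReal_tsum_of_nonneg (hS.dissipation_nonneg n) (hsum n hn'),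
      ENNReal.ofReal_mul hΔ.le]
  rw [Finset.sum_congr rfl hterm, ← ENNReal.ofReal_sum_of_nonneg fun n _ =>
    mul_nonneg hΔ.le (tsum_nonneg (hS.dissipation_nonneg n)), ← Finset.mul_sum]
  refine ENNReal.ofReal_le_ofReal ?_
  have h1 := hS.sum_dissipation_le hcf hξ
  rw [div_mul_eq_mul_div, div_mul_eq_mul_div, le_div_iff₀ hξ]
  linarith

lemma sum_abs_jump_le (hS : IsSchemeSetting P ℱ m N f v η u₀ 𝒯 Δt Nt u T V α h ξ cf cη)
    (hξ : 0 < ξ) (R : ℝ) :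
    ∑ n ∈ Finset.range Nt, ENNReal.ofReal Δt *
        ∑' K : 𝒯, ∑' L : {L // L ∈ neighbors 𝒯 K.1 ∧
            (K.1 ∈ meshInBall 𝒯 R ∨ L ∈ meshInBall 𝒯 R)},
          surf d (interface K.1 L.1) *
          ENNReal.ofReal |normalVelocity v K.1 L.1 (n * Δt) ((n + 1) * Δt)| *
          ∫⁻ ω, ENNReal.ofReal |f (uInterface v Δt u n K.1 L.1 ω) - f (u n K.1 ω)| ∂P ≤
      ENNReal.ofReal ((cf / ξ * Real.exp (cη * T) * (∫⁻ ω, ‖u₀ ω‖ₑ ^ 2 ∂P).toReal / 2 +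
        T * V * (volume (Metric.ball (0 : Rd d) R)).toReal / α ^ 2) * h ^ (-(1 / 2) : ℝ)) := by
  have hα := hS.mesh.alpha_pos
  have hh := hS.mesh.size_pos hS.dim_pos
  have hV := hS.velocity.nonneg hS.T_pos
  have hΔ := hS.step_pos
  have hT := hS.T_pos
  have hB : volume (Metric.ball (0 : Rd d) R) ≠ ∞ := Metric.isBounded_ball.measure_lt_top.ne
  set A := cf / ξ * Real.exp (cη * T) * (∫⁻ ω, ‖u₀ ω‖ₑ ^ 2 ∂P).toReal with hA
  have hA0 : 0 ≤ A := by positivity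
  set B := (volume (Metric.ball (0 : Rd d) R)).toReal with hBdef
  -- The Young parameter that balances the two parts: the squared jumps contribute order `θ`, the
  -- total flux order `1 / (θ h)`, and these coincide.
  set θ := h ^ (-(1 / 2) : ℝ) with hθ
  have hθ0 : 0 < θ := Real.rpow_pos_of_pos hh _
  have hθ2 : θ ^ 2 * h = 1 := by
    rw [hθ, ← Real.rpow_natCast, ← Real.rpow_mul hh.le, ← Real.rpow_add_one hh.ne']
    norm_num
  let Q : ℕ → 𝒯 → Set (Rd d) → ℝ≥0∞ := fun n K L => surf d (interface K.1 L) *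
    ENNReal.ofReal |normalVelocity v K.1 L (n * Δt) ((n + 1) * Δt)| *
      ∫⁻ ω, ENNReal.ofReal ((f (uInterface v Δt u n K.1 L ω) - f (u n K.1 ω)) ^ 2) ∂P
  have hstep : ∀ n ∈ Finset.range Nt, ENNReal.ofReal Δt *
        ∑' K : 𝒯, ∑' L : {L // L ∈ neighbors 𝒯 K.1 ∧
            (K.1 ∈ meshInBall 𝒯 R ∨ L ∈ meshInBall 𝒯 R)},
          surf d (interface K.1 L.1) *
          ENNReal.ofReal |normalVelocity v K.1 L.1 (n * Δt) ((n + 1) * Δt)| *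
          ∫⁻ ω, ENNReal.ofReal |f (uInterface v Δt u n K.1 L.1 ω) - f (u n K.1 ω)| ∂P ≤
      ENNReal.ofReal (θ / 2) * (ENNReal.ofReal Δt * ∑' K : 𝒯, ∑' L : neighbors 𝒯 K.1, Q n K L) +
        ENNReal.ofReal (Δt * (1 / (2 * θ) * (2 * V / (α ^ 2 * h) * B))) := by
    intro n hn
    rw [ENNReal.ofReal_mul hΔ.le, mul_left_comm, ← mul_add]
    refine mul_le_mul_right ?_ _
    calc _ ≤ ∑' K : 𝒯, ∑' L : {L // L ∈ neighbors 𝒯 K.1 ∧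
            (K.1 ∈ meshInBall 𝒯 R ∨ L ∈ meshInBall 𝒯 R)}, (ENNReal.ofReal (θ / 2) * Q n K L +
            ENNReal.ofReal (1 / (2 * θ)) *
              ENNReal.ofReal |meshFlux 𝒯 v (n * Δt) ((n + 1) * Δt) K L|) := by
          refine ENNReal.tsum_le_tsum fun K => ENNReal.tsum_le_tsum fun L => ?_
          simp only [Q]
          rw [hS.mesh.surf_mul_normalVelocity K.2 L.2.1, mul_left_comm, mul_comm
            (ENNReal.ofReal (1 / (2 * θ))), ← mul_add]
          exact mul_le_mul_right (lintegral_ofReal_abs_le P _ hθ0) _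
      _ = ENNReal.ofReal (θ / 2) * ∑' K : 𝒯, ∑' L : {L // L ∈ neighbors 𝒯 K.1 ∧
            (K.1 ∈ meshInBall 𝒯 R ∨ L ∈ meshInBall 𝒯 R)}, Q n K L +
          ENNReal.ofReal (1 / (2 * θ)) * ∑' K : 𝒯, ∑' L : {L // L ∈ neighbors 𝒯 K.1 ∧
            (K.1 ∈ meshInBall 𝒯 R ∨ L ∈ meshInBall 𝒯 R)},
              ENNReal.ofReal |meshFlux 𝒯 v (n * Δt) ((n + 1) * Δt) K L| := by
          simp_rw [ENNReal.tsum_add, ENNReal.tsum_mul_left]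
      _ ≤ _ := by
          refine add_le_add (mul_le_mul_right (ENNReal.tsum_le_tsum fun K => ?_) _) ?_
          · exact ENNReal.tsum_mono_subtype (Q n K) (s := {L | L ∈ neighbors 𝒯 K.1 ∧
              (K.1 ∈ meshInBall 𝒯 R ∨ L ∈ meshInBall 𝒯 R)}) fun L hL => hL.1
          · rw [ENNReal.ofReal_mul (by positivity), ENNReal.ofReal_mul (by positivity), hBdef,
              ENNReal.ofReal_toReal hB]
            exact mul_le_mul_right
              (hS.tsum_abs_meshFlux_meshInBall_le (Finset.mem_range.1 hn) R) _
  refine (Finset.sum_le_sum hstep).trans ?_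
  rw [Finset.sum_add_distrib, ← Finset.mul_sum, Finset.sum_const, Finset.card_range, nsmul_eq_mul,
    ← ENNReal.ofReal_natCast, ← ENNReal.ofReal_mul (Nat.cast_nonneg _)]
  refine (add_le_add_left (mul_le_mul_right (hS.sum_sq_jump_le hξ) _) _).trans ?_
  rw [← ENNReal.ofReal_mul (by positivity), ← ENNReal.ofReal_add (by positivity) (by positivity),
    ← mul_assoc (Nt : ℝ), hS.Nt_mul]
  refine (congrArg ENNReal.ofReal ?_).le
  have h1 : 1 / (2 * θ) * (2 * V / (α ^ 2 * h) * B) = V * B / α ^ 2 * θ := by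
    field_simp
    linear_combination (-(V * B)) * hθ2
  rw [h1]
  ring

end IsSchemeSetting

end FVScheme

/-- Weak BV estimate. The sums are taken in `[0,∞]` and expectations are integrals of nonnegative
functions, so the bounds include their finiteness. In the second part, the interfaces of `𝒯_R` are
the `K|L` with `K ∈ 𝒯_R` or `L ∈ 𝒯_R`, and each is counted from both of its sides, one of the two
terms being zero; the bound therefore holds whichever side is chosen for each interface. -/
theorem mainTheorem7 {d : ℕ} (hd : 0 < d) {Ω : Type*} [mΩ : MeasurableSpace Ω]
    (P : Measure Ω) [IsProbabilityMeasure P]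
    (u₀ : Ω → Lp ℝ 2 (volume : Measure (Rd d))) (hu₀ : ∫⁻ ω, ‖u₀ ω‖ₑ ^ 2 ∂P < ∞)
    (T : ℝ) (hT : 0 < T) (ξ : ℝ) (hξ : ξ ∈ Ioo (0 : ℝ) 1) (cf : ℝ≥0) (cη : ℝ) :
    (∃ C : ℝ, 0 < C ∧
      ∀ (V α h : ℝ) (ℱ : Filtration ℝ≥0 mΩ) (E : Type*) [MeasurableSpace E]
        (m : Measure E) [SigmaFinite m] (N : Ω → Measure (ℝ × E))
        (f : ℝ → ℝ) (v : ℝ → Rd d → Rd d) (η : ℝ → E → ℝ)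
        (𝒯 : Set (Set (Rd d))) (Nt : ℕ) (Δt : ℝ) (u : ℕ → Set (Rd d) → Ω → ℝ),
        UsualConditions P ℱ → StronglyMeasurable[ℱ 0] u₀ → IsPoissonNoise P ℱ m N →
        FluxAssumption f cf → VelocityAssumption v T V → NoiseAssumption m η cη →
        IsAdmissibleMesh 𝒯 α h → 0 < Nt → Δt = T / Nt →
        Δt * (cf * V) ≤ (1 - ξ) * α ^ 2 * h →
        IsUpwindSolution P ℱ m N f v η u₀ 𝒯 Δt Nt u →
        ∑' K : 𝒯, ∑ n ∈ Finset.range Nt, ENNReal.ofReal Δt *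
          ∑' L : neighbors 𝒯 K.1, surf d (interface K.1 L.1) *
            ENNReal.ofReal |normalVelocity v K.1 L.1 (n * Δt) ((n + 1) * Δt)| *
            ∫⁻ ω, ENNReal.ofReal ((f (uInterface v Δt u n K.1 L.1 ω) - f (u n K.1 ω)) ^ 2) ∂P
          ≤ ENNReal.ofReal C) ∧
    (∀ R V α : ℝ, 0 < R → ∃ C₁ : ℝ, 0 < C₁ ∧
      ∀ (h : ℝ) (ℱ : Filtration ℝ≥0 mΩ) (E : Type*) [MeasurableSpace E]
        (m : Measure E) [SigmaFinite m] (N : Ω → Measure (ℝ × E))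
        (f : ℝ → ℝ) (v : ℝ → Rd d → Rd d) (η : ℝ → E → ℝ)
        (𝒯 : Set (Set (Rd d))) (Nt : ℕ) (Δt : ℝ) (u : ℕ → Set (Rd d) → Ω → ℝ),
        UsualConditions P ℱ → StronglyMeasurable[ℱ 0] u₀ → IsPoissonNoise P ℱ m N →
        FluxAssumption f cf → VelocityAssumption v T V → NoiseAssumption m η cη →
        IsAdmissibleMesh 𝒯 α h → 0 < Nt → Δt = T / Nt →
        Δt * (cf * V) ≤ (1 - ξ) * α ^ 2 * h →
        IsUpwindSolution P ℱ m N f v η u₀ 𝒯 Δt Nt u → h < R →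
        ∑ n ∈ Finset.range Nt, ENNReal.ofReal Δt *
          ∑' K : 𝒯, ∑' L : {L // L ∈ neighbors 𝒯 K.1 ∧
              (K.1 ∈ meshInBall 𝒯 R ∨ L ∈ meshInBall 𝒯 R)},
            surf d (interface K.1 L.1) *
            ENNReal.ofReal |normalVelocity v K.1 L.1 (n * Δt) ((n + 1) * Δt)| *
            ∫⁻ ω, ENNReal.ofReal |f (uInterface v Δt u n K.1 L.1 ω) - f (u n K.1 ω)| ∂P
          ≤ ENNReal.ofReal (C₁ * h ^ (-(1 / 2) : ℝ))) := by
  set A := cf / ξ * Real.exp (cη * T) * (∫⁻ ω, ‖u₀ ω‖ₑ ^ 2 ∂P).toReal with hA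
  have hξ0 : 0 < ξ := hξ.1
  have hA0 : 0 ≤ A := by positivity
  -- The added `1` makes the constants strictly positive. The second one is fixed before `V` is
  -- known to bound a velocity, hence the absolute value.
  refine ⟨⟨A + 1, by positivity, ?_⟩, fun R V α hR =>
    ⟨A / 2 + T * |V| * (volume (Metric.ball (0 : Rd d) R)).toReal / α ^ 2 + 1, by positivity, ?_⟩⟩
  · intro V α h ℱ E _ m _ N f v η 𝒯 Nt Δt u hU hu₀m hN hf hv hη hM hNt hΔ hCFL hu
    have hS : IsSchemeSetting P ℱ m N f v η u₀ 𝒯 Δt Nt u T V α h ξ cf cη :=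
      ⟨hd, hT, hu₀, hU, hu₀m, hN, hf, hv, hη, hM, hNt, hΔ, hCFL, hu⟩
    rw [Summable.tsum_finsetSum fun n _ => ENNReal.summable]
    simp_rw [ENNReal.tsum_mul_left]
    exact (hS.sum_sq_jump_le hξ0).trans (ENNReal.ofReal_le_ofReal (by linarith))
  · intro h ℱ E _ m _ N f v η 𝒯 Nt Δt u hU hu₀m hN hf hv hη hM hNt hΔ hCFL hu _
    have hS : IsSchemeSetting P ℱ m N f v η u₀ 𝒯 Δt Nt u T V α h ξ cf cη :=
      ⟨hd, hT, hu₀, hU, hu₀m, hN, hf, hv, hη, hM, hNt, hΔ, hCFL, hu⟩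
    rw [abs_of_nonneg (hv.nonneg hT)]
    refine (hS.sum_abs_jump_le hξ0 R).trans (ENNReal.ofReal_le_ofReal
      (mul_le_mul_of_nonneg_right (by linarith) (Real.rpow_nonneg (hM.size_pos hd).le _)))
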